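/- Encode the nonempty faces of the $n$-cube $[-1,1]^n$ by sign vectors $\sigma\in\{0,\pm1\}^n$ (the dimension is the number of zeros; faces of $\sigma$ arise by replacing zeros by $\pm1$). For a simplicial complex $\Delta$ on $\{1,\dots,n\}$ (with $\emptyset\in\Delta$) its mirror complex is the subcomplex $\mathcal M(\Delta)=\{\sigma : \{i:\sigma_i=0\}\in\Delta\}$ of the $n$-cube. Let $Q_n$ be the boundary complex of the $n$-gon with vertices $1,\dots,n$ in cyclic order, and let $T_n$ be its pulling triangulation with respect to the vertex $n$ (the cone with apex $n$ over the faces of $Q_n$ not containing $n$). Let $\mathcal S_3(4)$ be the boundary complex of the $4$-cube, and for $k\ge 4$ let $$\mathcal S_3(k+1)=\bigl(\mathcal M(T_k)\times\{+1\}\bigr)\cup\bigl((\mathcal M(T_k)\cap C_k)\times\{0\}\bigr)\cup\bigl(C_k\times\{-1\}\bigr),$$ where $C_k$ is the subcomplex generated by the facets of $\mathcal S_3(k)$ that are not in $\mathcal M(T_k)$. Let $\mathrm{NCP}_4(q)$, $q\ge4$, denote the neighborly cubical polytope: a $4$-dimensional convex polytope with $2^q$ vertices labelled by $\{\pm1\}^q$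 whose facets are the convex hulls of the vertex sets of those cube faces $\alpha\in\{0,\pm1\}^q$ with exactly $3$ zeros that satisfy, with $t$ the number of leading nonzero entries of $\alpha$, one of the following conditions: - $t=0$, and between any two nonzero entries of $\alpha$ there is an even number of zeros; - $0<t<q-3$ and $\alpha=(-1,+1,\dots,(-1)^{t-1},\sigma,0,\beta)$ with $\sigma\in\{\pm1\}$, where between any two nonzero entries of $\beta$ there is an even number of zeros, and $\beta$ starts with an even number of zeros if $\sigma=(-1)^{t+1}$ and with an odd number of zeros if $\sigma=(-1)^{t}$; - $t=q-3$ and $\alpha=(-1,+1,\dots,(-1)^{t-1},\sigma,0,0,0)$ with $\sigma\in\{\pm1\}$. Then the following hold. (1) For every $q\ge 3$ the mirror complex $\mathcal M(Q_q)$ is an equivelar surface $\mathcal M_{4,q}$, i.e. a connected closed polyhedral surface in which all $2$-faces are quadrilaterals and all vertices have degree $q$. It is orientable, has $f$-vector $(2^q,\,2^{q-1}q,\,2^{q-2}q)$, and has genus $g(q)=1+2^{q-3}(q-4)$. With $n=2^q$ the number of its vertices, $g(q)=O(n\log n)$ as $q\to\infty$. (2) For every $q\ge 4$ the complex $\mathcal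 S_3(q)$ contains the $1$-skeleton of the $q$-cube, and both $\mathcal M(Q_q)$ and $\mathcal M(T_q)$ are subcomplexes of $\mathcal S_3(q)$. (3) For every $q\ge 4$ the polytope $\mathrm{NCP}_4(q)$ exists. For each of its realizations $P\subset\mathbb R^4$, the relabelling $(\alpha_1,\dots,\alpha_q)\mapsto(\alpha_q,-\alpha_{q-1},\dots,(-1)^{q+1}\alpha_1)$ identifies $\mathcal S_3(q)$ with the boundary complex $\partial P$ (so $\mathcal S_3(q)$ is a polytopal, neighborly cubical $3$-sphere), and hence $\mathcal M(Q_q)$ with a subcomplex of $\partial P$. (4) Every such $P$ has a Schlegel diagram, and in every Schlegel diagram of $P$ (central projection from a point beyond a facet $F$ to the hyperplane of $F$, identified affinely with $\mathbb R^3$) the image of $\mathcal M(Q_q)$ is a subcomplex that embeds $\mathcal M(Q_q)$ with straight faces in $\mathbb R^3$: every face is mapped to a convex polytope of the same dimension whose faces are the images of its faces, distinct faces have distinct images, and any two image faces meet exactly in the convex hull of the images of their common vertices. -/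

import Mathlib

/-! ### Sign vectors and subcomplexes of the cube -/

/-- Sign vectors of length `n`; they encode the nonempty faces of the cube `[-1,1]^n`. -/
abbrev SignVec (n : ℕ) : Type := Fin n → SignType

namespace SignVec

/-- The positions of the zeros: the directions in which the cube face extends. -/
def zeroSet {n : ℕ} (σ : SignVec n) : Finset (Fin n) :=
  Finset.univ.filter (fun i => σ i = 0)

/-- The dimension of the cube face encoded by `σ`. -/
def dim {n : ℕ} (σ : SignVec n) : ℕ := (zeroSet σ).card

/-- `IsFace α β`: the cube face encoded by `α` is contained in the one encoded by `β`. -/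
def IsFace {n : ℕ} (α β : SignVec n) : Prop := ∀ i, β i = 0 ∨ α i = β i

/-- The vertices of the cube are the sign vectors without zeros. -/
def IsVertex {n : ℕ} (ε : SignVec n) : Prop := ∀ i, ε i ≠ 0

/-- The vertices of the cube lying on the face `α`. -/
def verts {n : ℕ} (α : SignVec n) : Set (SignVec n) := {ε | IsVertex ε ∧ IsFace ε α}

/-- Inverting the order of the entries and then flipping the sign of every second entry:
`(α₁, …, αₙ) ↦ (αₙ, -αₙ₋₁, …, (-1)ⁿ⁺¹ α₁)`. -/
def reverseFlip {n : ℕ} (α : SignVec n) : SignVec n :=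
  fun i => (-1 : SignType) ^ (i : ℕ) * α (Fin.rev i)

end SignVec

open SignVec

/-- A set of sign vectors is a (cubical) complex if it is closed under passing to faces. -/
def IsCubicalComplex {n : ℕ} (C : Set (SignVec n)) : Prop :=
  ∀ β ∈ C, ∀ α, IsFace α β → α ∈ C

/-- `C` is a subcomplex of the cubical complex `D`. -/
def IsSubcomplex {n : ℕ} (C D : Set (SignVec n)) : Prop :=
  IsCubicalComplex C ∧ IsCubicalComplex D ∧ C ⊆ D

/-- The number of `k`-dimensional faces. -/
noncomputable def faceCount {n : ℕ} (C : Set (SignVec n)) (k : ℕ) : ℕ :=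
  {α | α ∈ C ∧ dim α = k}.ncard

/-- The boundary complex of the `n`-cube: all nonempty proper faces. -/
def cubeBoundary (n : ℕ) : Set (SignVec n) := {σ | ∃ i, σ i ≠ 0}

/-- A subcomplex of the `n`-cube is cubically `k`-neighborly if it has the `(k-1)`-skeleton
of the `n`-cube. -/
def IsCubicallyNeighborly {n : ℕ} (k : ℕ) (C : Set (SignVec n)) : Prop :=
  ∀ α : SignVec n, dim α < k → α ∈ C

/-! ### Polygons, pulling triangulations, mirroring, fissuring -/

/-- The boundary of the `n`-gon with vertices `0, …, n-1` in cyclic order, as an abstract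
simplicial complex (the empty face included). -/
def polygonBoundary (n : ℕ) : Set (Finset (Fin n)) :=
  {F | ∃ i : Fin n, F ⊆ {i, finRotate n i}}

/-- The pulling triangulation with respect to the vertex `v` of a simplicial polytope with
boundary complex `Δ`: the cone with apex `v` over the faces that do not contain `v`. -/
def pullingTriangulation {n : ℕ} (Δ : Set (Finset (Fin n))) (v : Fin n) :
    Set (Finset (Fin n)) :=
  {F | ∃ G ∈ Δ, v ∉ G ∧ F ⊆ insert v G}

/-- The pulling triangulation of the `n`-gon with respect to its last vertex. -/
def polygonTriangulation : (n : ℕ) → Set (Finset (Fin n))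
  | 0 => ∅
  | n + 1 => pullingTriangulation (polygonBoundary (n + 1)) (Fin.last n)

/-- The mirror complex of a simplicial complex on `n` vertices, a subcomplex of the `n`-cube. -/
def mirrorComplex {n : ℕ} (Δ : Set (Finset (Fin n))) : Set (SignVec n) :=
  {σ | zeroSet σ ∈ Δ}

/-- The subcomplex of `C` generated by the facets (maximal faces) of `C` not lying in `C₁`. -/
def complementComplex {n : ℕ} (C C₁ : Set (SignVec n)) : Set (SignVec n) :=
  {α | ∃ β ∈ C, (∀ γ ∈ C, IsFace β γ → γ = β) ∧ β ∉ C₁ ∧ IsFace α β}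

/-- The cubical fissure between `C₁` and `C₂`:
`(C₁ × {+1}) ∪ ((C₁ ∩ C₂) × {0}) ∪ (C₂ × {-1})`. -/
def fissure {n : ℕ} (C₁ C₂ : Set (SignVec n)) : Set (SignVec (n + 1)) :=
  {α | ((Fin.init α : SignVec n) ∈ C₁ ∧ α (Fin.last n) = 1) ∨
       ((Fin.init α : SignVec n) ∈ C₁ ∩ C₂ ∧ α (Fin.last n) = 0) ∨
       ((Fin.init α : SignVec n) ∈ C₂ ∧ α (Fin.last n) = -1)}

/-- The Babson-Billera-Chan construction from a sequence of `(d-1)`-balls `T i` with `i`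
vertices. It starts at `n = d + 1` with the boundary of the `(d+1)`-cube and produces the
complex for `n + 1` by fissuring the one for `n` along the mirror complex of `T n`.
(For `n ≤ d` the construction is not defined; the value is the empty complex.) -/
def bbcComplex (d : ℕ) (T : (n : ℕ) → Set (Finset (Fin n))) : (n : ℕ) → Set (SignVec n)
  | 0 => ∅
  | n + 1 =>
      if n < d then ∅
      else if n = d then cubeBoundary (n + 1)
      else fissure (mirrorComplex (T n))
        (complementComplex (bbcComplex d T n) (mirrorComplex (T n)))

/-- The neighborly cubical `3`-sphere with the graph of the `q`-cube built from the pulling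
triangulations of polygons. -/
def neighborlyCubicalSphere (q : ℕ) : Set (SignVec q) := bbcComplex 3 polygonTriangulation q

/-! ### Polyhedral surfaces, orientability, genus -/

/-- The vertex figure of `C` at `ε` (in dimension at most two): its nodes are the edges of `C`
at `ε`, its edges are the `2`-faces of `C` at `ε`. -/
def vertexFigure {n : ℕ} (C : Set (SignVec n)) (ε : SignVec n) :
    SimpleGraph {e : SignVec n // e ∈ C ∧ dim e = 1 ∧ IsFace ε e} where
  Adj e e' := e ≠ e' ∧ ∃ α ∈ C, dim α = 2 ∧ IsFace e.1 α ∧ IsFace e'.1 α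
  symm := ⟨fun _ _ ⟨h, α, hα, h2, h3, h4⟩ => ⟨h.symm, α, hα, h2, h4, h3⟩⟩
  loopless := ⟨fun _ h => h.1 rfl⟩

/-- The graph (`1`-skeleton) of `C`. -/
def skeletonGraph {n : ℕ} (C : Set (SignVec n)) :
    SimpleGraph {ε : SignVec n // ε ∈ C ∧ IsVertex ε} where
  Adj ε ε' := ε ≠ ε' ∧ ∃ e ∈ C, dim e = 1 ∧ IsFace ε.1 e ∧ IsFace ε'.1 e
  symm := ⟨fun _ _ ⟨h, e, he, h2, h3, h4⟩ => ⟨h.symm, e, he, h2, h4, h3⟩⟩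
  loopless := ⟨fun _ h => h.1 rfl⟩

/-- A polyhedral surface in the cube: a connected `2`-dimensional complex that is a closed
`2`-manifold, i.e. all of whose vertex figures are cycles. -/
structure IsPolyhedralSurface {n : ℕ} (C : Set (SignVec n)) : Prop where
  complex : IsCubicalComplex C
  dim_le : ∀ α ∈ C, dim α ≤ 2
  vertexFigure_cycle : ∀ ε ∈ C, IsVertex ε →
    ∃ k, 3 ≤ k ∧ Nonempty (vertexFigure C ε ≃g SimpleGraph.cycleGraph k)
  connected : (skeletonGraph C).Connected

/-- An equivelar surface of type `{p, q}`: all `2`-faces are `p`-gons and all vertices have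
degree `q`. -/
structure IsEquivelarSurface {n : ℕ} (p q : ℕ) (C : Set (SignVec n)) : Prop where
  surface : IsPolyhedralSurface C
  gon : ∀ α ∈ C, dim α = 2 → (verts α).ncard = p
  degree : ∀ ε ∈ C, IsVertex ε → {e | e ∈ C ∧ dim e = 1 ∧ IsFace ε e}.ncard = q

/-- The incidence number of the oriented cube face `α` and its facet `e` (each oriented by the
order of the coordinates): the sum below has the single term belonging to the
coordinate `i` which is fixed on `e` but not on `α`. -/
def incidence {n : ℕ} (α e : SignVec n) : ℤ :=
  ∑ i : Fin n, if α i = 0 ∧ e i ≠ 0 then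
    (-1) ^ (Finset.univ.filter (fun j => j < i ∧ α j = 0)).card * ((e i : SignType) : ℤ) else 0

/-- A polyhedral surface is orientable if its `2`-faces can be oriented such that any two of
them sharing an edge induce opposite orientations on it. -/
def IsOrientable {n : ℕ} (C : Set (SignVec n)) : Prop :=
  ∃ o : SignVec n → ℤ, (∀ α ∈ C, dim α = 2 → o α = 1 ∨ o α = -1) ∧
    ∀ α ∈ C, ∀ β ∈ C, ∀ e ∈ C, dim α = 2 → dim β = 2 → dim e = 1 → α ≠ β →
      IsFace e α → IsFace e β → o α * incidence α e = -(o β * incidence β e)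

/-- `C` is a (connected, closed) orientable polyhedral surface of genus `g`. -/
def HasGenus {n : ℕ} (C : Set (SignVec n)) (g : ℕ) : Prop :=
  IsPolyhedralSurface C ∧ IsOrientable C ∧
    (faceCount C 0 : ℤ) - faceCount C 1 + faceCount C 2 = 2 - 2 * g

/-! ### Convex polytopes -/

section Polytopes

variable {E : Type*} [NormedAddCommGroup E] [NormedSpace ℝ E]

/-- Nonempty proper faces of `P`: nonempty proper subsets cut out by supporting hyperplanes. -/
def IsProperFace (P G : Set E) : Prop := IsExposed ℝ P G ∧ G.Nonempty ∧ G ≠ P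

/-- Facets of `P`: maximal proper faces. -/
def IsFacet (P F : Set E) : Prop := Maximal (fun G => IsProperFace P G) F

/-- The convex hull of the images, under the vertex map `u`, of the vertices of the
cube face `α`. -/
def cell {n : ℕ} (u : SignVec n → E) (α : SignVec n) : Set E := convexHull ℝ (u '' verts α)

/-- Via the vertex map `u`, the complex `C` is a subcomplex of the boundary complex of `P`. -/
structure IsBoundarySubcomplex {n : ℕ} (C : Set (SignVec n)) (P : Set E)
    (u : SignVec n → E) : Prop where
  face : ∀ α ∈ C, IsProperFace P (cell u α)
  le_iff : ∀ α ∈ C, ∀ β ∈ C, cell u α ⊆ cell u β ↔ IsFace α β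
  lower : ∀ α ∈ C, ∀ G, IsProperFace P G → G ⊆ cell u α → ∃ γ ∈ C, G = cell u γ

/-- Via the vertex map `u`, the complex `C` is isomorphic to the whole boundary complex of `P`. -/
structure IsBoundaryComplex {n : ℕ} (C : Set (SignVec n)) (P : Set E)
    (u : SignVec n → E) : Prop extends IsBoundarySubcomplex C P u where
  surj : ∀ G, IsProperFace P G → ∃ α ∈ C, G = cell u α

/-- The vertex map `w` embeds `C` with straight faces: each face `α` of `C` is sent to a convex
polytope of the same dimension, whose nonempty faces are the images of the faces of `α`,
distinct faces have distinct images, and the images of two faces meet exactly in the convex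
hull of their common vertices. -/
structure IsStraightEmbedding {n : ℕ} (C : Set (SignVec n)) (w : SignVec n → E) : Prop where
  injOn : Set.InjOn (cell w) C
  dim_eq : ∀ α ∈ C, Module.finrank ℝ (vectorSpan ℝ (cell w α)) = dim α
  faces : ∀ α ∈ C, ∀ G : Set E,
    (IsExposed ℝ (cell w α) G ∧ G.Nonempty) ↔ ∃ γ, IsFace γ α ∧ G = cell w γ
  inter : ∀ α ∈ C, ∀ β ∈ C,
    cell w α ∩ cell w β = convexHull ℝ (w '' (verts α ∩ verts β))

/-- `y` is a point beyond the facet `F` of `P`, where `F` is cut out by the valid inequality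
`l ≤ c`: it violates this inequality and strictly satisfies those of all other facets. -/
structure IsBeyondFacet (P F : Set E) (l : StrongDual ℝ E) (c : ℝ) (y : E) : Prop where
  facet : IsFacet P F
  valid : ∀ x ∈ P, l x ≤ c
  cut : F = {x | x ∈ P ∧ l x = c}
  beyond : c < l y
  beneath : ∀ (G : Set E) (l' : StrongDual ℝ E) (c' : ℝ), IsFacet P G → G ≠ F →
    (∀ x ∈ P, l' x ≤ c') → G = {x | x ∈ P ∧ l' x = c'} → l' y < c'

/-- The central projection from `y` to the hyperplane `l = c`. -/
noncomputable def schlegelProjection (l : StrongDual ℝ E) (c : ℝ) (y x : E) : E :=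
  y + ((c - l y) / (l x - l y)) • (x - y)

/-- The Schlegel diagram of `P` based at the facet `F` (cut out by `l ≤ c`) with center of
projection `y`: the images of all nonempty proper faces other than `F`. It lies in the
hyperplane `l = c`. -/
def schlegelDiagram (P F : Set E) (l : StrongDual ℝ E) (c : ℝ) (y : E) : Set (Set E) :=
  {D | ∃ G, IsProperFace P G ∧ G ≠ F ∧ D = schlegelProjection l c y '' G}

end Polytopes

/-! ### Neighborly cubical polytopes -/

/-- From position `s` on, there is an even number of zeros between any two nonzero entries. -/
def GaleEvenFrom {n : ℕ} (α : SignVec n) (s : ℕ) : Prop :=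
  ∀ i j : Fin n, s ≤ (i : ℕ) → i < j → α i ≠ 0 → α j ≠ 0 →
    Even (Finset.univ.filter (fun k => i < k ∧ k < j ∧ α k = 0)).card

/-- The number of zeros with which the part of `α` from position `s` on starts. -/
def startZeros {n : ℕ} (α : SignVec n) (s : ℕ) : ℕ :=
  (Finset.univ.filter
    (fun k : Fin n => s ≤ (k : ℕ) ∧ ∀ j : Fin n, s ≤ (j : ℕ) → j ≤ k → α j = 0)).card

/-- The Cubical Gale Evenness Condition, describing the facets of the neighborly cubical
polytope of dimension `d + 1` with the graph of the `n`-cube. Positions are counted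
from `0`; `t` is the number of leading nonzero entries and `σ` is the last of these. -/
def CubicalGale {n : ℕ} (d : ℕ) (α : SignVec n) : Prop :=
  dim α = d ∧
  (((∀ i : Fin n, (i : ℕ) = 0 → α i = 0) ∧ GaleEvenFrom α 0) ∨
   (∃ (t : ℕ) (σ : SignType), 0 < t ∧ t < n - d ∧ σ ≠ 0 ∧
      (∀ i : Fin n, (i : ℕ) + 1 < t → α i = (-1) ^ ((i : ℕ) + 1)) ∧
      (∀ i : Fin n, (i : ℕ) + 1 = t → α i = σ) ∧
      (∀ i : Fin n, (i : ℕ) = t → α i = 0) ∧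
      GaleEvenFrom α (t + 1) ∧
      (σ = (-1) ^ (t + 1) → Even (startZeros α (t + 1))) ∧
      (σ = (-1) ^ t → Odd (startZeros α (t + 1)))) ∨
   (∃ σ : SignType, σ ≠ 0 ∧
      (∀ i : Fin n, (i : ℕ) + 1 < n - d → α i = (-1) ^ ((i : ℕ) + 1)) ∧
      (∀ i : Fin n, (i : ℕ) + 1 = n - d → α i = σ) ∧
      (∀ i : Fin n, n - d ≤ (i : ℕ) → α i = 0)))

/-- `P` is (a realization in `ℝ^(d+1)` of) the neighborly cubical polytope `NCP_{d+1}(n)`: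
a full-dimensional polytope whose `2^n` distinct vertices are labelled by `v` with the
vertices of the `n`-cube in such a way that its facets are precisely those given
by the Cubical Gale Evenness Condition. -/
structure IsNeighborlyCubicalPolytope (d n : ℕ) (P : Set (EuclideanSpace ℝ (Fin (d + 1))))
    (v : SignVec n → EuclideanSpace ℝ (Fin (d + 1))) : Prop where
  hull : P = convexHull ℝ (v '' {ε | IsVertex ε})
  injOn : Set.InjOn v {ε | IsVertex ε}
  vertices : P.extremePoints ℝ = v '' {ε | IsVertex ε}
  full : (interior P).Nonempty
  facets : {F | IsFacet P F} = cell v '' {α | CubicalGale d α}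

/-! ### Elementary facts on sign vectors -/

namespace SignVec

variable {n : ℕ}

/-! The sphere is controlled by its facets. A face common to a facet of S_3(n) inside M(T_n) and to
one outside it lies in M(Q_n), and conversely every 2-face of M(Q_n) lies in facets of both kinds.
Hence the facets of S_3(n+1) are those of S_3(n) with a last entry +1 (inside M(T_n)) or -1
(outside), together with the 2-faces of M(Q_n) with last entry 0 (`mem_sphereFacets_succ`,
`mem_neighborlyCubicalSphere`). Unrolling the recursion gives a closed form (`mem_sphereFacets_iff`)
that `reverseFlip` turns into the Cubical Gale Evenness Condition.

Existence of the polytope is proved on the dual side, by building its normal fan. On ℝ⁴ there are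
continuous piecewise linear functions g_1, ..., g_q whose sign vectors at nonzero points are exactly
the faces of S_3(q), together with a support function h whose maximizers among the points v(ε) at x
are the vertices of the sign vector of x (`IsSignFan`). For q = 4 these are the coordinates and the
ℓ¹-norm. Fissuring corresponds to adjoining g_{q+1} = Σ c_j |g_j|, with c chosen so that g_{q+1} is
positive on the rays in M(T_q) and negative on all other rays (`IsSignFan.exists_separating`). By
linearity on cones its zero set then crosses exactly the 2-faces of M(Q_q) among the two-dimensional
sign vectors. A large multiple of h plus |g_{q+1}| is again a support function of the required kind
(`IsSignFan.extend`).

An arbitrary realization is known only through its facets. Since every face set is cut out by facets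
(`IsFaceSet.exists_facetSet`), and every cube face in the sphere is an intersection of facets, its
boundary complex must be S_3(q) (`IsSpherePolytope.isBoundaryComplex`). The fan serves again here,
to show that every ridge lies in a second facet.

For Schlegel diagrams, a face of dimension at most 2 lies in some facet other than F. Seen from the
centre y such a facet is on the far side of P, so the projection is injective on the union of these
facets (`IsBeneath.schlegelProjection_inj`). Supporting inequalities transfer in both directions
along the projection, and dimensions follow by counting along chains of faces.

The surface statements come from the zero sets alone: vertex figures of M(Q_q) are copies of the
q-gon, face numbers are face numbers of the polygon times powers of 2, and the product of the
nonzero entries, corrected on the faces with zero set {1, q}, orients the 2-faces. -/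

theorem mem_zeroSet {σ : SignVec n} {x : Fin n} : x ∈ zeroSet σ ↔ σ x = 0 := by
  simp [zeroSet]

theorem IsFace.refl (α : SignVec n) : IsFace α α := fun _ => Or.inr rfl

theorem IsFace.trans {α β γ : SignVec n} (h : IsFace α β) (h' : IsFace β γ) : IsFace α γ := by
  intro i
  rcases h' i with h0 | h0
  · exact Or.inl h0
  · rcases h i with h1 | h1
    · exact Or.inl (h0 ▸ h1)
    · exact Or.inr (h1.trans h0)

theorem IsFace.antisymm {α β : SignVec n} (h : IsFace α β) (h' : IsFace β α) : α = β := by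
  funext i
  rcases h i with h0 | h0
  · rcases h' i with h1 | h1
    · rw [h0, h1]
    · exact h1.symm
  · exact h0

theorem IsFace.zeroSet_subset {α β : SignVec n} (h : IsFace α β) : zeroSet α ⊆ zeroSet β := by
  intro i hi
  rw [mem_zeroSet] at hi ⊢
  rcases h i with h0 | h0
  · exact h0
  · rw [← h0, hi]

theorem IsFace.apply_eq_zero {α β : SignVec n} (h : IsFace α β) {i : Fin n} (hi : α i = 0) :
    β i = 0 := mem_zeroSet.1 (h.zeroSet_subset (mem_zeroSet.2 hi))

theorem IsFace.dim_le {α β : SignVec n} (h : IsFace α β) : dim α ≤ dim β :=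
  Finset.card_le_card h.zeroSet_subset

theorem IsFace.eq_of_zeroSet {α β : SignVec n} (h : IsFace α β) (h' : zeroSet β ⊆ zeroSet α) :
    α = β := by
  funext i
  rcases h i with h0 | h0
  · rw [h0, mem_zeroSet.1 (h' (mem_zeroSet.2 h0))]
  · exact h0

theorem IsFace.eq_of_dim_le {α β : SignVec n} (h : IsFace α β) (h' : dim β ≤ dim α) : α = β :=
  h.eq_of_zeroSet (Finset.eq_of_subset_of_card_le h.zeroSet_subset h').symm.subset

theorem IsFace.dim_lt {α β : SignVec n} (h : IsFace α β) (hne : α ≠ β) : dim α < dim β := by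
  by_contra hlt
  exact hne (h.eq_of_dim_le (not_lt.1 hlt))

theorem isVertex_iff_dim {α : SignVec n} : IsVertex α ↔ dim α = 0 := by
  simp [IsVertex, dim, zeroSet, Finset.filter_eq_empty_iff]

theorem dim_eq_two_iff {σ : SignVec n} :
    dim σ = 2 ↔ ∃ a b : Fin n, a < b ∧ ∀ x, σ x = 0 ↔ x = a ∨ x = b := by
  rw [dim, Finset.card_eq_two]
  constructor
  · rintro ⟨a, b, hab, h⟩
    have h' : ∀ x, σ x = 0 ↔ x = a ∨ x = b := fun x => by
      rw [← mem_zeroSet, h]; simp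
    rcases lt_or_gt_of_ne hab with h1 | h1
    · exact ⟨a, b, h1, h'⟩
    · exact ⟨b, a, h1, fun x => by rw [h', or_comm]⟩
  · rintro ⟨a, b, hab, h⟩
    refine ⟨a, b, hab.ne, ?_⟩
    ext x
    rw [mem_zeroSet, h]; simp

theorem dim_eq_three_iff {σ : SignVec n} :
    dim σ = 3 ↔ ∃ a b c : Fin n, a < b ∧ b < c ∧ ∀ x, σ x = 0 ↔ x = a ∨ x = b ∨ x = c := by
  constructor
  · intro h
    obtain ⟨f, hf⟩ : ∃ f : Fin 3 ≃o zeroSet σ, True :=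
      ⟨(zeroSet σ).orderIsoOfFin h, trivial⟩
    refine ⟨f 0, f 1, f 2, ?_, ?_, fun x => ?_⟩
    · exact f.strictMono (by decide : (0 : Fin 3) < 1)
    · exact f.strictMono (by decide : (1 : Fin 3) < 2)
    · rw [← mem_zeroSet]
      constructor
      · intro hx
        obtain ⟨i, hi⟩ := f.surjective ⟨x, hx⟩
        have hi' : (f i : Fin n) = x := by rw [hi]
        fin_cases i
        · exact Or.inl hi'.symm
        · exact Or.inr (Or.inl hi'.symm)
        · exact Or.inr (Or.inr hi'.symm)
      · rintro (rfl | rfl | rfl) <;> exact (f _).2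
  · rintro ⟨a, b, c, hab, hbc, h⟩
    rw [dim, Finset.card_eq_three]
    refine ⟨a, b, c, hab.ne, (hab.trans hbc).ne, hbc.ne, ?_⟩
    ext x
    rw [mem_zeroSet, h]; simp

theorem exists_isVertex_isFace (α : SignVec n) : ∃ ε, IsVertex ε ∧ IsFace ε α := by
  refine ⟨fun i => if α i = 0 then 1 else α i, fun i => ?_, fun i => ?_⟩
  · by_cases h : α i = 0 <;> simp [h]
  · by_cases h : α i = 0 <;> simp [h]

/-- If the face relation fails at coordinate i, then β i is a sign and some nonzero sign different
from β i is still allowed by α. A vertex of α with that entry is not on β. -/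
theorem isFace_of_verts_subset {α β : SignVec n} (h : verts α ⊆ verts β) : IsFace α β := by
  intro i
  by_contra hcon
  push Not at hcon
  obtain ⟨h0, h1⟩ := hcon
  obtain ⟨s, hs0, hs1, hs2⟩ : ∃ s : SignType, s ≠ 0 ∧ s ≠ β i ∧ (α i = 0 ∨ s = α i) := by
    revert h0 h1
    generalize α i = x
    generalize β i = y
    revert x y
    decide
  let ε : SignVec n := fun j => if j = i then s else if α j = 0 then 1 else α j
  have hε : ε ∈ verts α := by
    refine ⟨fun j => ?_, fun j => ?_⟩
    · by_cases hj : j = i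
      · simpa [ε, hj] using hs0
      · by_cases hz : α j = 0 <;> simp [ε, hj, hz]
    · by_cases hj : j = i
      · subst hj; simpa [ε] using hs2
      · by_cases hz : α j = 0 <;> simp [ε, hj, hz]
  rcases (h hε).2 i with h2 | h2
  · exact h0 h2
  · exact hs1 (by simpa [ε] using h2)

theorem IsFace.verts_subset {α β : SignVec n} (h : IsFace α β) : verts α ⊆ verts β :=
  fun _ hε => ⟨hε.1, hε.2.trans h⟩

theorem verts_nonempty (α : SignVec n) : (verts α).Nonempty := exists_isVertex_isFace α

theorem isFace_update (α : SignVec n) (i : Fin n) : IsFace α (Function.update α i 0) := by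
  intro j
  by_cases h : j = i
  · subst h; simp
  · simp [h]

theorem update_eq_zero_iff {α : SignVec n} {i x : Fin n} :
    Function.update α i 0 x = 0 ↔ x = i ∨ α x = 0 := by
  by_cases h : x = i
  · subst h; simp
  · simp [h]

theorem isFace_snoc_iff {α β : SignVec (n + 1)} :
    IsFace α β ↔ IsFace (Fin.init α : SignVec n) (Fin.init β) ∧
      (β (Fin.last n) = 0 ∨ α (Fin.last n) = β (Fin.last n)) := by
  constructor
  · intro h
    exact ⟨fun i => h i.castSucc, h _⟩
  · rintro ⟨h, h'⟩ i
    induction i using Fin.lastCases with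
    | last => exact h'
    | cast i => exact h i

theorem dim_eq_init (α : SignVec (n + 1)) :
    dim α = dim (Fin.init α : SignVec n) + if α (Fin.last n) = 0 then 1 else 0 := by
  simp only [dim, zeroSet]
  rw [Finset.card_filter, Finset.card_filter, Fin.sum_univ_castSucc]
  rfl

end SignVec

open SignVec

/-! ### The polygon and its pulling triangulation -/

section Polygon

variable {n : ℕ}

/-- Replaces the cyclic rotation by inequalities between natural numbers, with the closing edge as a
separate case. This form makes the later position arguments accessible to `omega`. -/
theorem mem_polygonBoundary_iff (hn : 1 ≤ n) {F : Finset (Fin n)} :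
    F ∈ polygonBoundary n ↔ (∃ i : ℕ, ∀ x ∈ F, (x : ℕ) = i ∨ (x : ℕ) = i + 1) ∨
      (∀ x ∈ F, (x : ℕ) = 0 ∨ (x : ℕ) + 1 = n) := by
  obtain ⟨m, rfl⟩ : ∃ m, n = m + 1 := ⟨n - 1, by omega⟩
  constructor
  · rintro ⟨i, hi⟩
    by_cases h : i = Fin.last m
    · right
      intro x hx
      have := hi hx
      rw [h, finRotate_last] at this
      simp only [Finset.mem_insert, Finset.mem_singleton] at this
      rcases this with rfl | rfl <;> simp
    · left
      refine ⟨i, fun x hx => ?_⟩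
      have := hi hx
      simp only [Finset.mem_insert, Finset.mem_singleton] at this
      rcases this with rfl | rfl
      · simp
      · right; exact coe_finRotate_of_ne_last h
  · rintro (⟨i, hi⟩ | h)
    · by_cases him : i < m
      · refine ⟨⟨i, by omega⟩, fun x hx => ?_⟩
        simp only [Finset.mem_insert, Finset.mem_singleton]
        rcases hi x hx with h | h
        · left; exact Fin.ext h
        · right
          rw [finRotate_of_lt him]; exact Fin.ext h
      · refine ⟨Fin.last m, fun x hx => ?_⟩
        simp only [Finset.mem_insert, Finset.mem_singleton]
        left
        apply Fin.ext
        have := hi x hx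
        have := x.2
        simp only [Fin.val_last]
        omega
    · refine ⟨Fin.last m, fun x hx => ?_⟩
      simp only [Finset.mem_insert, Finset.mem_singleton, finRotate_last]
      rcases h x hx with h | h
      · right; exact Fin.ext h
      · left; apply Fin.ext; simp only [Fin.val_last]; omega

/-- The cone over the closing edge contributes nothing new: without the apex that edge is the single
vertex 0. So only windows of two consecutive positions together with the apex remain. -/
theorem mem_polygonTriangulation_iff (hn : 3 ≤ n) {F : Finset (Fin n)} :
    F ∈ polygonTriangulation n ↔
      ∃ i : ℕ, ∀ x ∈ F, (x : ℕ) = i ∨ (x : ℕ) = i + 1 ∨ (x : ℕ) + 1 = n := by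
  obtain ⟨m, rfl⟩ : ∃ m, n = m + 1 := ⟨n - 1, by omega⟩
  simp only [polygonTriangulation, pullingTriangulation, Set.mem_ofPred_eq]
  constructor
  · rintro ⟨G, hG, hv, hF⟩
    rw [mem_polygonBoundary_iff (by omega)] at hG
    rcases hG with ⟨i, hi⟩ | h
    · refine ⟨i, fun x hx => ?_⟩
      have := hF hx
      rw [Finset.mem_insert] at this
      rcases this with rfl | h
      · simp
      · have := hi x h; omega
    · refine ⟨0, fun x hx => ?_⟩
      have := hF hx
      rw [Finset.mem_insert] at this
      rcases this with rfl | h'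
      · simp
      · have := h x h'; omega
  · rintro ⟨i, hi⟩
    refine ⟨F.erase (Fin.last m), ?_, by simp, fun x hx => by
      simp [hx, em]⟩
    rw [mem_polygonBoundary_iff (by omega)]
    left
    refine ⟨i, fun x hx => ?_⟩
    rw [Finset.mem_erase] at hx
    have h1 := hi x hx.2
    have h2 : (x : ℕ) ≠ m := fun h => hx.1 (Fin.ext h)
    omega

theorem mem_mirror_polygonBoundary (hn : 1 ≤ n) {σ : SignVec n} :
    σ ∈ mirrorComplex (polygonBoundary n) ↔
      (∃ i : ℕ, ∀ x, σ x = 0 → (x : ℕ) = i ∨ (x : ℕ) = i + 1) ∨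
      (∀ x, σ x = 0 → (x : ℕ) = 0 ∨ (x : ℕ) + 1 = n) := by
  simp only [mirrorComplex, Set.mem_ofPred_eq, mem_polygonBoundary_iff hn, mem_zeroSet]

theorem mem_mirror_polygonTriangulation (hn : 3 ≤ n) {σ : SignVec n} :
    σ ∈ mirrorComplex (polygonTriangulation n) ↔
      ∃ i : ℕ, ∀ x, σ x = 0 → (x : ℕ) = i ∨ (x : ℕ) = i + 1 ∨ (x : ℕ) + 1 = n := by
  simp only [mirrorComplex, Set.mem_ofPred_eq, mem_polygonTriangulation_iff hn, mem_zeroSet]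

theorem mem_mirror_polygonBoundary_of_two (hn : 3 ≤ n) {σ : SignVec n} {a b : Fin n} (hab : a < b)
    (h : ∀ x, σ x = 0 ↔ x = a ∨ x = b) :
    σ ∈ mirrorComplex (polygonBoundary n) ↔
      (b : ℕ) = a + 1 ∨ ((a : ℕ) = 0 ∧ (b : ℕ) + 1 = n) := by
  rw [mem_mirror_polygonBoundary (by omega)]
  have hab' : (a : ℕ) < b := hab
  constructor
  · rintro (⟨i, hi⟩ | h')
    · have h1 := hi a ((h a).2 (by simp))
      have h2 := hi b ((h b).2 (by simp))
      omega
    · have h1 := h' a ((h a).2 (by simp))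
      have h2 := h' b ((h b).2 (by simp))
      omega
  · rintro (h' | h')
    · left
      refine ⟨a, fun x hx => ?_⟩
      rcases (h x).1 hx with rfl | rfl <;> omega
    · right
      intro x hx
      rcases (h x).1 hx with rfl | rfl <;> omega

theorem mem_mirror_polygonTriangulation_of_three (hn : 3 ≤ n) {σ : SignVec n} {a b c : Fin n}
    (hab : a < b) (hbc : b < c) (h : ∀ x, σ x = 0 ↔ x = a ∨ x = b ∨ x = c) :
    σ ∈ mirrorComplex (polygonTriangulation n) ↔ (b : ℕ) = a + 1 ∧ (c : ℕ) + 1 = n := by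
  rw [mem_mirror_polygonTriangulation hn]
  have hab' : (a : ℕ) < b := hab
  have hbc' : (b : ℕ) < c := hbc
  constructor
  · rintro ⟨i, hi⟩
    have h1 := hi a ((h a).2 (by simp))
    have h2 := hi b ((h b).2 (by simp))
    have h3 := hi c ((h c).2 (by simp))
    omega
  · rintro ⟨h1, h2⟩
    refine ⟨a, fun x hx => ?_⟩
    rcases (h x).1 hx with rfl | rfl | rfl <;> omega

theorem isCubicalComplex_mirror_polygonBoundary (hn : 1 ≤ n) :
    IsCubicalComplex (mirrorComplex (polygonBoundary n)) := by
  intro β hβ α h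
  rw [mem_mirror_polygonBoundary hn] at hβ ⊢
  rcases hβ with ⟨i, hi⟩ | h'
  · exact Or.inl ⟨i, fun x hx => hi x (h.apply_eq_zero hx)⟩
  · exact Or.inr fun x hx => h' x (h.apply_eq_zero hx)

theorem isCubicalComplex_mirror_polygonTriangulation (hn : 3 ≤ n) :
    IsCubicalComplex (mirrorComplex (polygonTriangulation n)) := by
  intro β hβ α h
  rw [mem_mirror_polygonTriangulation hn] at hβ ⊢
  obtain ⟨i, hi⟩ := hβ
  exact ⟨i, fun x hx => hi x (h.apply_eq_zero hx)⟩

theorem mirror_polygonBoundary_subset (hn : 3 ≤ n) :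
    mirrorComplex (polygonBoundary n) ⊆ mirrorComplex (polygonTriangulation n) := by
  intro σ h
  rw [mem_mirror_polygonBoundary (by omega)] at h
  rw [mem_mirror_polygonTriangulation hn]
  rcases h with ⟨i, hi⟩ | h
  · exact ⟨i, fun x hx => by have := hi x hx; omega⟩
  · exact ⟨0, fun x hx => by have := h x hx; omega⟩

/-- In dimension at most one every sign vector lies in the mirror complex of the polygon. -/
theorem mem_mirror_polygonBoundary_of_dim_lt {σ : SignVec n} (hn : 1 ≤ n) (h : dim σ < 2) :
    σ ∈ mirrorComplex (polygonBoundary n) := by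
  rw [mem_mirror_polygonBoundary hn]
  left
  have h1 : (zeroSet σ).card ≤ 1 := by change dim σ ≤ 1; omega
  rcases (zeroSet σ).eq_empty_or_nonempty with h0 | ⟨a, ha⟩
  · refine ⟨0, fun x hx => ?_⟩
    rw [← mem_zeroSet, h0] at hx
    simp at hx
  · refine ⟨a, fun x hx => ?_⟩
    rw [Finset.card_le_one.1 h1 x (mem_zeroSet.2 hx) a ha]
    simp

theorem dim_le_two_of_mem_mirror_polygonBoundary {σ : SignVec n}
    (h : σ ∈ mirrorComplex (polygonBoundary n)) : dim σ ≤ 2 := by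
  obtain ⟨i, hi⟩ := h
  exact (Finset.card_le_card hi).trans Finset.card_le_two

end Polygon

/-! ### The facets of the neighborly cubical sphere -/

/-- The facets of the neighborly cubical sphere, described recursively. -/
def sphereFacets : (n : ℕ) → Set (SignVec n)
  | 0 => ∅
  | n + 1 =>
      if n < 3 then ∅
      else if n = 3 then {α | dim α = 3}
      else {α | ((Fin.init α : SignVec n) ∈ sphereFacets n ∧
          (Fin.init α : SignVec n) ∈ mirrorComplex (polygonTriangulation n) ∧
            α (Fin.last n) = 1) ∨
        ((Fin.init α : SignVec n) ∈ sphereFacets n ∧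
          (Fin.init α : SignVec n) ∉ mirrorComplex (polygonTriangulation n) ∧
            α (Fin.last n) = -1) ∨
        ((Fin.init α : SignVec n) ∈ mirrorComplex (polygonBoundary n) ∧
          dim (Fin.init α : SignVec n) = 2 ∧ α (Fin.last n) = 0)}

theorem sphereFacets_four : sphereFacets 4 = {α | dim α = 3} := by
  simp [sphereFacets]

theorem mem_sphereFacets_succ {n : ℕ} (hn : 4 ≤ n) {α : SignVec (n + 1)} :
    α ∈ sphereFacets (n + 1) ↔
      ((Fin.init α : SignVec n) ∈ sphereFacets n ∧
          (Fin.init α : SignVec n) ∈ mirrorComplex (polygonTriangulation n) ∧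
            α (Fin.last n) = 1) ∨
        ((Fin.init α : SignVec n) ∈ sphereFacets n ∧
          (Fin.init α : SignVec n) ∉ mirrorComplex (polygonTriangulation n) ∧
            α (Fin.last n) = -1) ∨
        ((Fin.init α : SignVec n) ∈ mirrorComplex (polygonBoundary n) ∧
          dim (Fin.init α : SignVec n) = 2 ∧ α (Fin.last n) = 0) := by
  rw [sphereFacets, if_neg (by omega), if_neg (by omega)]
  rfl

theorem dim_of_mem_sphereFacets {n : ℕ} (hn : 4 ≤ n) {α : SignVec n} (h : α ∈ sphereFacets n) :
    dim α = 3 := by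
  induction n, hn using Nat.le_induction with
  | base => rwa [sphereFacets_four] at h
  | succ n hn ih =>
    rw [mem_sphereFacets_succ hn] at h
    rw [dim_eq_init]
    rcases h with ⟨h1, -, h3⟩ | ⟨h1, -, h3⟩ | ⟨-, h2, h3⟩
    · rw [ih h1, h3]; simp
    · rw [ih h1, h3]; simp
    · rw [h2, h3]; simp

/-- With last entry zero, the facets are the mirror images of polygon edges. -/
theorem mem_sphereFacets_of_last {n : ℕ} (hn : 4 ≤ n) {α : SignVec n} {a b c : Fin n} (hab : a < b)
    (hbc : b < c) (h : ∀ x, α x = 0 ↔ x = a ∨ x = b ∨ x = c) (hc : (c : ℕ) + 1 = n)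
    (h' : (b : ℕ) = a + 1 ∨ ((a : ℕ) = 0 ∧ (b : ℕ) + 2 = n)) : α ∈ sphereFacets n := by
  rcases hn.eq_or_lt with rfl | hn
  · rw [sphereFacets_four]
    exact dim_eq_three_iff.2 ⟨a, b, c, hab, hbc, h⟩
  · obtain ⟨m, rfl⟩ : ∃ m, n = m + 1 := ⟨n - 1, by omega⟩
    rw [mem_sphereFacets_succ (by omega)]
    right; right
    have hab' : (a : ℕ) < b := hab
    have hbc' : (b : ℕ) < c := hbc
    have h0 : ∀ x : Fin m, (Fin.init α : SignVec m) x = 0 ↔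
        x = ⟨a, by omega⟩ ∨ x = ⟨b, by omega⟩ := by
      intro x
      rw [Fin.init, h]
      simp only [Fin.ext_iff, Fin.val_castSucc]
      have := x.2
      omega
    have hlt : (⟨a, by omega⟩ : Fin m) < ⟨b, by omega⟩ := hab
    refine ⟨(mem_mirror_polygonBoundary_of_two (by omega) hlt h0).2 ?_,
      dim_eq_two_iff.2 ⟨_, _, hlt, h0⟩, ?_⟩
    · simp only; omega
    · rw [h]; right; right; apply Fin.ext; simp only [Fin.val_last]; omega

/-- The zeros of a facet with last entry zero. -/
theorem zeros_of_mem_sphereFacets {n : ℕ} (hn : 4 ≤ n) {α : SignVec n} (h : α ∈ sphereFacets n)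
    {l : Fin n} (hl : (l : ℕ) + 1 = n) (h0 : α l = 0) :
    ∃ a b : Fin n, a < b ∧ b < l ∧ (∀ x, α x = 0 ↔ x = a ∨ x = b ∨ x = l) ∧
      ((b : ℕ) = a + 1 ∨ ((a : ℕ) = 0 ∧ (b : ℕ) + 2 = n)) := by
  obtain ⟨a, b, c, hab, hbc, hx⟩ := dim_eq_three_iff.1 (dim_of_mem_sphereFacets hn h)
  have hab' : (a : ℕ) < b := hab
  have hbc' : (b : ℕ) < c := hbc
  have hcl : c = l := by
    have h1 := (hx l).1 h0
    simp only [Fin.ext_iff] at h1 ⊢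
    have := c.2
    omega
  subst hcl
  refine ⟨a, b, hab, hbc, hx, ?_⟩
  rcases hn.eq_or_lt with rfl | hn
  · omega
  · obtain ⟨m, rfl⟩ : ∃ m, n = m + 1 := ⟨n - 1, by omega⟩
    have hc : c = Fin.last m := Fin.ext (by simp only [Fin.val_last]; omega)
    subst hc
    rw [mem_sphereFacets_succ (by omega), h0] at h
    simp only [zero_ne_one, and_false, false_or, and_true] at h
    have h1 : (0 : SignType) ≠ -1 := by decide
    simp only [h1, and_false, false_or] at h
    have h2 : ∀ x : Fin m, (Fin.init α : SignVec m) x = 0 ↔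
        x = ⟨a, by omega⟩ ∨ x = ⟨b, by omega⟩ := by
      intro x
      rw [Fin.init, hx]
      simp only [Fin.ext_iff, Fin.val_castSucc, Fin.val_last]
      have := x.2
      omega
    have hlt : (⟨a, by omega⟩ : Fin m) < ⟨b, by omega⟩ := hab
    have := (mem_mirror_polygonBoundary_of_two (by omega) hlt h2).1 h.1
    simp only at this
    omega

/-- Every face of the triangulated mirror complex extends to a face of dimension three. -/
theorem exists_facet_of_mem_triangulation {n : ℕ} (hn : 4 ≤ n) {α : SignVec n}
    (h : α ∈ mirrorComplex (polygonTriangulation n)) :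
    ∃ β ∈ sphereFacets n, β ∈ mirrorComplex (polygonTriangulation n) ∧ IsFace α β := by
  have h' := h
  rw [mem_mirror_polygonTriangulation (by omega)] at h'
  obtain ⟨i, hi⟩ := h'
  -- A window {i, i+1} that meets the apex n-1 or leaves the range is replaced by {n-3, n-2}; the
  -- zeros then lie in {n-2, n-1} anyway.
  obtain ⟨j, hj, hjx⟩ : ∃ j : ℕ, j + 3 ≤ n ∧ ∀ x : Fin n, α x = 0 →
      (x : ℕ) = j ∨ (x : ℕ) = j + 1 ∨ (x : ℕ) + 1 = n := by
    by_cases hin : i + 3 ≤ n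
    · exact ⟨i, hin, hi⟩
    · refine ⟨n - 3, by omega, fun x hx => ?_⟩
      have := hi x hx
      have := x.2
      omega
  let β : SignVec n := fun x =>
    if (x : ℕ) = j ∨ (x : ℕ) = j + 1 ∨ (x : ℕ) + 1 = n then 0 else α x
  have hβ : ∀ x, β x = 0 ↔ x = ⟨j, by omega⟩ ∨ x = ⟨j + 1, by omega⟩ ∨ x = ⟨n - 1, by omega⟩ := by
    intro x
    simp only [Fin.ext_iff]
    have := x.2
    by_cases hc : (x : ℕ) = j ∨ (x : ℕ) = j + 1 ∨ (x : ℕ) + 1 = n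
    · simp only [β, if_pos hc, true_iff]; omega
    · simp only [β, if_neg hc]
      refine ⟨fun h => absurd (hjx x h) hc, fun h => ?_⟩
      omega
  have hab : (⟨j, by omega⟩ : Fin n) < ⟨j + 1, by omega⟩ := by simp [Fin.lt_def]
  have hbc : (⟨j + 1, by omega⟩ : Fin n) < ⟨n - 1, by omega⟩ := by simp [Fin.lt_def]; omega
  refine ⟨β, mem_sphereFacets_of_last hn hab hbc hβ (by simp only; omega) (Or.inl rfl),
    (mem_mirror_polygonTriangulation_of_three (by omega) hab hbc hβ).2 ⟨rfl, by simp only; omega⟩,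
    fun x => ?_⟩
  by_cases hc : (x : ℕ) = j ∨ (x : ℕ) = j + 1 ∨ (x : ℕ) + 1 = n
  · left; simp only [β, if_pos hc]
  · right; simp only [β, if_neg hc]

theorem not_mem_triangulation_of_last_ne_zero {n : ℕ} (hn : 4 ≤ n) {α : SignVec n}
    (hd : dim α = 3) {l : Fin n} (hl : (l : ℕ) + 1 = n) (h0 : α l ≠ 0) :
    α ∉ mirrorComplex (polygonTriangulation n) := by
  obtain ⟨a, b, c, hab, hbc, hx⟩ := dim_eq_three_iff.1 hd
  rw [mem_mirror_polygonTriangulation_of_three (by omega) hab hbc hx]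
  rintro ⟨-, h⟩
  exact h0 ((hx l).2 (Or.inr (Or.inr (Fin.ext (by omega)))))

/-- A mirrored polygon edge lies in a facet outside the triangulated mirror complex. -/
theorem exists_facet_not_mem_triangulation {n : ℕ} (hn : 4 ≤ n) {γ : SignVec n}
    (h : γ ∈ mirrorComplex (polygonBoundary n)) (hd : dim γ = 2) :
    ∃ β ∈ sphereFacets n, β ∉ mirrorComplex (polygonTriangulation n) ∧ IsFace γ β := by
  induction n, hn using Nat.le_induction with
  | base =>
    obtain ⟨a, b, hab, hx⟩ := dim_eq_two_iff.1 hd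
    rw [mem_mirror_polygonBoundary_of_two (by omega) hab hx] at h
    rw [sphereFacets_four]
    -- In the 4-cube every 3-face is a facet, so only a third direction is needed that does not
    -- complete the edge to a triangle of the triangulation.
    have key : ∀ a b : Fin 4, a < b → ((b : ℕ) = a + 1 ∨ ((a : ℕ) = 0 ∧ (b : ℕ) + 1 = 4)) →
        ∃ c : Fin 4, ∃ a' b' c' : Fin 4, a' < b' ∧ b' < c' ∧
          (∀ x : Fin 4, (x = c ∨ x = a ∨ x = b) ↔ x = a' ∨ x = b' ∨ x = c') ∧
          ¬ ((b' : ℕ) = a' + 1 ∧ (c' : ℕ) + 1 = 4) := by decide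
    obtain ⟨c, a', b', c', h1, h2, h3, h4⟩ := key a b hab h
    have hz : ∀ x, Function.update γ c 0 x = 0 ↔ x = a' ∨ x = b' ∨ x = c' := fun x => by
      rw [update_eq_zero_iff, hx, h3]
    refine ⟨Function.update γ c 0, dim_eq_three_iff.2 ⟨a', b', c', h1, h2, hz⟩, ?_,
      isFace_update _ _⟩
    rwa [mem_mirror_polygonTriangulation_of_three (by omega) h1 h2 hz]
  | succ n hn ih =>
    by_cases h0 : γ (Fin.last n) = 0
    · obtain ⟨a, b, hab, hx⟩ := dim_eq_two_iff.1 hd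
      rw [mem_mirror_polygonBoundary_of_two (by omega) hab hx] at h
      have hab' : (a : ℕ) < b := hab
      have hb : (b : ℕ) = n := by
        have := (hx _).1 h0
        simp only [Fin.ext_iff, Fin.val_last] at this
        omega
      -- An edge of the (n+1)-gon at the vertex n is {n-1, n} or {0, n}. Either one extends to {0,
      -- n-1, n}, which is the zero set of facets but no triangle of the triangulation, as 0 and n-1
      -- are not consecutive for n ≥ 4.
      obtain ⟨c, hc⟩ : ∃ c : Fin (n + 1), ∀ x : Fin (n + 1),
          (x = c ∨ x = a ∨ x = b) ↔ x = ⟨0, by omega⟩ ∨ x = ⟨n - 1, by omega⟩ ∨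
            x = ⟨n, by omega⟩ := by
        rcases h with h | h
        · refine ⟨⟨0, by omega⟩, fun x => ?_⟩
          simp only [Fin.ext_iff]; omega
        · refine ⟨⟨n - 1, by omega⟩, fun x => ?_⟩
          simp only [Fin.ext_iff]; omega
      have hz : ∀ x, Function.update γ c 0 x = 0 ↔ x = ⟨0, by omega⟩ ∨ x = ⟨n - 1, by omega⟩ ∨
            x = ⟨n, by omega⟩ := fun x => by
        rw [update_eq_zero_iff, hx, hc]
      have h1 : (⟨0, by omega⟩ : Fin (n + 1)) < ⟨n - 1, by omega⟩ := by simp [Fin.lt_def]; omega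
      have h2 : (⟨n - 1, by omega⟩ : Fin (n + 1)) < ⟨n, by omega⟩ := by simp [Fin.lt_def]; omega
      refine ⟨_, mem_sphereFacets_of_last (by omega) h1 h2 hz rfl (Or.inr ⟨rfl, by
        simp only; omega⟩), ?_, isFace_update _ _⟩
      rw [mem_mirror_polygonTriangulation_of_three (by omega) h1 h2 hz]
      simp only; omega
    · have hd' : dim (Fin.init γ : SignVec n) = 2 := by
        rw [dim_eq_init, if_neg h0] at hd; exact hd
      have hQ : (Fin.init γ : SignVec n) ∈ mirrorComplex (polygonBoundary n) := by
        rw [mem_mirror_polygonBoundary (by omega)] at h ⊢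
        rcases h with ⟨i, hi⟩ | h
        · exact Or.inl ⟨i, fun x hx => hi x.castSucc hx⟩
        · refine Or.inl ⟨0, fun x hx => ?_⟩
          have := h x.castSucc hx
          simp only [Fin.val_castSucc] at this
          omega
      have hsign : γ (Fin.last n) = 1 ∨ γ (Fin.last n) = -1 := by
        revert h0
        generalize γ (Fin.last n) = s
        revert s
        decide
      -- The prescribed last sign decides in which half of the fissured sphere to extend: inside the
      -- triangulated part for +1, outside by induction for -1. Both extensions are outside at level
      -- n+1, because their last entry is nonzero.
      obtain ⟨β, hβ, hβγ, hβs⟩ : ∃ β ∈ sphereFacets n, IsFace (Fin.init γ : SignVec n) β ∧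
          ((β ∈ mirrorComplex (polygonTriangulation n) ∧ γ (Fin.last n) = 1) ∨
            (β ∉ mirrorComplex (polygonTriangulation n) ∧ γ (Fin.last n) = -1)) := by
        rcases hsign with hs | hs
        · obtain ⟨β, h1, h2, h3⟩ :=
            exists_facet_of_mem_triangulation hn (mirror_polygonBoundary_subset (by omega) hQ)
          exact ⟨β, h1, h3, Or.inl ⟨h2, hs⟩⟩
        · obtain ⟨β, h1, h2, h3⟩ := ih hQ hd'
          exact ⟨β, h1, h3, Or.inr ⟨h2, hs⟩⟩
      let β' : SignVec (n + 1) := Fin.snoc (α := fun _ => SignType) β (γ (Fin.last n))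
      have hi : (Fin.init β' : SignVec n) = β := Fin.init_snoc (α := fun _ => SignType) _ _
      have hlast : β' (Fin.last n) = γ (Fin.last n) := Fin.snoc_last (α := fun _ => SignType) _ _
      have hmem : β' ∈ sphereFacets (n + 1) := by
        rw [mem_sphereFacets_succ hn, hi, hlast]
        tauto
      refine ⟨β', hmem, ?_, ?_⟩
      · exact not_mem_triangulation_of_last_ne_zero (by omega)
          (dim_of_mem_sphereFacets (by omega) hmem) (l := Fin.last n) rfl (by rwa [hlast])
      · rw [isFace_snoc_iff, hi, hlast]
        exact ⟨hβγ, Or.inr rfl⟩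

/-- A face common to facets inside and outside the triangulated mirror complex lies in the
mirror complex of the polygon. -/
theorem mem_mirror_polygonBoundary_of_isFace {n : ℕ} (hn : 4 ≤ n) {γ β₁ β₂ : SignVec n}
    (h₁ : β₁ ∈ mirrorComplex (polygonTriangulation n))
    (h₂ : β₂ ∈ sphereFacets n) (h₂' : β₂ ∉ mirrorComplex (polygonTriangulation n))
    (hγ₁ : IsFace γ β₁) (hγ₂ : IsFace γ β₂) : γ ∈ mirrorComplex (polygonBoundary n) := by
  rw [mem_mirror_polygonTriangulation (by omega)] at h₁
  obtain ⟨i, hi⟩ := h₁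
  rw [mem_mirror_polygonBoundary (by omega)]
  by_cases h0 : γ ⟨n - 1, by omega⟩ = 0
  · obtain ⟨a, b, hab, hbc, hx, h⟩ :=
      zeros_of_mem_sphereFacets hn h₂ (by simp only; omega) (hγ₂.apply_eq_zero h0)
    rw [mem_mirror_polygonTriangulation_of_three (by omega) hab hbc hx] at h₂'
    have hab' : (a : ℕ) < b := hab
    have hbc' : (b : ℕ) < n - 1 := hbc
    have hab'' : (a : ℕ) = 0 ∧ (b : ℕ) + 2 = n := by
      rcases h with h | h
      · exact absurd ⟨h, by simp only; omega⟩ h₂'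
      · exact h
    have key : ∀ x, γ x = 0 → ((x : ℕ) = 0 ∨ (x : ℕ) + 2 = n ∨ (x : ℕ) + 1 = n) ∧
        ((x : ℕ) = i ∨ (x : ℕ) = i + 1 ∨ (x : ℕ) + 1 = n) := by
      intro x hx0
      have h1 := (hx x).1 (hγ₂.apply_eq_zero hx0)
      simp only [Fin.ext_iff] at h1
      exact ⟨by omega, hi x (hγ₁.apply_eq_zero hx0)⟩
    -- The zeros of γ lie in {0, n-2, n-1} and in {i, i+1, n-1}. For i = 0 this leaves the closing
    -- edge {0, n-1}, since n ≥ 4 separates 1 from n-2; otherwise it leaves the edge {n-2, n-1}.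
    by_cases hi0 : i = 0
    · right
      intro x hx0
      have := key x hx0
      omega
    · left
      refine ⟨n - 2, fun x hx0 => ?_⟩
      have := key x hx0
      omega
  · left
    refine ⟨i, fun x hx => ?_⟩
    have h1 := hi x (hγ₁.apply_eq_zero hx)
    rcases h1 with h1 | h1 | h1
    · exact Or.inl h1
    · exact Or.inr h1
    · exfalso
      apply h0
      rwa [show (⟨n - 1, by omega⟩ : Fin n) = x from Fin.ext (by simp only; omega)]

/-- Every face of the mirrored polygon lies in a `2`-face of it. -/
theorem exists_two_face_of_mem_mirror_polygonBoundary {n : ℕ} (hn : 3 ≤ n) {γ : SignVec n}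
    (h : γ ∈ mirrorComplex (polygonBoundary n)) :
    ∃ δ ∈ mirrorComplex (polygonBoundary n), dim δ = 2 ∧ IsFace γ δ := by
  obtain ⟨a, b, hab, hQ, hx⟩ : ∃ a b : Fin n, a < b ∧
      ((b : ℕ) = a + 1 ∨ ((a : ℕ) = 0 ∧ (b : ℕ) + 1 = n)) ∧ ∀ x, γ x = 0 → x = a ∨ x = b := by
    rw [mem_mirror_polygonBoundary (by omega)] at h
    rcases h with ⟨i, hi⟩ | h
    · by_cases hin : i + 2 ≤ n
      · refine ⟨⟨i, by omega⟩, ⟨i + 1, by omega⟩, by simp [Fin.lt_def], Or.inl rfl, fun x hx => ?_⟩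
        simpa only [Fin.ext_iff] using hi x hx
      · refine ⟨⟨n - 2, by omega⟩, ⟨n - 1, by omega⟩, by simp [Fin.lt_def]; omega,
          Or.inl (by simp only; omega), fun x hx => ?_⟩
        simp only [Fin.ext_iff]
        have := hi x hx
        have := x.2
        omega
    · refine ⟨⟨0, by omega⟩, ⟨n - 1, by omega⟩, by simp [Fin.lt_def]; omega,
          Or.inr ⟨rfl, by simp only; omega⟩, fun x hx => ?_⟩
      simp only [Fin.ext_iff]
      have := h x hx
      omega
  let δ : SignVec n := fun x => if x = a ∨ x = b then 0 else γ x
  have hδ : ∀ x, δ x = 0 ↔ x = a ∨ x = b := by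
    intro x
    by_cases hc : x = a ∨ x = b
    · simp [δ, hc]
    · simp only [δ, if_neg hc]
      exact ⟨hx x, fun h => absurd h hc⟩
  refine ⟨δ, (mem_mirror_polygonBoundary_of_two hn hab hδ).2 hQ,
    dim_eq_two_iff.2 ⟨a, b, hab, hδ⟩, fun x => ?_⟩
  by_cases hc : x = a ∨ x = b
  · left; simp only [δ, if_pos hc]
  · right; simp only [δ, if_neg hc]

/-! ### The neighborly cubical sphere is generated by its facets -/

theorem neighborlyCubicalSphere_four : neighborlyCubicalSphere 4 = cubeBoundary 4 := by
  simp [neighborlyCubicalSphere, bbcComplex]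

theorem neighborlyCubicalSphere_succ {n : ℕ} (hn : 4 ≤ n) :
    neighborlyCubicalSphere (n + 1) = fissure (mirrorComplex (polygonTriangulation n))
      (complementComplex (neighborlyCubicalSphere n)
        (mirrorComplex (polygonTriangulation n))) := by
  rw [neighborlyCubicalSphere, bbcComplex, if_neg (by omega), if_neg (by omega)]
  rfl

/-- Purity of the sphere. In the fissure, the middle layer consists of faces of M(Q_n), and each of
these extends to a 2-face of M(Q_n), which becomes a facet with last entry 0. -/
theorem mem_neighborlyCubicalSphere {n : ℕ} (hn : 4 ≤ n) {α : SignVec n} :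
    α ∈ neighborlyCubicalSphere n ↔ ∃ β ∈ sphereFacets n, IsFace α β := by
  induction n, hn using Nat.le_induction with
  | base =>
    rw [neighborlyCubicalSphere_four, sphereFacets_four]
    constructor
    · rintro ⟨i, hi⟩
      have key : ∀ i : Fin 4, ∃ a b c : Fin 4, a < b ∧ b < c ∧
          ∀ x, x ≠ i ↔ x = a ∨ x = b ∨ x = c := by decide
      obtain ⟨a, b, c, hab, hbc, h⟩ := key i
      refine ⟨fun x => if x = i then α i else 0,
        dim_eq_three_iff.2 ⟨a, b, c, hab, hbc, fun x => ?_⟩, fun x => ?_⟩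
      · rw [← h]
        by_cases hx : x = i <;> simp [hx, hi]
      · by_cases hx : x = i <;> simp [hx]
    · rintro ⟨β, hβ, h⟩
      by_contra hcon
      have h0 : ∀ i, β i = 0 := fun i => by
        by_contra hi
        exact hcon ⟨i, fun h' => hi (h.apply_eq_zero h')⟩
      have h4 : dim β = 4 := by simp [dim, zeroSet, h0]
      have h3 : dim β = 3 := hβ
      omega
  | succ n hn ih =>
    -- All members of `sphereFacets n` have dimension 3, so by induction they are exactly the
    -- maximal faces of the sphere.
    have hC : ∀ δ : SignVec n, δ ∈ complementComplex (neighborlyCubicalSphere n)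
        (mirrorComplex (polygonTriangulation n)) ↔
        ∃ β ∈ sphereFacets n, β ∉ mirrorComplex (polygonTriangulation n) ∧ IsFace δ β := by
      intro δ
      constructor
      · rintro ⟨β, hβ, hmax, hT, hδ⟩
        obtain ⟨β', hβ', hf⟩ := ih.1 hβ
        have := hmax β' (ih.2 ⟨β', hβ', .refl _⟩) hf
        subst this
        exact ⟨β', hβ', hT, hδ⟩
      · rintro ⟨β, hβ, hT, hδ⟩
        refine ⟨β, ih.2 ⟨β, hβ, .refl _⟩, fun γ hγ hf => ?_, hT, hδ⟩
        obtain ⟨β', hβ', hf'⟩ := ih.1 hγ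
        have h1 : β = β' := (hf.trans hf').eq_of_dim_le
          (by rw [dim_of_mem_sphereFacets hn hβ, dim_of_mem_sphereFacets hn hβ'])
        subst h1
        exact hf'.antisymm hf
    rw [neighborlyCubicalSphere_succ hn]
    simp only [fissure, Set.mem_ofPred_eq, Set.mem_inter_iff, hC]
    constructor
    · rintro (⟨hT, hs⟩ | ⟨⟨hT, β, hβ, hβT, hf⟩, hs⟩ | ⟨⟨β, hβ, hβT, hf⟩, hs⟩)
      · obtain ⟨β, h1, h2, h3⟩ := exists_facet_of_mem_triangulation hn hT
        refine ⟨Fin.snoc (α := fun _ => SignType) β 1, ?_, ?_⟩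
        · rw [mem_sphereFacets_succ hn]
          left
          simp [h1, h2]
        · rw [isFace_snoc_iff]
          simp [h3, hs]
      · obtain ⟨δ, hδ, hd, hαδ⟩ := exists_two_face_of_mem_mirror_polygonBoundary (by omega)
          (mem_mirror_polygonBoundary_of_isFace hn hT hβ hβT (.refl _) hf)
        refine ⟨Fin.snoc (α := fun _ => SignType) δ 0, ?_, ?_⟩
        · rw [mem_sphereFacets_succ hn]
          right; right
          simp [hδ, hd]
        · rw [isFace_snoc_iff]
          simp [hαδ]
      · refine ⟨Fin.snoc (α := fun _ => SignType) β (-1), ?_, ?_⟩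
        · rw [mem_sphereFacets_succ hn]
          right; left
          simp [hβ, hβT]
        · rw [isFace_snoc_iff]
          simp [hf, hs]
    · rintro ⟨β, hβ, hf⟩
      rw [isFace_snoc_iff] at hf
      rw [mem_sphereFacets_succ hn] at hβ
      have hTc := isCubicalComplex_mirror_polygonTriangulation (n := n) (by omega)
      rcases hβ with ⟨h1, h2, h3⟩ | ⟨h1, h2, h3⟩ | ⟨h1, h2, h3⟩
      · left
        refine ⟨hTc _ h2 _ hf.1, ?_⟩
        rw [h3] at hf
        simpa using hf.2
      · right; right
        refine ⟨⟨_, h1, h2, hf.1⟩, ?_⟩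
        rw [h3] at hf
        simpa using hf.2
      -- This facet is a prism over a 2-face of M(Q_n), so the last entry of α is unrestricted. Its
      -- initial part lies in both halves, hence the layer can be chosen to match that entry.
      · have hT' : (Fin.init α : SignVec n) ∈ mirrorComplex (polygonTriangulation n) :=
          hTc _ (mirror_polygonBoundary_subset (by omega) h1) _ hf.1
        obtain ⟨β', g1, g2, g3⟩ := exists_facet_not_mem_triangulation hn h1 h2
        have hC' : ∃ β ∈ sphereFacets n, β ∉ mirrorComplex (polygonTriangulation n) ∧
            IsFace (Fin.init α : SignVec n) β := ⟨β', g1, g2, hf.1.trans g3⟩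
        have hs : α (Fin.last n) = 1 ∨ α (Fin.last n) = 0 ∨ α (Fin.last n) = -1 := by
          generalize α (Fin.last n) = s
          revert s
          decide
        rcases hs with hs | hs | hs
        · exact Or.inl ⟨hT', hs⟩
        · exact Or.inr (Or.inl ⟨⟨hT', hC'⟩, hs⟩)
        · exact Or.inr (Or.inr ⟨hC', hs⟩)

theorem isCubicalComplex_neighborlyCubicalSphere {n : ℕ} (hn : 4 ≤ n) :
    IsCubicalComplex (neighborlyCubicalSphere n) := by
  intro β hβ α h
  rw [mem_neighborlyCubicalSphere hn] at hβ ⊢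
  obtain ⟨γ, hγ, hf⟩ := hβ
  exact ⟨γ, hγ, h.trans hf⟩

theorem mirror_polygonTriangulation_subset {n : ℕ} (hn : 4 ≤ n) :
    mirrorComplex (polygonTriangulation n) ⊆ neighborlyCubicalSphere n := by
  intro α h
  obtain ⟨β, h1, -, h3⟩ := exists_facet_of_mem_triangulation hn h
  exact (mem_neighborlyCubicalSphere hn).2 ⟨β, h1, h3⟩

theorem mirror_polygonBoundary_subset_sphere {n : ℕ} (hn : 4 ≤ n) :
    mirrorComplex (polygonBoundary n) ⊆ neighborlyCubicalSphere n :=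
  (mirror_polygonBoundary_subset (by omega)).trans (mirror_polygonTriangulation_subset hn)

theorem isCubicallyNeighborly_sphere {n : ℕ} (hn : 4 ≤ n) :
    IsCubicallyNeighborly 2 (neighborlyCubicalSphere n) := fun _ h =>
  mirror_polygonBoundary_subset_sphere hn (mem_mirror_polygonBoundary_of_dim_lt (by omega) h)


/-! ### The mirror complex of the polygon is an equivelar surface -/

section Surface

variable {n : ℕ}

/-! #### Counting faces -/

theorem SignVec.ncard_verts (α : SignVec n) : (verts α).ncard = 2 ^ dim α := by
  classical
  let S : Fin n → Finset SignType := fun i => if α i = 0 then Finset.univ.filter (· ≠ 0) else {α i}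
  have h1 : verts α = (Fintype.piFinset S : Finset (SignVec n)) := by
    ext ε
    simp only [verts, Finset.mem_coe, Fintype.mem_piFinset, Set.mem_ofPred_eq]
    constructor
    · rintro ⟨hε, hf⟩ i
      by_cases h0 : α i = 0
      · simpa [S, h0] using hε i
      · simpa [S, h0] using hf i
    · intro h
      have key : ∀ i, ε i ≠ 0 ∧ (α i = 0 ∨ ε i = α i) := fun i => by
        have := h i
        by_cases h0 : α i = 0
        · simp only [S, if_pos h0, Finset.mem_filter] at this
          exact ⟨this.2, Or.inl h0⟩
        · simp only [S, if_neg h0, Finset.mem_singleton] at this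
          exact ⟨this ▸ h0, Or.inr this⟩
      exact ⟨fun i => (key i).1, fun i => (key i).2⟩
  rw [h1, Set.ncard_coe_finset, Fintype.card_piFinset]
  have h2 : ∀ i, (S i).card = if α i = 0 then 2 else 1 := fun i => by
    by_cases h0 : α i = 0
    · simp only [S, if_pos h0]; rfl
    · simp only [S, if_neg h0]; rfl
  simp only [h2, Finset.prod_ite, Finset.prod_const, one_pow, mul_one, dim, zeroSet]

theorem SignVec.card_zeroSet_eq (Z : Finset (Fin n)) :
    (Finset.univ.filter fun σ : SignVec n => zeroSet σ = Z).card = 2 ^ (n - Z.card) := by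
  classical
  let S : Fin n → Finset SignType := fun i => if i ∈ Z then {0} else Finset.univ.filter (· ≠ 0)
  have h1 : (Finset.univ.filter fun σ : SignVec n => zeroSet σ = Z) = Fintype.piFinset S := by
    ext σ
    simp only [Finset.mem_filter, Finset.mem_univ, true_and, Fintype.mem_piFinset,
      Finset.ext_iff, mem_zeroSet]
    refine forall_congr' fun i => ?_
    by_cases h0 : i ∈ Z <;> simp [S, h0]
  rw [h1, Fintype.card_piFinset]
  have h2 : ∀ i, (S i).card = if i ∈ Z then 1 else 2 := fun i => by
    by_cases h0 : i ∈ Z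
    · simp only [S, if_pos h0]; rfl
    · simp only [S, if_neg h0]; rfl
  have h3 : (Finset.univ.filter fun i => i ∉ Z) = Zᶜ := by ext; simp
  simp only [h2, Finset.prod_ite, Finset.prod_const, one_pow, one_mul, h3,
    Finset.card_compl, Fintype.card_fin]

/-- Fibre the faces over their zero sets: the n - k nonzero entries can be signed independently. -/
theorem faceCount_mirrorComplex (Δ : Set (Finset (Fin n))) (k : ℕ) :
    faceCount (mirrorComplex Δ) k = {Z | Z ∈ Δ ∧ Z.card = k}.ncard * 2 ^ (n - k) := by
  classical
  have h1 : {α : SignVec n | α ∈ mirrorComplex Δ ∧ dim α = k} =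
      ((Finset.univ.filter fun α : SignVec n => zeroSet α ∈ Δ ∧ dim α = k :
        Finset (SignVec n)) : Set (SignVec n)) := by
    ext α; simp [mirrorComplex]
  have h2 : {Z | Z ∈ Δ ∧ Z.card = k} = ((Finset.univ.filter fun Z : Finset (Fin n) =>
      Z ∈ Δ ∧ Z.card = k : Finset (Finset (Fin n))) : Set (Finset (Fin n))) := by
    ext Z; simp
  rw [faceCount, h1, h2, Set.ncard_coe_finset, Set.ncard_coe_finset,
    Finset.card_eq_sum_card_fiberwise (f := zeroSet)
      (t := Finset.univ.filter fun Z : Finset (Fin n) => Z ∈ Δ ∧ Z.card = k)]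
  · rw [← smul_eq_mul, ← Finset.sum_const]
    refine Finset.sum_congr rfl fun Z hZ => ?_
    simp only [Finset.mem_filter, Finset.mem_univ, true_and] at hZ
    rw [← hZ.2, ← card_zeroSet_eq, Finset.filter_filter]
    refine congrArg Finset.card (Finset.filter_congr fun α _ => ⟨fun h => h.2, fun h => ?_⟩)
    exact ⟨⟨h ▸ hZ.1, by rw [dim, h]⟩, h⟩
  · intro α hα
    rw [Finset.mem_coe, Finset.mem_filter] at hα ⊢
    exact ⟨Finset.mem_univ _, hα.2⟩

theorem empty_mem_polygonBoundary (hn : 1 ≤ n) : ∅ ∈ polygonBoundary n :=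
  ⟨⟨0, hn⟩, Finset.empty_subset _⟩

theorem faceCount_zero (hn : 3 ≤ n) : faceCount (mirrorComplex (polygonBoundary n)) 0 = 2 ^ n := by
  rw [faceCount_mirrorComplex]
  have h1 : {Z | Z ∈ polygonBoundary n ∧ Z.card = 0} = {∅} := by
    ext Z
    simp only [Finset.card_eq_zero, Set.mem_ofPred_eq, Set.mem_singleton_iff]
    constructor
    · exact fun h => h.2
    · rintro rfl
      exact ⟨empty_mem_polygonBoundary (by omega), rfl⟩
  rw [h1, Set.ncard_singleton, one_mul, Nat.sub_zero]

theorem faceCount_one :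
    faceCount (mirrorComplex (polygonBoundary n)) 1 = 2 ^ (n - 1) * n := by
  rw [faceCount_mirrorComplex]
  have h1 : {Z | Z ∈ polygonBoundary n ∧ Z.card = 1} =
      Set.range (fun i : Fin n => ({i} : Finset (Fin n))) := by
    ext Z
    simp only [Finset.card_eq_one, Set.mem_ofPred_eq, Set.mem_range]
    constructor
    · rintro ⟨-, i, rfl⟩
      exact ⟨i, rfl⟩
    · rintro ⟨i, rfl⟩
      exact ⟨⟨i, by simp⟩, i, rfl⟩
  rw [h1, ← Set.image_univ, Set.ncard_image_of_injective _ Finset.singleton_injective,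
    Set.ncard_univ, Nat.card_eq_fintype_card, Fintype.card_fin, mul_comm]

theorem faceCount_two (hn : 3 ≤ n) :
    faceCount (mirrorComplex (polygonBoundary n)) 2 = 2 ^ (n - 2) * n := by
  rw [faceCount_mirrorComplex]
  obtain ⟨m, rfl⟩ : ∃ m, n = m + 1 := ⟨n - 1, by omega⟩
  have hne : ∀ i : Fin (m + 1), i ≠ finRotate (m + 1) i := fun i h => by
    have h1 := congrArg Fin.val h
    rw [coe_finRotate] at h1
    split_ifs at h1 with h2
    · rw [h2, Fin.val_last] at h1; omega
    · omega
  have h1 : {Z | Z ∈ polygonBoundary (m + 1) ∧ Z.card = 2} =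
      Set.range (fun i : Fin (m + 1) => ({i, finRotate (m + 1) i} : Finset (Fin (m + 1)))) := by
    ext Z
    simp only [Set.mem_ofPred_eq, Set.mem_range]
    constructor
    · rintro ⟨⟨i, hi⟩, hc⟩
      exact ⟨i, (Finset.eq_of_subset_of_card_le hi (by rw [hc, Finset.card_pair (hne i)])).symm⟩
    · rintro ⟨i, rfl⟩
      exact ⟨⟨i, subset_rfl⟩, Finset.card_pair (hne i)⟩
  have h2 : Function.Injective
      (fun i : Fin (m + 1) => ({i, finRotate (m + 1) i} : Finset (Fin (m + 1)))) := by
    intro i j hij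
    beta_reduce at hij
    have h3 : i ∈ ({j, finRotate (m + 1) j} : Finset (Fin (m + 1))) := by
      have : i ∈ ({i, finRotate (m + 1) i} : Finset (Fin (m + 1))) := by simp
      rwa [hij] at this
    have h4 : j ∈ ({i, finRotate (m + 1) i} : Finset (Fin (m + 1))) := by
      have : j ∈ ({j, finRotate (m + 1) j} : Finset (Fin (m + 1))) := by simp
      rwa [← hij] at this
    rw [Finset.mem_insert, Finset.mem_singleton] at h3 h4
    rcases h3 with h3 | h3
    · exact h3
    · rcases h4 with h4 | h4
      · exact h4.symm
      · exfalso
        have h5 := congrArg Fin.val h3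
        have h6 := congrArg Fin.val h4
        rw [coe_finRotate] at h5 h6
        split_ifs at h5 h6 with h7 h8 h8
        all_goals
          try have h9 := congrArg Fin.val h7
          try have h10 := congrArg Fin.val h8
          try rw [Fin.val_last] at h9
          try rw [Fin.val_last] at h10
          omega
  rw [h1, ← Set.image_univ, Set.ncard_image_of_injective _ h2,
    Set.ncard_univ, Nat.card_eq_fintype_card, Fintype.card_fin, mul_comm]

/-! #### Vertex figures -/

theorem SignVec.IsVertex.update_eq_zero_iff {ε : SignVec n} (hε : IsVertex ε) {i x : Fin n} :
    Function.update ε i 0 x = 0 ↔ x = i := by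
  rw [SignVec.update_eq_zero_iff]
  exact ⟨fun h => h.resolve_right (hε x), Or.inl⟩

theorem SignVec.IsVertex.dim_update {ε : SignVec n} (hε : IsVertex ε) (i : Fin n) :
    dim (Function.update ε i 0) = 1 := by
  rw [dim, Finset.card_eq_one]
  refine ⟨i, ?_⟩
  ext x
  rw [mem_zeroSet, hε.update_eq_zero_iff, Finset.mem_singleton]

/-- The edges at a vertex correspond to the coordinate directions. -/
noncomputable def edgeEquiv (hn : 1 ≤ n) {ε : SignVec n} (hε : IsVertex ε) :
    Fin n ≃ {e : SignVec n // e ∈ mirrorComplex (polygonBoundary n) ∧ dim e = 1 ∧ IsFace ε e} :=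
  Equiv.ofBijective (fun i => ⟨Function.update ε i 0,
    mem_mirror_polygonBoundary_of_dim_lt hn (by rw [hε.dim_update]; omega), hε.dim_update i,
    isFace_update ε i⟩) (by
    constructor
    · intro i j hij
      have h1 := congrArg Subtype.val hij
      simp only at h1
      have h2 : Function.update ε i 0 i = 0 := by simp
      rw [h1] at h2
      exact hε.update_eq_zero_iff.1 h2
    · rintro ⟨e, -, hd, hf⟩
      obtain ⟨i, hi⟩ := Finset.card_eq_one.1 hd
      refine ⟨i, Subtype.ext ?_⟩
      funext x
      by_cases hx : x = i
      · subst hx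
        have h1 : e x = 0 := mem_zeroSet.1 (by rw [hi]; exact Finset.mem_singleton_self x)
        simp [h1]
      · have h1 : e x ≠ 0 := fun h0 => hx (by
          have := mem_zeroSet.2 h0
          rwa [hi, Finset.mem_singleton] at this)
        rcases hf x with h2 | h2
        · exact absurd h2 h1
        · simp [hx, h2])

theorem cycleGraph_adj_iff (hn : 3 ≤ n) {i j : Fin n} :
    (SimpleGraph.cycleGraph n).Adj i j ↔ (j : ℕ) = i + 1 ∨ (i : ℕ) = j + 1 ∨
      ((i : ℕ) = 0 ∧ (j : ℕ) + 1 = n) ∨ ((j : ℕ) = 0 ∧ (i : ℕ) + 1 = n) := by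
  rw [SimpleGraph.cycleGraph_adj']
  have hi := i.2
  have hj := j.2
  rcases lt_trichotomy i j with h | h | h
  · rw [Fin.coe_sub_iff_lt.2 h, Fin.coe_sub_iff_le.2 h.le]
    have h' : (i : ℕ) < j := h
    omega
  · subst h
    have h1 : ((i - i : Fin n) : ℕ) = 0 := by rw [Fin.coe_sub_iff_le.2 le_rfl]; omega
    rw [h1]
    omega
  · rw [Fin.coe_sub_iff_lt.2 h, Fin.coe_sub_iff_le.2 h.le]
    have h' : (j : ℕ) < i := h
    omega

/-- Mirroring reproduces the original complex as the vertex figure at every vertex: an edge at ε is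
a direction i, and two directions span a 2-face exactly when they form an edge of the polygon. -/
theorem vertexFigure_iso_cycleGraph (hn : 3 ≤ n) {ε : SignVec n} (hε : IsVertex ε) :
    Nonempty (vertexFigure (mirrorComplex (polygonBoundary n)) ε ≃g SimpleGraph.cycleGraph n) := by
  refine ⟨(RelIso.symm ⟨edgeEquiv (by omega) hε, fun {i j} => ?_⟩)⟩
  change ((edgeEquiv (by omega) hε i) ≠ (edgeEquiv (by omega) hε j) ∧
    ∃ α ∈ mirrorComplex (polygonBoundary n), dim α = 2 ∧
      IsFace (Function.update ε i 0) α ∧ IsFace (Function.update ε j 0) α) ↔ _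
  rw [(edgeEquiv (by omega) hε).injective.ne_iff, cycleGraph_adj_iff hn]
  have hi := i.2
  have hj := j.2
  constructor
  · rintro ⟨hij, α, hα, hd, hfi, hfj⟩
    have h1 : α i = 0 := hfi.apply_eq_zero (by simp)
    have h2 : α j = 0 := hfj.apply_eq_zero (by simp)
    obtain ⟨a, b, hab, hz⟩ := dim_eq_two_iff.1 hd
    rw [mem_mirror_polygonBoundary_of_two hn hab hz] at hα
    have h3 := (hz i).1 h1
    have h4 := (hz j).1 h2
    simp only [Fin.ext_iff, Ne] at h3 h4 hij
    have hab' : (a : ℕ) < b := hab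
    omega
  · intro h
    have hij : i ≠ j := by
      rintro rfl
      omega
    let α : SignVec n := Function.update (Function.update ε i 0) j 0
    have hz : ∀ x, α x = 0 ↔ x = i ∨ x = j := fun x => by
      simp only [α]
      rw [SignVec.update_eq_zero_iff, hε.update_eq_zero_iff, or_comm]
    have hfj : IsFace (Function.update ε j 0) α := by
      simp only [α]
      rw [Function.update_comm hij]
      exact isFace_update _ _
    refine ⟨hij, α, ?_, ?_, isFace_update _ _, hfj⟩
    · rcases lt_or_gt_of_ne hij with hlt | hlt
      · have hlt' : (i : ℕ) < j := hlt
        rw [mem_mirror_polygonBoundary_of_two hn hlt hz]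
        omega
      · have hlt' : (j : ℕ) < i := hlt
        rw [mem_mirror_polygonBoundary_of_two hn hlt fun x => by rw [hz, or_comm]]
        omega
    · rw [dim_eq_two_iff]
      rcases lt_or_gt_of_ne hij with hlt | hlt
      · exact ⟨i, j, hlt, hz⟩
      · exact ⟨j, i, hlt, fun x => by rw [hz, or_comm]⟩

/-! #### Connectedness -/

theorem skeletonGraph_connected (hn : 3 ≤ n) :
    (skeletonGraph (mirrorComplex (polygonBoundary n))).Connected := by
  classical
  have hmem : ∀ ε : SignVec n, IsVertex ε → ε ∈ mirrorComplex (polygonBoundary n) := fun ε hε =>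
    mem_mirror_polygonBoundary_of_dim_lt (by omega) (by rw [isVertex_iff_dim.1 hε]; omega)
  have hstep : ∀ (ε : SignVec n) (hε : IsVertex ε) (i : Fin n) (s : SignType) (hs : s ≠ 0)
      (hε' : IsVertex (Function.update ε i s)),
      (skeletonGraph (mirrorComplex (polygonBoundary n))).Reachable ⟨ε, hmem ε hε, hε⟩
        ⟨Function.update ε i s, hmem _ hε', hε'⟩ := by
    intro ε hε i s hs hε'
    by_cases heq : ε = Function.update ε i s
    · have : (⟨ε, hmem ε hε, hε⟩ : {ε : SignVec n // ε ∈ mirrorComplex (polygonBoundary n) ∧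
          IsVertex ε}) = ⟨Function.update ε i s, hmem _ hε', hε'⟩ := Subtype.ext heq
      rw [this]
    · refine SimpleGraph.Adj.reachable ⟨fun h => heq (congrArg Subtype.val h),
        Function.update ε i 0, mem_mirror_polygonBoundary_of_dim_lt (by omega)
          (by rw [hε.dim_update]; omega), hε.dim_update i, isFace_update ε i, fun x => ?_⟩
      by_cases hx : x = i
      · subst hx; left; simp
      · right; simp [hx]
  -- Every cube edge belongs to the complex, so ε can be turned into δ by changing one coordinate at
  -- a time.
  have hreach : ∀ (ε δ : SignVec n) (hε : IsVertex ε) (hδ : IsVertex δ) (s : Finset (Fin n))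
      (hs : IsVertex (fun i => if i ∈ s then δ i else ε i)),
      (skeletonGraph (mirrorComplex (polygonBoundary n))).Reachable ⟨ε, hmem ε hε, hε⟩
        ⟨fun i => if i ∈ s then δ i else ε i, hmem _ hs, hs⟩ := by
    intro ε δ hε hδ s
    induction s using Finset.induction_on with
    | empty => intro hs; simp
    | insert a s ha ih =>
      intro hs
      have hs' : IsVertex (fun i => if i ∈ s then δ i else ε i) := fun i => by
        by_cases hi : i ∈ s
        · simpa [hi] using hδ i
        · simpa [hi] using hε i
      have heq : (fun i => if i ∈ insert a s then δ i else ε i) =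
          Function.update (fun i => if i ∈ s then δ i else ε i) a (δ a) := by
        funext i
        by_cases hi : i = a
        · subst hi; simp
        · simp [hi]
      have h1 := hstep _ hs' a (δ a) (hδ a) (heq ▸ hs)
      have h2 := (ih hs').trans h1
      convert h2 using 2
  have : Nonempty {ε : SignVec n // ε ∈ mirrorComplex (polygonBoundary n) ∧ IsVertex ε} :=
    ⟨⟨fun _ => 1, hmem _ fun _ => one_ne_zero, fun _ => one_ne_zero⟩⟩
  refine SimpleGraph.Connected.mk ?_
  rintro ⟨ε, h, hε⟩ ⟨δ, h', hδ⟩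
  have := hreach ε δ hε hδ Finset.univ (by simpa using hδ)
  simpa using this

theorem isPolyhedralSurface_mirror (hn : 3 ≤ n) :
    IsPolyhedralSurface (mirrorComplex (polygonBoundary n)) where
  complex := isCubicalComplex_mirror_polygonBoundary (by omega)
  dim_le _ h := dim_le_two_of_mem_mirror_polygonBoundary h
  vertexFigure_cycle _ _ hε := ⟨n, hn, vertexFigure_iso_cycleGraph hn hε⟩
  connected := skeletonGraph_connected hn

theorem isEquivelarSurface_mirror (hn : 3 ≤ n) :
    IsEquivelarSurface 4 n (mirrorComplex (polygonBoundary n)) where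
  surface := isPolyhedralSurface_mirror hn
  gon α _ hd := by rw [ncard_verts, hd]; norm_num
  degree ε _ hε := by
    rw [← Nat.card_coe_set_eq]
    exact (Nat.card_congr (edgeEquiv (by omega) hε).symm).trans (by simp)

/-! #### Orientability -/

/-- The product of the nonzero entries. -/
def SignVec.signProd (α : SignVec n) : ℤ := ∏ i, if α i = 0 then 1 else ((α i : SignType) : ℤ)

theorem SignType.intCast_eq {s : SignType} (hs : s ≠ 0) : (s : ℤ) = 1 ∨ (s : ℤ) = -1 := by
  cases s <;> simp at hs ⊢

theorem SignVec.signProd_eq (α : SignVec n) : signProd α = 1 ∨ signProd α = -1 := by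
  unfold signProd
  refine Finset.prod_induction _ (fun x : ℤ => x = 1 ∨ x = -1) ?_ (Or.inl rfl) ?_
  · rintro a b (rfl | rfl) (rfl | rfl) <;> simp
  · intro i _
    by_cases h : α i = 0
    · simp [h]
    · rw [if_neg h]; exact SignType.intCast_eq h

theorem SignVec.signProd_facet {α e : SignVec n} {k : Fin n} (hk : α k = 0) (hek : e k ≠ 0)
    (h : ∀ i, i ≠ k → e i = α i) : signProd α * ((e k : SignType) : ℤ) = signProd e := by
  classical
  unfold signProd
  rw [← Finset.mul_prod_erase _ _ (Finset.mem_univ k), ← Finset.mul_prod_erase Finset.univ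
    (fun i => if e i = 0 then 1 else ((e i : SignType) : ℤ)) (Finset.mem_univ k), if_pos hk,
    if_neg hek, one_mul, mul_comm]
  congr 1
  refine Finset.prod_congr rfl fun i hi => ?_
  rw [h i (Finset.ne_of_mem_erase hi)]

/-- Passing from α to e fixes one zero of α, and the sign put there is also the quotient of the two
sign products. After multiplication by `signProd` only the positional sign of the fixed zero
remains: +1 if a is fixed (then j = b), -1 if b is fixed. -/
theorem incidence_eq {α e : SignVec n} {a b : Fin n} (hab : a < b)
    (hz : ∀ x, α x = 0 ↔ x = a ∨ x = b) (hf : IsFace e α) {j : Fin n}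
    (hj : ∀ x, e x = 0 ↔ x = j) :
    signProd α * incidence α e = signProd e * if j = b then 1 else -1 := by
  classical
  have hj' := (hz j).1 (hf.apply_eq_zero ((hj j).2 rfl))
  have hrest : ∀ k, (∀ i, i ≠ k → α i = 0 → e i = 0) → ∀ i, i ≠ k → e i = α i := by
    intro k hk i hi
    rcases hf i with h1 | h1
    · rw [h1, hk i hi h1]
    · exact h1
  rcases hj' with rfl | rfl
  · have hb0 : α b = 0 := (hz b).2 (Or.inr rfl)
    have heb : e b ≠ 0 := fun h0 => hab.ne ((hj b).1 h0).symm
    have h1 : incidence α e = -((e b : SignType) : ℤ) := by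
      unfold incidence
      rw [Finset.sum_eq_single b]
      · have h2 : (Finset.univ.filter fun i => i < b ∧ α i = 0) = {j} := by
          ext i
          simp only [Finset.mem_filter, Finset.mem_univ, true_and, Finset.mem_singleton]
          constructor
          · rintro ⟨h3, h4⟩
            exact ((hz i).1 h4).resolve_right h3.ne
          · rintro rfl
            exact ⟨hab, (hz i).2 (Or.inl rfl)⟩
        rw [if_pos ⟨hb0, heb⟩, h2]
        simp
      · intro i _ hi
        rw [if_neg]
        rintro ⟨h3, h4⟩
        rcases (hz i).1 h3 with rfl | rfl
        · exact h4 ((hj i).2 rfl)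
        · exact hi rfl
      · simp
    rw [h1, if_neg hab.ne, ← signProd_facet hb0 heb (hrest b fun i hi h0 => ?_)]
    · ring
    · exact (hj i).2 (((hz i).1 h0).resolve_right hi)
  · have ha0 : α a = 0 := (hz a).2 (Or.inl rfl)
    have hea : e a ≠ 0 := fun h0 => hab.ne ((hj a).1 h0)
    have h1 : incidence α e = ((e a : SignType) : ℤ) := by
      unfold incidence
      rw [Finset.sum_eq_single a]
      · have h2 : (Finset.univ.filter fun i => i < a ∧ α i = 0) = ∅ := by
          rw [Finset.filter_eq_empty_iff]
          rintro i - ⟨h3, h4⟩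
          rcases (hz i).1 h4 with rfl | rfl
          · exact lt_irrefl _ h3
          · exact lt_asymm h3 hab
        rw [if_pos ⟨ha0, hea⟩, h2]
        simp
      · intro i _ hi
        rw [if_neg]
        rintro ⟨h3, h4⟩
        rcases (hz i).1 h3 with rfl | rfl
        · exact hi rfl
        · exact h4 ((hj i).2 rfl)
      · simp
    rw [h1, if_pos rfl, ← signProd_facet ha0 hea (hrest a fun i hi h0 => ?_)]
    · ring
    · exact (hj i).2 (((hz i).1 h0).resolve_left hi)

theorem isOrientable_mirror (hn : 3 ≤ n) :
    IsOrientable (mirrorComplex (polygonBoundary n)) := by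
  classical
  let z : Fin n := ⟨0, by omega⟩
  let l : Fin n := ⟨n - 1, by omega⟩
  -- The two 2-faces at an edge in direction j have zero sets {j-1, j} and {j, j+1}, cyclically.
  -- Away from the closing edge j is the larger zero in one and the smaller in the other, so
  -- `signProd` alone induces opposite signs. On faces with zero set {0, n-1} the order is reversed,
  -- which the extra -1 repairs.
  let o : SignVec n → ℤ := fun α => signProd α * if α z = 0 ∧ α l = 0 then -1 else 1
  have hval : ∀ α ∈ mirrorComplex (polygonBoundary n), dim α = 2 → ∃ a b : Fin n, (a : ℕ) < b ∧
      (∀ x, α x = 0 ↔ x = a ∨ x = b) ∧ ((b : ℕ) = a + 1 ∨ ((a : ℕ) = 0 ∧ (b : ℕ) + 1 = n)) ∧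
      ∀ e j, IsFace e α → (∀ x, e x = 0 ↔ x = j) → (j = a ∨ j = b) ∧
        o α * incidence α e = signProd e * ((if (j : ℕ) = b then 1 else -1) *
          if (b : ℕ) = a + 1 then 1 else -1) := by
    intro α hα hd
    obtain ⟨a, b, hab, hz⟩ := dim_eq_two_iff.1 hd
    have hQ := (mem_mirror_polygonBoundary_of_two hn hab hz).1 hα
    have hab' : (a : ℕ) < b := hab
    refine ⟨a, b, hab, hz, hQ, fun e j hf hj => ⟨(hz j).1 (hf.apply_eq_zero ((hj j).2 rfl)), ?_⟩⟩
    have h1 := incidence_eq hab hz hf hj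
    simp only [o]
    rw [mul_right_comm, h1, mul_assoc]
    congr 2
    · simp only [Fin.ext_iff]
    · have hiff : (α z = 0 ∧ α l = 0) ↔ ¬ (b : ℕ) = a + 1 := by
        rw [hz, hz]
        simp only [z, l, Fin.ext_iff]
        have := b.2
        omega
      by_cases hb : (b : ℕ) = a + 1
      · rw [if_pos hb, if_neg fun h => hiff.1 h hb]
      · rw [if_neg hb, if_pos (hiff.2 hb)]
  refine ⟨o, fun α _ _ => ?_, fun α hα β hβ e _ hdα hdβ hde hne hfα hfβ => ?_⟩
  · simp only [o]
    rcases signProd_eq α with h | h <;> rw [h] <;> split_ifs <;> simp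
  · obtain ⟨a, b, hab, hz, hQ, h⟩ := hval α hα hdα
    obtain ⟨a', b', hab', hz', hQ', h'⟩ := hval β hβ hdβ
    obtain ⟨j, hj⟩ := Finset.card_eq_one.1 hde
    have hj' : ∀ x, e x = 0 ↔ x = j := fun x => by
      rw [← mem_zeroSet, hj, Finset.mem_singleton]
    obtain ⟨h1, h2⟩ := h e j hfα hj'
    obtain ⟨h3, h4⟩ := h' e j hfβ hj'
    -- Two faces through e with the same zero set coincide, since e determines their nonzero
    -- entries.
    have hneq : ¬ ((a : ℕ) = a' ∧ (b : ℕ) = b') := by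
      rintro ⟨h5, h6⟩
      obtain rfl : a = a' := Fin.ext h5
      obtain rfl : b = b' := Fin.ext h6
      apply hne
      funext x
      by_cases h0 : α x = 0
      · rw [h0, eq_comm, hz', ← hz, h0]
      · have h0' : β x ≠ 0 := fun h7 => h0 ((hz x).2 ((hz' x).1 h7))
        rcases hfα x with h7 | h7
        · exact absurd h7 h0
        · rcases hfβ x with h8 | h8
          · exact absurd h8 h0'
          · rw [← h7, h8]
    rw [h2, h4]
    simp only [Fin.ext_iff] at h1 h3
    have hj2 := j.2
    split_ifs <;> first | (exfalso; omega) | ring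

/-! #### The genus -/

theorem hasGenus_mirror (hn : 3 ≤ n) {g : ℕ} (hg : (g : ℤ) = 1 + 2 ^ (n - 3) * ((n : ℤ) - 4)) :
    HasGenus (mirrorComplex (polygonBoundary n)) g := by
  refine ⟨isPolyhedralSurface_mirror hn, isOrientable_mirror hn, ?_⟩
  rw [faceCount_zero hn, faceCount_one, faceCount_two hn, hg]
  obtain ⟨m, rfl⟩ : ∃ m, n = m + 3 := ⟨n - 3, by omega⟩
  simp only [Nat.add_sub_cancel, show m + 3 - 1 = m + 2 by omega, show m + 3 - 2 = m + 1 by omega]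
  push_cast
  ring

theorem exists_genus : ∃ g : ℕ → ℕ,
    (∀ q : ℕ, 3 ≤ q → (g q : ℤ) = 1 + 2 ^ (q - 3) * ((q : ℤ) - 4)) ∧
      (fun q : ℕ => (g q : ℝ)) =O[Filter.atTop]
        (fun q : ℕ => (faceCount (mirrorComplex (polygonBoundary q)) 0 : ℝ) *
          Real.log (faceCount (mirrorComplex (polygonBoundary q)) 0 : ℝ)) := by
  have hg : ∀ q : ℕ, 3 ≤ q →
      (((1 + 2 ^ (q - 3) * ((q : ℤ) - 4)).toNat : ℕ) : ℤ) = 1 + 2 ^ (q - 3) * ((q : ℤ) - 4) := by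
    intro q hq
    refine Int.toNat_of_nonneg ?_
    rcases hq.eq_or_lt with rfl | hq
    · norm_num
    · have h1 : (0 : ℤ) ≤ (q : ℤ) - 4 := by omega
      positivity
  refine ⟨fun q => (1 + 2 ^ (q - 3) * ((q : ℤ) - 4)).toNat, hg, ?_⟩
  -- With 2^q vertices, the comparison function is 2^q · q · log 2; the constant 2 suffices because
  -- log 2 > 1/2.
  refine Asymptotics.IsBigO.of_bound 2 ?_
  filter_upwards [Filter.eventually_ge_atTop 3] with q hq
  have h1 : (((1 + 2 ^ (q - 3) * ((q : ℤ) - 4)).toNat : ℕ) : ℝ) =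
      1 + 2 ^ (q - 3) * ((q : ℝ) - 4) := by
    exact_mod_cast congrArg (Int.cast : ℤ → ℝ) (hg q hq)
  have h3 : (0 : ℝ) ≤ (((1 + 2 ^ (q - 3) * ((q : ℤ) - 4)).toNat : ℕ) : ℝ) := Nat.cast_nonneg _
  have hq' : (3 : ℝ) ≤ q := by exact_mod_cast hq
  rw [faceCount_zero hq]
  push_cast
  rw [Real.log_pow, Real.norm_of_nonneg h3, h1, Real.norm_of_nonneg
    (mul_nonneg (by positivity) (mul_nonneg (by positivity) (Real.log_nonneg (by norm_num))))]
  have h2 : (2 : ℝ) ^ (q - 3) ≤ 2 ^ q := pow_le_pow_right₀ (by norm_num) (by omega)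
  have h4 : (1 : ℝ) ≤ 2 ^ (q - 3) := one_le_pow₀ (by norm_num)
  have h5 := Real.log_two_gt_d9
  have h6 : (2 : ℝ) ^ (q - 3) * (q : ℝ) ≤ 2 ^ q * q := by gcongr
  have h7 : (2 : ℝ) ^ q * q * (1 / 2) ≤ 2 ^ q * q * Real.log 2 := by
    gcongr
    linarith
  nlinarith

end Surface


/-! ### The Cubical Gale Evenness Condition -/

section CubicalGale

/-- Unrolls the recursion. A facet whose largest zero is c arises as a mirrored polygon edge when
coordinate c is added, or comes from the 4-cube if c ≤ 3. Just after that the apex is c, so the next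
entry is +1 precisely when a, b are consecutive; from then on the apex is no longer a zero and all
entries are -1. The guard 3 ≤ c exempts facets of the 4-cube with zeros 0, 1, 2, whose next entry is
arbitrary. -/
theorem mem_sphereFacets_iff {n : ℕ} (hn : 4 ≤ n) {α : SignVec n} :
    α ∈ sphereFacets n ↔ ∃ a b c : Fin n, a < b ∧ b < c ∧
      (∀ x, α x = 0 ↔ x = a ∨ x = b ∨ x = c) ∧
      ((b : ℕ) = a + 1 ∨ ((a : ℕ) = 0 ∧ (b : ℕ) + 1 = c)) ∧
      (∀ x : Fin n, (c : ℕ) + 1 < x → α x = -1) ∧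
      (∀ x : Fin n, (x : ℕ) = c + 1 → 3 ≤ (c : ℕ) →
        α x = if (b : ℕ) = a + 1 then 1 else -1) := by
  induction n, hn using Nat.le_induction with
  | base =>
    rw [sphereFacets_four, Set.mem_ofPred_eq, dim_eq_three_iff]
    constructor
    · rintro ⟨a, b, c, hab, hbc, h⟩
      have hab' : (a : ℕ) < b := hab
      have hbc' : (b : ℕ) < c := hbc
      have hc := c.2
      refine ⟨a, b, c, hab, hbc, h, by omega, fun x hx => ?_, fun x hx => ?_⟩
      · have := x.2; omega
      · have := x.2; omega
    · rintro ⟨a, b, c, hab, hbc, h, -⟩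
      exact ⟨a, b, c, hab, hbc, h⟩
  | succ n hn ih =>
    rw [mem_sphereFacets_succ hn]
    constructor
    · intro h
      have hext : ∀ {a b c : Fin n}, α (Fin.last n) ≠ 0 →
          (∀ x, (Fin.init α : SignVec n) x = 0 ↔ x = a ∨ x = b ∨ x = c) →
          ∀ x, α x = 0 ↔ x = a.castSucc ∨ x = b.castSucc ∨ x = c.castSucc := by
        intro a b c h0 hz x
        induction x using Fin.lastCases with
        | last =>
          simp only [h0, false_iff, Fin.ext_iff, Fin.val_last, Fin.val_castSucc]
          omega
        | cast x =>
          simpa [Fin.init] using hz x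
      rcases h with ⟨h1, h2, h3⟩ | ⟨h1, h2, h3⟩ | ⟨h1, h2, h3⟩
      · obtain ⟨a, b, c, hab, hbc, hz, hcase, hs1, hs2⟩ := ih.1 h1
        rw [mem_mirror_polygonTriangulation_of_three (by omega) hab hbc hz] at h2
        refine ⟨a.castSucc, b.castSucc, c.castSucc, hab, hbc, hext (by rw [h3]; decide) hz,
          hcase, fun x hx => ?_, fun x hx hc => ?_⟩
        · have := x.2
          simp only [Fin.val_castSucc] at hx
          omega
        · have hxl : x = Fin.last n := Fin.ext (by
            simp only [Fin.val_castSucc] at hx; simp only [Fin.val_last]; omega)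
          subst hxl
          exact h3.trans (if_pos h2.1).symm
      · obtain ⟨a, b, c, hab, hbc, hz, hcase, hs1, hs2⟩ := ih.1 h1
        rw [mem_mirror_polygonTriangulation_of_three (by omega) hab hbc hz] at h2
        refine ⟨a.castSucc, b.castSucc, c.castSucc, hab, hbc, hext (by rw [h3]; decide) hz,
          hcase, fun x hx => ?_, fun x hx hc => ?_⟩
        · induction x using Fin.lastCases with
          | last => exact h3
          | cast x => exact hs1 x hx
        · induction x using Fin.lastCases with
          | last =>
            simp only [Fin.val_castSucc, Fin.val_last] at hx ⊢
            rw [h3, if_neg fun h4 => h2 ⟨h4, hx.symm⟩]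
          | cast x => exact hs2 x hx hc
      · obtain ⟨a, b, hab, hz⟩ := dim_eq_two_iff.1 h2
        rw [mem_mirror_polygonBoundary_of_two (by omega) hab hz] at h1
        refine ⟨a.castSucc, b.castSucc, Fin.last n, hab, Fin.castSucc_lt_last b, fun x => ?_, ?_,
          fun x hx => ?_, fun x hx => ?_⟩
        · induction x using Fin.lastCases with
          | last => simp [h3]
          | cast x =>
            have h4 : x.castSucc ≠ Fin.last n := (Fin.castSucc_lt_last x).ne
            simpa [Fin.init, h4] using hz x
        · simpa using h1
        · have := x.2
          simp only [Fin.val_last] at hx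
          omega
        · have := x.2
          simp only [Fin.val_last] at hx
          omega
    · rintro ⟨a, b, c, hab, hbc, hz, hcase, hs1, hs2⟩
      have hab' : (a : ℕ) < b := hab
      have hbc' : (b : ℕ) < c := hbc
      have hc := c.2
      by_cases hcl : (c : ℕ) = n
      · right; right
        have h0 : ∀ x : Fin n, (Fin.init α : SignVec n) x = 0 ↔
            x = ⟨a, by omega⟩ ∨ x = ⟨b, by omega⟩ := by
          intro x
          rw [Fin.init, hz]
          simp only [Fin.ext_iff, Fin.val_castSucc]
          have := x.2
          omega
        have hlt : (⟨a, by omega⟩ : Fin n) < ⟨b, by omega⟩ := hab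
        refine ⟨(mem_mirror_polygonBoundary_of_two (by omega) hlt h0).2 (by simp only; omega),
          dim_eq_two_iff.2 ⟨_, _, hlt, h0⟩, (hz _).2 (Or.inr (Or.inr (Fin.ext hcl.symm)))⟩
      · have h0 : ∀ x : Fin n, (Fin.init α : SignVec n) x = 0 ↔
            x = ⟨a, by omega⟩ ∨ x = ⟨b, by omega⟩ ∨ x = ⟨c, by omega⟩ := by
          intro x
          rw [Fin.init, hz]
          simp only [Fin.ext_iff, Fin.val_castSucc]
        have hlt : (⟨a, by omega⟩ : Fin n) < ⟨b, by omega⟩ := hab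
        have hlt' : (⟨b, by omega⟩ : Fin n) < ⟨c, by omega⟩ := hbc
        have hmem : (Fin.init α : SignVec n) ∈ sphereFacets n :=
          ih.2 ⟨_, _, _, hlt, hlt', h0, hcase, fun x hx => hs1 x.castSucc hx,
            fun x hx => hs2 x.castSucc hx⟩
        have hT := mem_mirror_polygonTriangulation_of_three (n := n) (by omega) hlt hlt' h0
        simp only at hT
        by_cases hcn : (c : ℕ) + 1 = n
        · have h3 := hs2 (Fin.last n) (by simp only [Fin.val_last]; omega) (by omega)
          by_cases hba : (b : ℕ) = a + 1
          · rw [if_pos hba] at h3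
            exact Or.inl ⟨hmem, hT.2 ⟨hba, hcn⟩, h3⟩
          · rw [if_neg hba] at h3
            exact Or.inr (Or.inl ⟨hmem, fun h4 => hba (hT.1 h4).1, h3⟩)
        · exact Or.inr (Or.inl ⟨hmem, fun h4 => hcn (hT.1 h4).2,
            hs1 _ (by simp only [Fin.val_last]; omega)⟩)

/-! ### Gale parities for sign vectors with two zeros in the tail -/

variable {n : ℕ}

theorem galeEvenFrom_succ_iff {μ : SignVec n} {s : ℕ} (h : ∀ i : Fin n, (i : ℕ) = s → μ i = 0) :
    GaleEvenFrom μ s ↔ GaleEvenFrom μ (s + 1) := by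
  constructor
  · exact fun hG i j hi => hG i j (by omega)
  · intro hG i j hi hij hi0 hj0
    have : (i : ℕ) ≠ s := fun h1 => hi0 (h i h1)
    exact hG i j (by omega) hij hi0 hj0

/-- With only two zeros, evenness forbids an isolated zero flanked by nonzero entries. So the zeros
are adjacent, or they sit at the two ends of the tail. -/
theorem galeEvenFrom_iff {μ : SignVec n} {s : ℕ} {x y : Fin n} (hxy : x < y) (hs : s ≤ (x : ℕ))
    (hz : ∀ k : Fin n, s ≤ (k : ℕ) → (μ k = 0 ↔ k = x ∨ k = y)) :
    GaleEvenFrom μ s ↔ (y : ℕ) = x + 1 ∨ ((x : ℕ) = s ∧ (y : ℕ) + 1 = n) := by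
  have hxy' : (x : ℕ) < y := hxy
  have hy := y.2
  constructor
  · intro hG
    by_contra hcon
    -- An isolated interior zero z violates evenness, tested on its two neighbours.
    have key : ∀ z : Fin n, (z = x ∨ z = y) → s < (z : ℕ) → (z : ℕ) + 1 < n →
        (∀ k : Fin n, k = x ∨ k = y → (k : ℕ) + 1 ≠ z ∧ (k : ℕ) ≠ z + 1) → False := by
      intro z hz' hsz hzn hk
      have h1 : μ ⟨z - 1, by omega⟩ ≠ 0 := fun h0 => by
        have h2 := (hk _ ((hz _ (by simp only; omega)).1 h0)).1
        simp only at h2; omega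
      have h2 : μ ⟨z + 1, hzn⟩ ≠ 0 := fun h0 => by
        have h2 := (hk _ ((hz _ (by simp only; omega)).1 h0)).2
        simp only at h2; omega
      have h3 := hG ⟨z - 1, by omega⟩ ⟨z + 1, hzn⟩ (by simp only; omega)
        (by simp only [Fin.lt_def]; omega) h1 h2
      have h4 : (Finset.univ.filter fun k : Fin n => (⟨z - 1, by omega⟩ : Fin n) < k ∧
          k < ⟨z + 1, hzn⟩ ∧ μ k = 0) = {z} := by
        ext k
        simp only [Finset.mem_filter, Finset.mem_univ, true_and, Finset.mem_singleton, Fin.lt_def,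
          Fin.ext_iff]
        constructor
        · omega
        · intro hkz
          have : k = z := Fin.ext hkz
          subst this
          exact ⟨by omega, by omega, (hz k (by omega)).2 hz'⟩
      rw [h4, Finset.card_singleton] at h3
      exact absurd h3 (by decide)
    by_cases hxs : (x : ℕ) = s
    · exact key y (Or.inr rfl) (by omega) (by omega) (by rintro k (rfl | rfl) <;> omega)
    · exact key x (Or.inl rfl) (by omega) (by omega) (by rintro k (rfl | rfl) <;> omega)
  · intro h i j hi hij hi0 hj0
    have hij' : (i : ℕ) < j := hij
    rw [Ne, hz i hi] at hi0
    rw [Ne, hz j (by omega)] at hj0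
    simp only [Fin.ext_iff, not_or] at hi0 hj0
    have hj := j.2
    by_cases hin : (i : ℕ) < x ∧ (y : ℕ) < j
    · have h4 : (Finset.univ.filter fun k : Fin n => i < k ∧ k < j ∧ μ k = 0) = {x, y} := by
        ext k
        simp only [Finset.mem_filter, Finset.mem_univ, true_and, Finset.mem_singleton, Fin.lt_def,
          Finset.mem_insert]
        constructor
        · rintro ⟨h1, h2, h3⟩
          exact (hz k (by omega)).1 h3
        · rintro (rfl | rfl)
          · exact ⟨hin.1, by omega, (hz k (by omega)).2 (Or.inl rfl)⟩
          · exact ⟨by omega, by omega, (hz k (by omega)).2 (Or.inr rfl)⟩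
      rw [h4, Finset.card_pair hxy.ne]
      decide
    · have h4 : (Finset.univ.filter fun k : Fin n => i < k ∧ k < j ∧ μ k = 0) = ∅ := by
        rw [Finset.filter_eq_empty_iff]
        rintro k - ⟨h1, h2, h3⟩
        rw [Fin.lt_def] at h1 h2
        rcases (hz k (by omega)).1 h3 with rfl | rfl <;> omega
      rw [h4]
      simp

/-- The value is odd only when exactly one zero sits at the start; this parity separates the
end-to-end pair of zeros from the adjacent pair. -/
theorem startZeros_eq {μ : SignVec n} {s : ℕ} {x y : Fin n} (hxy : x < y) (hs : s ≤ (x : ℕ))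
    (hz : ∀ k : Fin n, s ≤ (k : ℕ) → (μ k = 0 ↔ k = x ∨ k = y)) :
    startZeros μ s = if (x : ℕ) = s then (if (y : ℕ) = x + 1 then 2 else 1) else 0 := by
  have hxy' : (x : ℕ) < y := hxy
  have hsn : s < n := hs.trans_lt x.2
  unfold startZeros
  by_cases hxs : (x : ℕ) = s
  · rw [if_pos hxs]
    by_cases hyx : (y : ℕ) = x + 1
    · rw [if_pos hyx, ← Finset.card_pair hxy.ne]
      congr 1
      ext k
      simp only [Finset.mem_filter, Finset.mem_univ, true_and, Finset.mem_singleton,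
          Finset.mem_insert]
      constructor
      · rintro ⟨h1, h2⟩
        exact (hz k h1).1 (h2 k h1 le_rfl)
      · intro hk
        have hk' : s ≤ (k : ℕ) := by rcases hk with rfl | rfl <;> omega
        refine ⟨hk', fun j hj hjk => (hz j hj).2 ?_⟩
        rw [Fin.le_def] at hjk
        simp only [Fin.ext_iff] at hk ⊢
        omega
    · rw [if_neg hyx, ← Finset.card_singleton x]
      congr 1
      ext k
      simp only [Finset.mem_filter, Finset.mem_univ, true_and, Finset.mem_singleton]
      constructor
      · rintro ⟨h1, h2⟩
        rcases (hz k h1).1 (h2 k h1 le_rfl) with h3 | h3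
        · exact h3
        · exfalso
          subst h3
          have h4 := (hz ⟨x + 1, by omega⟩ (by simp only; omega)).1
            (h2 ⟨x + 1, by omega⟩ (by simp only; omega) (by rw [Fin.le_def]; simp only; omega))
          simp only [Fin.ext_iff] at h4
          omega
      · rintro rfl
        refine ⟨hs, fun j hj hjk => (hz j hj).2 (Or.inl ?_)⟩
        rw [Fin.le_def] at hjk
        exact Fin.ext (by omega)
  · rw [if_neg hxs, Finset.card_eq_zero, Finset.filter_eq_empty_iff]
    rintro k - ⟨h1, h2⟩
    have h3 := (hz ⟨s, hsn⟩ le_rfl).1 (h2 ⟨s, hsn⟩ le_rfl h1)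
    simp only [Fin.ext_iff] at h3
    omega

/-! ### The relabelling and its effect on the Gale condition -/

theorem SignVec.reverseFlip_eq_zero_iff {α : SignVec n} {i : Fin n} :
    reverseFlip α i = 0 ↔ α (Fin.rev i) = 0 := by
  unfold reverseFlip
  rcases neg_one_pow_eq_or SignType (i : ℕ) with h | h <;> rw [h] <;>
    generalize α (Fin.rev i) = s <;> revert s <;> decide

theorem SignVec.dim_reverseFlip (α : SignVec n) : dim (reverseFlip α) = dim α := by
  refine Finset.card_bij' (fun i _ => Fin.rev i) (fun i _ => Fin.rev i) ?_ ?_ ?_ ?_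
  · intro i hi
    rw [mem_zeroSet] at hi ⊢
    exact reverseFlip_eq_zero_iff.1 hi
  · intro i hi
    rw [mem_zeroSet] at hi ⊢
    rw [reverseFlip_eq_zero_iff, Fin.rev_rev]
    exact hi
  · exact fun i _ => Fin.rev_rev i
  · exact fun i _ => Fin.rev_rev i

theorem SignType.neg_one_pow_mul_eq_iff {k : ℕ} {s r : SignType} :
    (-1) ^ k * s = r ↔ s = (-1) ^ k * r := by
  rcases neg_one_pow_eq_or SignType k with h | h <;> rw [h] <;> revert s r <;> decide

theorem SignType.neg_one_pow_mul_self (k : ℕ) : (-1 : SignType) ^ k * (-1) ^ k = 1 := by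
  rcases neg_one_pow_eq_or SignType k with h | h <;> rw [h] <;> decide

/-- Reversal moves the tail of constant entries -1 after the largest zero c to the front, where the
sign flip makes it the alternating prefix. The entry at c + 1 becomes σ, and its value (+1 for
adjacent a, b and -1 otherwise) becomes the parity requirement on the zeros at the start of the
remaining part. -/
theorem cubicalGale_reverseFlip_iff (hn : 4 ≤ n) {α : SignVec n} :
    CubicalGale 3 (reverseFlip α) ↔ α ∈ sphereFacets n := by
  rw [mem_sphereFacets_iff hn]
  have hzero : ∀ {a b c : Fin n}, (∀ x, α x = 0 ↔ x = a ∨ x = b ∨ x = c) →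
      ∀ x, reverseFlip α x = 0 ↔ (x = Fin.rev c ∨ x = Fin.rev b ∨ x = Fin.rev a) := by
    intro a b c h x
    rw [reverseFlip_eq_zero_iff, h]
    simp only [Fin.ext_iff, Fin.val_rev]
    have := x.2; have := a.2; have := b.2; have := c.2
    omega
  have hpow : ∀ k : ℕ, (-1 : SignType) ^ k ≠ 0 := fun k => by
    rcases neg_one_pow_eq_or SignType k with h | h <;> rw [h] <;> decide
  -- the sign before the first zero
  have hsign : ∀ (t : ℕ) (s : SignType), s ≠ 0 →
      ((-1) ^ (t + 1) * s = (-1) ^ (t + 1) ↔ s = 1) ∧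
      ((-1) ^ (t + 1) * s = (-1) ^ t ↔ s = -1) := fun t s hs => by
    rw [pow_succ]
    rcases neg_one_pow_eq_or SignType t with h | h <;> rw [h] <;> revert s <;> decide
  constructor
  · rintro ⟨hd, hcase⟩
    rw [dim_reverseFlip] at hd
    obtain ⟨a, b, c, hab, hbc, hz⟩ := dim_eq_three_iff.1 hd
    have hz' := hzero hz
    have hab' : (a : ℕ) < b := hab
    have hbc' : (b : ℕ) < c := hbc
    have hc := c.2
    have hlt : Fin.rev b < Fin.rev a := Fin.rev_lt_rev.2 hab
    have hva : (Fin.rev a : ℕ) = n - (a + 1) := Fin.val_rev a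
    have hvb : (Fin.rev b : ℕ) = n - (b + 1) := Fin.val_rev b
    have hvc : (Fin.rev c : ℕ) = n - (c + 1) := Fin.val_rev c
    refine ⟨a, b, c, hab, hbc, hz, ?_⟩
    have hzk : ∀ k : Fin n, (Fin.rev c : ℕ) + 1 ≤ k →
        (reverseFlip α k = 0 ↔ k = Fin.rev b ∨ k = Fin.rev a) := by
      intro k hk
      rw [hz']
      simp only [Fin.ext_iff]
      omega
    have hmid := galeEvenFrom_iff hlt (by omega : (Fin.rev c : ℕ) + 1 ≤ Fin.rev b) hzk
    have hst := startZeros_eq hlt (by omega : (Fin.rev c : ℕ) + 1 ≤ Fin.rev b) hzk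
    rcases hcase with ⟨h0, hG⟩ | ⟨t, σ, ht0, htn, hσ0, hlow, hσ, ht, hG, he, ho⟩ |
      ⟨σ, hσ0, hlow, hσ, hhigh⟩
    · have h1 := (hz' ⟨0, by omega⟩).1 (h0 _ rfl)
      simp only [Fin.ext_iff] at h1
      have hc0 : (Fin.rev c : ℕ) = 0 := by omega
      rw [galeEvenFrom_succ_iff (fun i hi => h0 i hi)] at hG
      rw [hc0] at hmid
      have h2 := hmid.1 hG
      refine ⟨by omega, fun x hx => ?_, fun x hx => ?_⟩
      · have := x.2; omega
      · have := x.2; omega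
    · have hct : (Fin.rev c : ℕ) = t := by
        have h1 : ∀ i : Fin n, (i : ℕ) < t → reverseFlip α i ≠ 0 := by
          intro i hi
          by_cases hi' : (i : ℕ) + 1 < t
          · rw [hlow i hi']; exact hpow _
          · rw [hσ i (by omega)]; exact hσ0
        have h2 := (hz' ⟨t, by omega⟩).1 (ht _ rfl)
        have h3 : ¬ (Fin.rev c : ℕ) < t := fun h3 => h1 _ h3 ((hz' _).2 (Or.inl rfl))
        simp only [Fin.ext_iff] at h2
        omega
      rw [hct] at hmid hst
      have h2 := hmid.1 hG
      refine ⟨by omega, fun x hx => ?_, fun x hx hc3 => ?_⟩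
      · have hx2 := x.2
        have h3 := hlow (Fin.rev x) (by rw [Fin.val_rev]; omega)
        unfold reverseFlip at h3
        rw [Fin.rev_rev, SignType.neg_one_pow_mul_eq_iff, pow_succ, ← mul_assoc,
          SignType.neg_one_pow_mul_self] at h3
        simpa using h3
      · have hx2 := x.2
        obtain ⟨t', rfl⟩ : ∃ t', t = t' + 1 := ⟨t - 1, by omega⟩
        have hxt : (Fin.rev x : ℕ) = t' := by rw [Fin.val_rev]; omega
        have h3 := hσ (Fin.rev x) (by omega)
        unfold reverseFlip at h3
        rw [Fin.rev_rev, hxt] at h3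
        have hx0 : α x ≠ 0 := fun h0 => by
          rw [h0, mul_zero] at h3; exact hσ0 h3.symm
        -- Translates the parity of the exponent: σ = (-1)^(t+1) means α x = 1, and σ = (-1)^t means
        -- α x = -1, where t = t' + 1.
        have h4 := hsign (t' + 1) (α x) hx0
        have h5 : ((-1 : SignType)) ^ (t' + 1 + 1) = (-1) ^ t' := by
          rw [pow_succ, pow_succ, mul_assoc]; simp
        rw [h5, h3] at h4
        rw [h5] at he
        by_cases hba : (b : ℕ) = a + 1
        · rw [if_pos hba]
          by_contra hne
          have h6 : α x = -1 := by
            revert hne hx0; generalize α x = s; revert s; decide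
          have h7 := ho (h4.2.2 h6)
          rw [hst] at h7
          split_ifs at h7
          · exact absurd h7 (by decide)
          · omega
          · exact absurd h7 (by decide)
        · rw [if_neg hba]
          by_contra hne
          have h6 : α x = 1 := by
            revert hne hx0; generalize α x = s; revert s; decide
          have h7 := he (h4.1.2 h6)
          rw [hst, if_pos (by omega), if_neg (by omega)] at h7
          exact absurd h7 (by decide)
    · have h1 := (hz' ⟨n - 3, by omega⟩).1 (hhigh _ le_rfl)
      have h2 := (hz' ⟨n - 2, by omega⟩).1 (hhigh _ (by simp only; omega))
      have h3 := (hz' ⟨n - 1, by omega⟩).1 (hhigh _ (by simp only; omega))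
      simp only [Fin.ext_iff] at h1 h2 h3
      refine ⟨by omega, fun x hx => ?_, fun x hx => by omega⟩
      have hx2 := x.2
      have h4 := hlow (Fin.rev x) (by rw [Fin.val_rev]; omega)
      unfold reverseFlip at h4
      rw [Fin.rev_rev, SignType.neg_one_pow_mul_eq_iff, pow_succ, ← mul_assoc,
        SignType.neg_one_pow_mul_self] at h4
      simpa using h4
  · rintro ⟨a, b, c, hab, hbc, hz, hcase, hs1, hs2⟩
    have hz' := hzero hz
    have hab' : (a : ℕ) < b := hab
    have hbc' : (b : ℕ) < c := hbc
    have hc := c.2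
    have hlt : Fin.rev b < Fin.rev a := Fin.rev_lt_rev.2 hab
    have hva : (Fin.rev a : ℕ) = n - (a + 1) := Fin.val_rev a
    have hvb : (Fin.rev b : ℕ) = n - (b + 1) := Fin.val_rev b
    have hvc : (Fin.rev c : ℕ) = n - (c + 1) := Fin.val_rev c
    have hzk : ∀ k : Fin n, (Fin.rev c : ℕ) + 1 ≤ k →
        (reverseFlip α k = 0 ↔ k = Fin.rev b ∨ k = Fin.rev a) := by
      intro k hk
      rw [hz']
      simp only [Fin.ext_iff]
      omega
    have hmid := (galeEvenFrom_iff hlt (by omega : (Fin.rev c : ℕ) + 1 ≤ Fin.rev b) hzk).2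
      (by omega)
    have hst := startZeros_eq hlt (by omega : (Fin.rev c : ℕ) + 1 ≤ Fin.rev b) hzk
    have hlow : ∀ i : Fin n, (i : ℕ) + 1 < Fin.rev c → reverseFlip α i = (-1) ^ ((i : ℕ) + 1) := by
      intro i hi
      unfold reverseFlip
      rw [hs1 (Fin.rev i) (by rw [Fin.val_rev]; omega), pow_succ]
    refine ⟨by rw [dim_reverseFlip]; exact dim_eq_three_iff.2 ⟨a, b, c, hab, hbc, hz⟩, ?_⟩
    by_cases hcn : (c : ℕ) + 1 = n
    · left
      have h0 : ∀ i : Fin n, (i : ℕ) = 0 → reverseFlip α i = 0 := fun i hi =>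
        (hz' i).2 (Or.inl (Fin.ext (by omega)))
      refine ⟨h0, ?_⟩
      rw [galeEvenFrom_succ_iff h0]
      rwa [show (Fin.rev c : ℕ) = 0 by omega] at hmid
    · right
      obtain ⟨t, ht⟩ : ∃ t : ℕ, (Fin.rev c : ℕ) = t + 1 := ⟨Fin.rev c - 1, by omega⟩
      have htn : t < n := by have := (Fin.rev c).2; omega
      have hσ0 : reverseFlip α ⟨t, htn⟩ ≠ 0 := fun h0 => by
        rw [hz'] at h0
        simp only [Fin.ext_iff] at h0
        omega
      rw [ht] at hmid hst hlow
      -- The case c = 2 has zeros 0, 1, 2, which is the third alternative of the Gale condition,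
      -- where σ is free.
      by_cases hc2 : (c : ℕ) = 2
      · right
        refine ⟨reverseFlip α ⟨t, htn⟩, hσ0, fun i hi => hlow i (by omega), fun i hi => ?_,
          fun i hi => ?_⟩
        · congr 1; exact Fin.ext (by simp only; omega)
        · rw [hz']
          simp only [Fin.ext_iff]
          have := i.2
          omega
      · left
        refine ⟨t + 1, reverseFlip α ⟨t, htn⟩, by omega, by omega, hσ0, fun i hi => hlow i hi,
          fun i hi => ?_, fun i hi => ?_, hmid, ?_⟩
        · congr 1; exact Fin.ext (by simp only; omega)
        · exact (hz' i).2 (Or.inl (Fin.ext (by omega)))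
        · have h5 : ((-1 : SignType)) ^ (t + 1 + 1) = (-1) ^ t := by
            rw [pow_succ, pow_succ, mul_assoc]; simp
          have hx := hs2 (Fin.rev ⟨t, htn⟩) (by rw [Fin.val_rev]; simp only; omega) (by omega)
          have hx0 : α (Fin.rev ⟨t, htn⟩) ≠ 0 := fun h0 => hσ0 (reverseFlip_eq_zero_iff.2 h0)
          have h4 := hsign (t + 1) _ hx0
          rw [h5] at h4 ⊢
          have h6 : reverseFlip α ⟨t, htn⟩ = (-1) ^ t * α (Fin.rev ⟨t, htn⟩) := rfl
          rw [h6, hst, h4.1, h4.2, hx]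
          by_cases hba : (b : ℕ) = a + 1
          · rw [if_pos hba]
            refine ⟨fun _ => ?_, fun h => absurd h (by decide)⟩
            split_ifs
            · decide
            · omega
            · decide
          · rw [if_neg hba]
            refine ⟨fun h => absurd h (by decide), fun _ => ?_⟩
            rw [if_pos (by omega), if_neg (by omega)]
            decide

end CubicalGale


/-! ### Piecewise linear sign fans -/

section SignFan

theorem SignType.cast_eq_one_or_neg_one {s : SignType} (hs : s ≠ 0) :
    (s : ℝ) = 1 ∨ (s : ℝ) = -1 := by
  cases s <;> simp at hs ⊢

theorem SignType.abs_eq_mul {s : SignType} (hs : s ≠ 0) {r : ℝ} (h : 0 ≤ (s : ℝ) * r) :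
    |r| = (s : ℝ) * r := by
  rcases SignType.cast_eq_one_or_neg_one hs with h1 | h1 <;> rw [h1] at h ⊢
  · rw [one_mul] at h ⊢; exact abs_of_nonneg h
  · rw [abs_of_nonpos (by linarith)]; ring

theorem SignType.eq_sign_iff {s : SignType} (hs : s ≠ 0) {r : ℝ} :
    (SignType.sign r = 0 ∨ s = SignType.sign r) ↔ 0 ≤ (s : ℝ) * r := by
  rcases lt_trichotomy r 0 with h | h | h
  · rw [sign_neg h]
    cases s <;> simp at hs ⊢ <;> linarith
  · subst h; simp
  · rw [sign_pos h]
    cases s <;> simp at hs ⊢ <;> linarith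

/-- The sign vector of the functions `g` at the point `x`. -/
noncomputable def signVec {E : Type*} {q : ℕ} (g : Fin q → E → ℝ) (x : E) : SignVec q :=
  fun j => SignType.sign (g j x)

theorem signVec_eq_zero {E : Type*} {q : ℕ} {g : Fin q → E → ℝ} {x : E} {j : Fin q} : signVec g x j = 0 ↔ g j x = 0 := sign_eq_zero_iff

theorem isFace_signVec_iff {E : Type*} {q : ℕ} {g : Fin q → E → ℝ} {ε : SignVec q} (hε : IsVertex ε) {x : E} :
    IsFace ε (signVec g x) ↔ ∀ j, 0 ≤ (ε j : ℝ) * g j x :=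
  forall_congr' fun j => SignType.eq_sign_iff (hε j)

theorem card_constraints {E : Type*} {q : ℕ} (g : Fin q → E → ℝ) (x : E) :
    Fintype.card (Option (zeroSet (signVec g x))) = dim (signVec g x) + 1 := by
  simp [dim]

variable {E : Type*} [NormedAddCommGroup E] [InnerProductSpace ℝ E]

local notation "⟪" x ", " y "⟫" => inner ℝ x y

/-- Functions `g` that are linear on the cones on which their signs are constant, with linear
extensions `L`, together with a convex support function `h` that agrees with the vector `v ε`
precisely on the cone belonging to `ε`. -/
structure IsSignFan {q : ℕ} (g : Fin q → E → ℝ) (L : SignVec q → Fin q → E) (v : SignVec q → E)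
    (h : E → ℝ) : Prop where
  continuous : ∀ j, Continuous (g j)
  eq_of_g : ∀ ε x, IsVertex ε → (∀ j, 0 ≤ (ε j : ℝ) * g j x) → ∀ j, g j x = ⟪L ε j, x⟫
  eq_of_L : ∀ ε x, IsVertex ε → (∀ j, 0 ≤ (ε j : ℝ) * ⟪L ε j, x⟫) → ∀ j, g j x = ⟪L ε j, x⟫
  inj : ∀ x, (∀ j, g j x = 0) → x = 0
  le_support : ∀ ε x, IsVertex ε →
    ∑ j, |(|g j x| - (ε j : ℝ) * ⟪L ε j, x⟫)| ≤ h x - ⟪v ε, x⟫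
  support_eq : ∀ ε x, IsVertex ε → (∀ j, 0 ≤ (ε j : ℝ) * g j x) → ⟪v ε, x⟫ = h x

variable {q : ℕ} {g : Fin q → E → ℝ} {L : SignVec q → Fin q → E} {v : SignVec q → E} {h : E → ℝ}

theorem SignVec.isFace_of_common_vertex {ε α β : SignVec q} (hα : IsFace ε α) (hβ : IsFace ε β)
    (h : ∀ j, α j = 0 → β j = 0) : IsFace α β := by
  intro j
  by_cases h0 : α j = 0
  · exact Or.inl (h j h0)
  · rcases hα j with h1 | h1
    · exact absurd h1 h0
    · rcases hβ j with h2 | h2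
      · exact Or.inl h2
      · exact Or.inr (h1.symm.trans h2)

namespace IsSignFan

theorem signVec_ne_zero (F : IsSignFan g L v h) {x : E} (hx : x ≠ 0) : ∃ j, g j x ≠ 0 := by
  by_contra hcon
  push Not at hcon
  exact hx (F.inj x hcon)

theorem inner_eq (F : IsSignFan g L v h) {ε : SignVec q} (hε : IsVertex ε) {x : E}
    (hx : IsFace ε (signVec g x)) (j : Fin q) : g j x = ⟪L ε j, x⟫ :=
  F.eq_of_g ε x hε ((isFace_signVec_iff hε).1 hx) j

/-- A functional that is positive on the cone belonging to `ε`. -/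
noncomputable def height (L : SignVec q → Fin q → E) (ε : SignVec q) : E :=
  ∑ j, (ε j : ℝ) • L ε j

theorem inner_height (L : SignVec q → Fin q → E) (ε : SignVec q) (x : E) :
    ⟪height L ε, x⟫ = ∑ j, (ε j : ℝ) * ⟪L ε j, x⟫ := by
  simp [height, sum_inner, inner_smul_left]

/-- On the cone of ε the height equals Σ |g_j x|, and the g_j have no common zero except the origin.
-/
theorem inner_height_pos (F : IsSignFan g L v h) {ε : SignVec q} (hε : IsVertex ε) {x : E}
    (hx : IsFace ε (signVec g x)) (hx0 : x ≠ 0) : 0 < ⟪height L ε, x⟫ := by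
  rw [inner_height]
  have h1 := (isFace_signVec_iff hε).1 hx
  obtain ⟨j, hj⟩ := F.signVec_ne_zero hx0
  refine Finset.sum_pos' (fun i _ => ?_) ⟨j, Finset.mem_univ _, ?_⟩
  · rw [← F.inner_eq hε hx]; exact h1 i
  · rw [← F.inner_eq hε hx, ← SignType.abs_eq_mul (hε j) (h1 j)]
    exact abs_pos.2 hj

/-- Says that slices of constant height of the cone of ε contain no ray: a direction in the cone of
height 0 vanishes. -/
theorem eq_zero_of_inner_height (F : IsSignFan g L v h) {ε : SignVec q} (hε : IsVertex ε) {u : E}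
    (h0 : ⟪height L ε, u⟫ = 0) (hu : ∀ j, 0 ≤ (ε j : ℝ) * ⟪L ε j, u⟫) : u = 0 := by
  by_contra hne
  have hg := F.eq_of_L ε u hε hu
  have hf : IsFace ε (signVec g u) := (isFace_signVec_iff hε).2 fun j => by
    rw [hg j]; exact hu j
  exact (F.inner_height_pos hε hf hne).ne' h0

/-- On the closed cone belonging to `ε` the functions are additive. -/
theorem cone_comb (F : IsSignFan g L v h) {ε : SignVec q} (hε : IsVertex ε) {x y : E}
    (hx : IsFace ε (signVec g x)) (hy : IsFace ε (signVec g y)) {a b : ℝ} (ha : 0 ≤ a)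
    (hb : 0 ≤ b) : IsFace ε (signVec g (a • x + b • y)) ∧
      ∀ j, g j (a • x + b • y) = a * g j x + b * g j y := by
  have hL : ∀ j, ⟪L ε j, a • x + b • y⟫ = a * g j x + b * g j y := fun j => by
    rw [F.inner_eq hε hx, F.inner_eq hε hy, inner_add_right, inner_smul_right, inner_smul_right]
  have hx' := (isFace_signVec_iff hε).1 hx
  have hy' := (isFace_signVec_iff hε).1 hy
  have hpos : ∀ j, 0 ≤ (ε j : ℝ) * ⟪L ε j, a • x + b • y⟫ := fun j => by
    rw [hL]
    have := mul_nonneg ha (hx' j)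
    have := mul_nonneg hb (hy' j)
    nlinarith
  have hg := F.eq_of_L ε _ hε hpos
  refine ⟨(isFace_signVec_iff hε).2 fun j => ?_, fun j => ?_⟩
  · rw [hg j]; exact hpos j
  · rw [hg j, hL]

/-- Moving inside the closed cone of `ε`, without leaving the zeros of `x`, another of the
functions eventually vanishes. -/
theorem exists_hit (F : IsSignFan g L v h) {ε : SignVec q} (hε : IsVertex ε) {x u : E}
    (hx : IsFace ε (signVec g x)) (hx0 : x ≠ 0) (hu : u ≠ 0) (hφ : ⟪height L ε, u⟫ = 0)
    (hz : ∀ j, g j x = 0 → ⟪L ε j, u⟫ = 0) :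
    ∃ t : ℝ, 0 < t ∧ x + t • u ≠ 0 ∧ IsFace ε (signVec g (x + t • u)) ∧
      IsFace (signVec g x) (signVec g (x + t • u)) ∧
      dim (signVec g x) < dim (signVec g (x + t • u)) := by
  have hx' := (isFace_signVec_iff hε).1 hx
  -- N collects the functions whose absolute value decreases along u; it is nonempty since u does
  -- not lie in the cone. The minimal ratio is the first time at which one of them reaches zero.
  -- Height is preserved on the way, so the origin is not met.
  let N : Finset (Fin q) := Finset.univ.filter fun j => (ε j : ℝ) * ⟪L ε j, u⟫ < 0
  have hN : N.Nonempty := by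
    by_contra hN
    rw [Finset.not_nonempty_iff_eq_empty, Finset.filter_eq_empty_iff] at hN
    exact hu (F.eq_zero_of_inner_height hε hφ fun j => not_lt.1 (hN (Finset.mem_univ j)))
  obtain ⟨k, hk, hmin⟩ := N.exists_min_image
    (fun j => (ε j : ℝ) * g j x / -((ε j : ℝ) * ⟪L ε j, u⟫)) hN
  have hk' : (ε k : ℝ) * ⟪L ε k, u⟫ < 0 := (Finset.mem_filter.1 hk).2
  have hgk : g k x ≠ 0 := fun h0 => by
    rw [hz k h0, mul_zero] at hk'; exact lt_irrefl _ hk'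
  have hεgk : 0 < (ε k : ℝ) * g k x := by
    rw [← SignType.abs_eq_mul (hε k) (hx' k)]; exact abs_pos.2 hgk
  set t : ℝ := (ε k : ℝ) * g k x / -((ε k : ℝ) * ⟪L ε k, u⟫) with ht
  have ht0 : 0 < t := div_pos hεgk (by linarith)
  have hL : ∀ j, ⟪L ε j, x + t • u⟫ = g j x + t * ⟪L ε j, u⟫ := fun j => by
    rw [F.inner_eq hε hx, inner_add_right, inner_smul_right]
  have hpos : ∀ j, 0 ≤ (ε j : ℝ) * ⟪L ε j, x + t • u⟫ := by
    intro j
    rw [hL, mul_add]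
    by_cases hj : (ε j : ℝ) * ⟪L ε j, u⟫ < 0
    · have h1 := hmin j (Finset.mem_filter.2 ⟨Finset.mem_univ _, hj⟩)
      rw [le_div_iff₀ (by linarith)] at h1
      linarith
    · have := mul_nonneg ht0.le (not_lt.1 hj)
      have := hx' j
      linarith
  have hg := F.eq_of_L ε _ hε hpos
  have hf : IsFace ε (signVec g (x + t • u)) :=
    (isFace_signVec_iff hε).2 fun j => by rw [hg j]; exact hpos j
  have hface : IsFace (signVec g x) (signVec g (x + t • u)) :=
    isFace_of_common_vertex hx hf fun j hj => by
      rw [signVec_eq_zero] at hj ⊢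
      rw [hg, hL, hj, hz j hj]; ring
  refine ⟨t, ht0, fun h0 => ?_, hf, hface, hface.dim_lt fun heq => ?_⟩
  · have h1 := F.inner_height_pos hε hx hx0
    have h2 : ⟪height L ε, x + t • u⟫ = ⟪height L ε, x⟫ := by
      rw [inner_add_right, inner_smul_right, hφ]; ring
    rw [h0, inner_zero_right] at h2
    linarith
  · have h1 : g k (x + t • u) = 0 := by
      have h2 : (ε k : ℝ) * g k (x + t • u) = 0 := by
        have h3 : t * -((ε k : ℝ) * ⟪L ε k, u⟫) = (ε k : ℝ) * g k x :=
          div_mul_cancel₀ _ (by linarith)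
        rw [hg, hL]
        linarith
      exact (mul_eq_zero.1 h2).resolve_left fun h3 => by
        rw [h3, zero_mul] at hεgk; exact lt_irrefl _ hεgk
    have h2 := congrFun heq k
    rw [signVec_eq_zero.2 h1, signVec_eq_zero] at h2
    exact hgk h2

/-- The height functional together with the functionals that vanish at `x`. -/
noncomputable def constraints (g : Fin q → E → ℝ) (L : SignVec q → Fin q → E) (ε : SignVec q)
    (x : E) : Option (zeroSet (signVec g x)) → E
  | none => height L ε
  | some j => L ε j

/-- A nonzero u killed by all constraints could be followed until a further function vanishes,
giving more than three zeros. So sign vectors with three zeros belong to rays. -/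
theorem eq_zero_of_constraints (F : IsSignFan g L v h)
    (hO : ∀ x, x ≠ 0 → dim (signVec g x) ≤ 3) {ε : SignVec q}
    (hε : IsVertex ε) {x : E} (hx0 : x ≠ 0) (hf : IsFace ε (signVec g x))
    (hd : dim (signVec g x) = 3) {u : E} (hu : ∀ i, ⟪constraints g L ε x i, u⟫ = 0) : u = 0 := by
  by_contra hu0
  obtain ⟨t, -, h1, -, -, h2⟩ := F.exists_hit hε hf hx0 hu0 (hu none) fun j hj =>
    hu (some ⟨j, mem_zeroSet.2 (signVec_eq_zero.2 hj)⟩)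
  have := hO _ h1
  omega

/-- A ray is determined by its sign vector. -/
theorem exists_smul_of_signVec_eq (F : IsSignFan g L v h)
    (hO : ∀ x, x ≠ 0 → dim (signVec g x) ≤ 3) {x y : E} (hx0 : x ≠ 0) (hy0 : y ≠ 0)
    (hd : dim (signVec g x) = 3) (hxy : signVec g x = signVec g y) :
    ∃ r : ℝ, 0 < r ∧ ∀ j, g j y = r * g j x := by
  obtain ⟨ε, hε, hf⟩ := exists_isVertex_isFace (signVec g x)
  have hf' : IsFace ε (signVec g y) := hxy ▸ hf
  have h1 := F.inner_height_pos hε hf hx0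
  have h2 := F.inner_height_pos hε hf' hy0
  refine ⟨⟪height L ε, y⟫ / ⟪height L ε, x⟫, div_pos h2 h1, ?_⟩
  set r := ⟪height L ε, y⟫ / ⟪height L ε, x⟫ with hr
  have hu : y - r • x = 0 := by
    refine F.eq_zero_of_constraints hO hε hx0 hf hd fun i => ?_
    match i with
    | none =>
      change ⟪height L ε, y - r • x⟫ = 0
      rw [inner_sub_right, inner_smul_right, hr, div_mul_cancel₀ _ h1.ne', sub_self]
    | some j =>
      change ⟪L ε j, y - r • x⟫ = 0
      have h3 := mem_zeroSet.1 j.2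
      have h4 : signVec g y j = 0 := by rw [← hxy]; exact h3
      rw [signVec_eq_zero] at h3 h4
      rw [inner_sub_right, inner_smul_right, ← F.inner_eq hε hf, ← F.inner_eq hε hf', h3, h4]
      ring
  intro j
  rw [F.inner_eq hε hf', F.inner_eq hε hf, ← inner_smul_right, ← sub_eq_zero, ← inner_sub_right,
    hu, inner_zero_right]

/-- Along one ray the ratio |g_j| / |g_i| is constant, each sign vector with three zeros has at most
one ray, and there are finitely many sign vectors. The sum of the individual bounds serves as a
common bound. -/
theorem exists_ratio_bound (F : IsSignFan g L v h)
    (hO : ∀ x, x ≠ 0 → dim (signVec g x) ≤ 3) (i j : Fin q) :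
    ∃ C : ℝ, ∀ x, x ≠ 0 → dim (signVec g x) = 3 → g i x ≠ 0 → |g j x| ≤ C * |g i x| := by
  have h1 : ∀ β : SignVec q, ∃ C : ℝ, 0 ≤ C ∧ ∀ x, x ≠ 0 → dim (signVec g x) = 3 →
      signVec g x = β → g i x ≠ 0 → |g j x| ≤ C * |g i x| := by
    intro β
    by_cases hβ : ∃ x, x ≠ 0 ∧ dim (signVec g x) = 3 ∧ signVec g x = β
    · obtain ⟨x, hx0, hd, rfl⟩ := hβ
      refine ⟨|g j x| / |g i x|, by positivity, fun y hy0 _ hyx hi => ?_⟩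
      obtain ⟨r, hr, hrg⟩ := F.exists_smul_of_signVec_eq hO hx0 hy0 hd hyx.symm
      rw [hrg, mul_ne_zero_iff] at hi
      have := abs_pos.2 hi.2
      rw [hrg, hrg, abs_mul, abs_mul]
      apply le_of_eq
      field_simp
    · refine ⟨0, le_rfl, fun x h1 h2 h3 => ?_⟩
      exact absurd ⟨x, h1, h2, h3⟩ hβ
  choose C hC0 hC using h1
  refine ⟨∑ β, C β, fun x hx0 hd hi => (hC _ x hx0 hd rfl hi).trans ?_⟩
  exact mul_le_mul_of_nonneg_right
    (Finset.single_le_sum (fun β _ => hC0 β) (Finset.mem_univ _)) (abs_nonneg _)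

/-! ### Cones of the fan in dimension four -/

variable [FiniteDimensional ℝ E]

theorem exists_orthogonal {ι : Type*} [Fintype ι] (w : ι → E)
    (hι : Fintype.card ι < Module.finrank ℝ E) : ∃ u : E, u ≠ 0 ∧ ∀ i, ⟪w i, u⟫ = 0 := by
  let f : E →ₗ[ℝ] (ι → ℝ) := LinearMap.pi fun i => (innerSL ℝ (w i)).toLinearMap
  have hk : LinearMap.ker f ≠ ⊥ := LinearMap.ker_ne_bot_of_finrank_lt (by simpa using hι)
  obtain ⟨u, hu, hu0⟩ := (Submodule.ne_bot_iff _).1 hk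
  exact ⟨u, hu0, fun i => congrFun (LinearMap.mem_ker.1 hu) i⟩

theorem exists_inner_eq {ι : Type*} [Fintype ι] (w : ι → E)
    (hι : Fintype.card ι = Module.finrank ℝ E) (hw : ∀ u, (∀ i, ⟪w i, u⟫ = 0) → u = 0)
    (c : ι → ℝ) : ∃ u : E, ∀ i, ⟪w i, u⟫ = c i := by
  let f : E →ₗ[ℝ] (ι → ℝ) := LinearMap.pi fun i => (innerSL ℝ (w i)).toLinearMap
  have hf : Function.Injective f := by
    rw [injective_iff_map_eq_zero]
    exact fun u hu => hw u fun i => congrFun hu i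
  have hs : Function.Surjective f :=
    (LinearMap.injective_iff_surjective_of_finrank_eq_finrank (by simpa using hι.symm)).1 hf
  obtain ⟨u, hu⟩ := hs c
  exact ⟨u, fun i => congrFun hu i⟩

/-- At most two zeros and the height give at most three linear conditions in dimension four, so
there is a direction u preserving them. Moving along u and along -u each hits a smaller cone, and x
lies between the two points reached. -/
theorem exists_split (F : IsSignFan g L v h) (hE : Module.finrank ℝ E = 4) {x : E} (hx0 : x ≠ 0)
    (hd : dim (signVec g x) ≤ 2) :
    ∃ ε x₁ x₂, IsVertex ε ∧ x₁ ≠ 0 ∧ x₂ ≠ 0 ∧ IsFace ε (signVec g x₁) ∧ IsFace ε (signVec g x₂) ∧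
      IsFace (signVec g x) (signVec g x₁) ∧ IsFace (signVec g x) (signVec g x₂) ∧
      dim (signVec g x) < dim (signVec g x₁) ∧ dim (signVec g x) < dim (signVec g x₂) ∧
      ∃ a b : ℝ, 0 < a ∧ 0 < b ∧ x = a • x₁ + b • x₂ := by
  obtain ⟨ε, hε, hf⟩ := exists_isVertex_isFace (signVec g x)
  obtain ⟨u, hu0, hu⟩ := exists_orthogonal (constraints g L ε x)
    (by rw [card_constraints]; omega)
  have hφ : ⟪height L ε, u⟫ = 0 := hu none
  have hz : ∀ j, g j x = 0 → ⟪L ε j, u⟫ = 0 := fun j hj =>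
    hu (some ⟨j, mem_zeroSet.2 (signVec_eq_zero.2 hj)⟩)
  obtain ⟨s, hs, s1, s2, s3, s4⟩ := F.exists_hit hε hf hx0 hu0 hφ hz
  obtain ⟨t, ht, t1, t2, t3, t4⟩ := F.exists_hit hε hf hx0 (neg_ne_zero.2 hu0)
    (by rw [inner_neg_right, hφ, neg_zero]) (fun j hj => by rw [inner_neg_right, hz j hj, neg_zero])
  refine ⟨ε, _, _, hε, s1, t1, s2, t2, s3, t3, s4, t4, t / (s + t), s / (s + t), by positivity,
    by positivity, ?_⟩
  have hst : s + t ≠ 0 := by positivity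
  rw [smul_add, smul_add, smul_smul, smul_neg, smul_neg, smul_smul, add_add_add_comm, ← add_smul,
    ← add_div, add_comm t s, div_self hst, one_smul]
  rw [div_mul_eq_mul_div, div_mul_eq_mul_div, mul_comm t s, add_neg_cancel, add_zero]

theorem exists_climb (F : IsSignFan g L v h) (hE : Module.finrank ℝ E = 4) {x : E} (hx0 : x ≠ 0) :
    ∃ x', x' ≠ 0 ∧ IsFace (signVec g x) (signVec g x') ∧ 3 ≤ dim (signVec g x') := by
  induction hk : 3 - dim (signVec g x) using Nat.strong_induction_on generalizing x with
  | _ k ih =>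
    by_cases hd : dim (signVec g x) ≤ 2
    · obtain ⟨ε, x₁, x₂, -, h1, -, -, -, hf, -, hlt, -⟩ := F.exists_split hE hx0 hd
      obtain ⟨x', h1', h2', h3'⟩ := ih _ (by omega) h1 rfl
      exact ⟨x', h1', hf.trans h2', h3'⟩
    · exact ⟨x, hx0, .refl _, by omega⟩

/-- Near a ray all faces of its sign vector occur. -/
theorem frequently_signVec_eq (F : IsSignFan g L v h) (hE : Module.finrank ℝ E = 4)
    (hO : ∀ x, x ≠ 0 → dim (signVec g x) ≤ 3) {x : E} (hx0 : x ≠ 0)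
    (hd : dim (signVec g x) = 3) {α : SignVec q} (hα : IsFace α (signVec g x)) :
    ∃ᶠ y in nhds x, signVec g y = α := by
  obtain ⟨ε, hε, hεα⟩ := exists_isVertex_isFace α
  have hf := hεα.trans hα
  -- The four constraints at a ray are independent, so a direction can be prescribed along which the
  -- vanishing functions acquire exactly the signs of α. For small positive steps the other
  -- functions keep their sign.
  obtain ⟨u, hu⟩ := exists_inner_eq (constraints g L ε x) (by rw [card_constraints, hd, hE])
    (fun u hu => F.eq_zero_of_constraints hO hε hx0 hf hd hu)
    (fun i => match i with
      | none => 0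
      | some j => (α j : ℝ))
  have hz : ∀ j, g j x = 0 → ⟪L ε j, u⟫ = (α j : ℝ) := fun j hj =>
    hu (some ⟨j, mem_zeroSet.2 (signVec_eq_zero.2 hj)⟩)
  have htend : Filter.Tendsto (fun t : ℝ => x + t • u) (nhdsWithin 0 (Set.Ioi 0)) (nhds x) := by
    have : Continuous fun t : ℝ => x + t • u := by fun_prop
    have h1 := this.tendsto 0
    simp only [zero_smul, add_zero] at h1
    exact h1.mono_left nhdsWithin_le_nhds
  refine htend.frequently (Filter.Eventually.frequently ?_)
  have hx' := (isFace_signVec_iff hε).1 hf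
  have h1 : ∀ j, ∀ᶠ t in nhdsWithin (0 : ℝ) (Set.Ioi 0),
      0 ≤ (ε j : ℝ) * ⟪L ε j, x + t • u⟫ ∧
        SignType.sign ⟪L ε j, x + t • u⟫ = α j := by
    intro j
    by_cases hj : g j x = 0
    · filter_upwards [self_mem_nhdsWithin] with t ht
      have ht' : (0 : ℝ) < t := ht
      have h2 : ⟪L ε j, x + t • u⟫ = t * (α j : ℝ) := by
        rw [inner_add_right, inner_smul_right, hz j hj, ← F.inner_eq hε hf, hj, zero_add]
      rw [h2, sign_mul, sign_pos ht', one_mul]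
      refine ⟨?_, ?_⟩
      · rcases hεα j with h3 | h3
        · rw [h3]; simp
        · rw [h3]; nlinarith [mul_self_nonneg (α j : ℝ)]
      · cases α j <;> simp
    · have h3 : 0 < (ε j : ℝ) * ⟪L ε j, x⟫ := by
        rw [← F.inner_eq hε hf, ← SignType.abs_eq_mul (hε j) (hx' j)]
        exact abs_pos.2 hj
      have hcont : Continuous fun y => (ε j : ℝ) * ⟪L ε j, y⟫ := by fun_prop
      have h4 : α j = ε j := by
        rcases hα j with h5 | h5
        · exact absurd (signVec_eq_zero.1 h5) hj
        · rcases hεα j with h6 | h6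
          · rw [h6] at h5
            exact absurd (signVec_eq_zero.1 h5.symm) hj
          · exact h6.symm
      filter_upwards [htend.eventually (hcont.tendsto x |>.eventually (lt_mem_nhds h3))] with t ht
      refine ⟨ht.le, ?_⟩
      rw [h4]
      rcases (SignType.eq_sign_iff (hε j)).2 ht.le with h5 | h5
      · rw [sign_eq_zero_iff] at h5
        rw [h5, mul_zero] at ht
        exact absurd ht (lt_irrefl _)
      · exact h5.symm
  filter_upwards [Filter.eventually_all.2 h1] with t ht
  have hg := F.eq_of_L ε _ hε fun j => (ht j).1
  funext j
  rw [signVec, hg, (ht j).2]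

end IsSignFan

end SignFan


/-! ### Extending a sign fan and existence of the neighborly fan -/

section FanExtension

/-- Adding a linear combination of the absolute values of the given functions. -/
noncomputable def extendFan {E : Type*} {q : ℕ} (g : Fin q → E → ℝ) (c : Fin q → ℝ) : Fin (q + 1) → E → ℝ :=
  Fin.snoc (α := fun _ => E → ℝ) g (fun x => ∑ j, c j * |g j x|)

theorem extendFan_castSucc {E : Type*} {q : ℕ} (g : Fin q → E → ℝ) (c : Fin q → ℝ) (j : Fin q) :
    extendFan g c j.castSucc = g j := Fin.snoc_castSucc (α := fun _ => E → ℝ) _ _ _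

theorem extendFan_last {E : Type*} {q : ℕ} (g : Fin q → E → ℝ) (c : Fin q → ℝ) (x : E) :
    extendFan g c (Fin.last q) x = ∑ j, c j * |g j x| := by
  rw [extendFan, Fin.snoc_last]

theorem init_signVec_extendFan {E : Type*} {q : ℕ} (g : Fin q → E → ℝ) (c : Fin q → ℝ) (x : E) :
    (Fin.init (signVec (extendFan g c) x) : SignVec q) = signVec g x := by
  funext j
  simp only [Fin.init, signVec, extendFan_castSucc]

theorem signVec_extendFan_last {E : Type*} {q : ℕ} (g : Fin q → E → ℝ) (c : Fin q → ℝ) (x : E) :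
    signVec (extendFan g c) x (Fin.last q) = SignType.sign (∑ j, c j * |g j x|) := by
  rw [signVec, extendFan_last]

variable {E : Type*} [NormedAddCommGroup E] [InnerProductSpace ℝ E]

local notation "⟪" x ", " y "⟫" => inner ℝ x y

variable {q : ℕ} {g : Fin q → E → ℝ} {L : SignVec q → Fin q → E} {v : SignVec q → E} {h : E → ℝ}

theorem SignVec.IsVertex.init {ε : SignVec (q + 1)} (hε : IsVertex ε) :
    IsVertex (Fin.init ε : SignVec q) := fun j => hε j.castSucc

/-- On the cone of ε the new function is the linear functional K(ε), so only the support function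
needs care. The quantitative gap in `le_support` is what makes the induction possible. -/
theorem IsSignFan.extend (F : IsSignFan g L v h) (c : Fin q → ℝ) :
    ∃ L' v' h', IsSignFan (extendFan g c) L' v' h' := by
  let K : SignVec q → E := fun ε => ∑ j, (c j * (ε j : ℝ)) • L ε j
  have hK : ∀ ε x, ⟪K ε, x⟫ = ∑ j, c j * ((ε j : ℝ) * ⟪L ε j, x⟫) := fun ε x => by
    simp [K, sum_inner, inner_smul_left, mul_assoc]
  let C : ℝ := ∑ j, |c j|
  let L' : SignVec (q + 1) → Fin (q + 1) → E := fun ε =>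
    Fin.snoc (α := fun _ => E) (L (Fin.init ε)) (K (Fin.init ε))
  have hL'c : ∀ ε (j : Fin q), L' ε j.castSucc = L (Fin.init ε) j := fun ε j =>
    Fin.snoc_castSucc (α := fun _ => E) _ _ _
  have hL'l : ∀ ε, L' ε (Fin.last q) = K (Fin.init ε) := fun ε =>
    Fin.snoc_last (α := fun _ => E) _ _
  have hgK : ∀ (ε : SignVec q) (x : E), IsVertex ε → (∀ j, 0 ≤ (ε j : ℝ) * g j x) →
      ∑ j, c j * |g j x| = ⟪K ε, x⟫ := fun ε x hε hx => by
    rw [hK]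
    refine Finset.sum_congr rfl fun j _ => ?_
    rw [SignType.abs_eq_mul (hε j) (hx j), ← F.eq_of_g ε x hε hx j]
  -- With D the old gap sum, the new function differs from K by at most C · D. The term for the new
  -- coordinate may thus exceed its signed version by 2 · C · D, which 2C of the copies of h absorb;
  -- the remaining copy pays for D itself.
  refine ⟨L', fun ε => (2 * C + 1) • v (Fin.init ε) + (ε (Fin.last q) : ℝ) • K (Fin.init ε),
    fun x => (2 * C + 1) * h x + |(∑ j, c j * |g j x|)|, ?_, ?_, ?_, ?_, ?_, ?_⟩
  · intro j
    induction j using Fin.lastCases with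
    | last =>
      have : extendFan g c (Fin.last q) = fun x => ∑ j, c j * |g j x| :=
        funext (extendFan_last g c)
      rw [this]
      exact continuous_finsetSum _ fun j _ => continuous_const.mul (F.continuous j).abs
    | cast j => rw [extendFan_castSucc]; exact F.continuous j
  · intro ε x hε hx
    have hx' : ∀ j : Fin q, 0 ≤ ((Fin.init ε : SignVec q) j : ℝ) * g j x := fun j => by
      have := hx j.castSucc
      rwa [extendFan_castSucc] at this
    intro j
    induction j using Fin.lastCases with
    | last => rw [extendFan_last, hL'l]; exact hgK _ x hε.init hx'
    | cast j => rw [extendFan_castSucc, hL'c]; exact F.eq_of_g _ x hε.init hx' j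
  · intro ε x hε hx
    have hx' : ∀ j : Fin q, 0 ≤ ((Fin.init ε : SignVec q) j : ℝ) * ⟪L (Fin.init ε) j, x⟫ :=
      fun j => by
        have := hx j.castSucc
        rwa [hL'c] at this
    have hg := F.eq_of_L _ x hε.init hx'
    intro j
    induction j using Fin.lastCases with
    | last =>
      rw [extendFan_last, hL'l]
      exact hgK _ x hε.init fun j => by rw [hg j]; exact hx' j
    | cast j => rw [extendFan_castSucc, hL'c]; exact hg j
  · intro x hx
    refine F.inj x fun j => ?_
    have := hx j.castSucc
    rwa [extendFan_castSucc] at this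
  · intro ε x hε
    have hD := F.le_support (Fin.init ε) x hε.init
    rw [Fin.sum_univ_castSucc]
    simp only [extendFan_castSucc, extendFan_last, hL'c, hL'l]
    set D := ∑ j : Fin q, |(|g j x| - (ε j.castSucc : ℝ) * ⟪L (Fin.init ε) j, x⟫)| with hDdef
    set G := ∑ j, c j * |g j x| with hG
    have hC0 : 0 ≤ C := Finset.sum_nonneg fun _ _ => abs_nonneg _
    have h1 : |G - ⟪K (Fin.init ε), x⟫| ≤ C * D := by
      rw [hG, hK, ← Finset.sum_sub_distrib]
      refine (Finset.abs_sum_le_sum_abs _ _).trans ?_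
      rw [hDdef, Finset.mul_sum]
      refine Finset.sum_le_sum fun j _ => ?_
      rw [← mul_sub, abs_mul]
      exact mul_le_mul_of_nonneg_right (Finset.single_le_sum (f := fun j => |c j|)
        (fun i _ => abs_nonneg _) (Finset.mem_univ j)) (abs_nonneg _)
    have h2 : D ≤ h x - ⟪v (Fin.init ε), x⟫ := hD
    rw [inner_add_left, real_inner_smul_left, real_inner_smul_left]
    have h3 : (2 * C + 1) * D ≤ (2 * C + 1) * (h x - ⟪v (Fin.init ε), x⟫) :=
      mul_le_mul_of_nonneg_left h2 (by positivity)
    have h4 : |(|G| - (ε (Fin.last q) : ℝ) * ⟪K (Fin.init ε), x⟫)| ≤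
        |G| - (ε (Fin.last q) : ℝ) * ⟪K (Fin.init ε), x⟫ + 2 * (C * D) := by
      have h5 := abs_le.1 h1
      have h6 := le_abs_self G
      have h7 := neg_abs_le G
      rcases SignType.cast_eq_one_or_neg_one (hε (Fin.last q)) with hs | hs <;> rw [hs] <;>
        exact abs_le'.2 ⟨by nlinarith [abs_nonneg (G - ⟪K (Fin.init ε), x⟫)], by nlinarith⟩
    linarith
  · intro ε x hε hx
    have hx' : ∀ j : Fin q, 0 ≤ ((Fin.init ε : SignVec q) j : ℝ) * g j x := fun j => by
      have := hx j.castSucc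
      rwa [extendFan_castSucc] at this
    have hl := hx (Fin.last q)
    rw [extendFan_last] at hl
    rw [inner_add_left, real_inner_smul_left, real_inner_smul_left,
      F.support_eq _ x hε.init hx', ← hgK _ x hε.init hx', SignType.abs_eq_mul (hε _) hl]

/-- The coordinate fan. -/
theorem isSignFan_basis {n : ℕ} (b : OrthonormalBasis (Fin n) ℝ E) :
    IsSignFan (fun j x => ⟪b j, x⟫) (fun _ j => b j) (fun ε => ∑ j, (ε j : ℝ) • b j)
      (fun x => ∑ j, |⟪b j, x⟫|) := by
  have hv : ∀ (ε : SignVec n) (x : E),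
      ⟪∑ j, (ε j : ℝ) • b j, x⟫ = ∑ j, (ε j : ℝ) * ⟪b j, x⟫ := fun ε x => by
    simp [sum_inner, inner_smul_left]
  refine ⟨fun j => by fun_prop, fun _ _ _ _ _ => rfl, fun _ _ _ _ _ => rfl, fun x hx => ?_,
    fun ε x hε => ?_, fun ε x hε hx => ?_⟩
  · rw [← b.sum_repr' x]
    exact Finset.sum_eq_zero fun i _ => by rw [hx i, zero_smul]
  · rw [hv, ← Finset.sum_sub_distrib]
    refine le_of_eq (Finset.sum_congr rfl fun j _ => abs_of_nonneg (sub_nonneg.2 ?_))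
    rcases SignType.cast_eq_one_or_neg_one (hε j) with hs | hs <;> rw [hs]
    · rw [one_mul]; exact le_abs_self _
    · rw [neg_one_mul]; exact neg_le_abs _
  · rw [hv]
    exact Finset.sum_congr rfl fun j _ => (SignType.abs_eq_mul (hε j) (hx j)).symm

/-- The new function can be chosen positive on the rays in the triangulated mirror complex and
negative on all others. -/
theorem IsSignFan.exists_separating (F : IsSignFan g L v h) (hq : 4 ≤ q)
    (hO : ∀ x, x ≠ 0 → 3 ≤ dim (signVec g x) → signVec g x ∈ sphereFacets q) :
    ∃ c : Fin q → ℝ, ∀ x, x ≠ 0 → 3 ≤ dim (signVec g x) →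
      (signVec g x ∈ mirrorComplex (polygonTriangulation q) → 0 < ∑ j, c j * |g j x|) ∧
      (signVec g x ∉ mirrorComplex (polygonTriangulation q) → ∑ j, c j * |g j x| < 0) := by
  have hO' : ∀ x, x ≠ 0 → dim (signVec g x) ≤ 3 := fun x hx => by
    by_contra hd
    have := dim_of_mem_sphereFacets hq (hO x hx (by omega))
    omega
  let i0 : Fin q := ⟨0, by omega⟩
  let i1 : Fin q := ⟨1, by omega⟩
  let i2 : Fin q := ⟨q - 2, by omega⟩
  let i3 : Fin q := ⟨q - 1, by omega⟩
  -- The new function is A'|g_0| - |g_1| + |g_{q-2}| - K|g_{q-1}|. K makes it negative where g_{q-1}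
  -- ≠ 0. Where g_{q-1} = 0, the rays outside have zeros 0, q-2, q-1 and only -|g_1| survives; on
  -- the rays inside, A' makes the first term dominate -|g_1| if g_0 ≠ 0, and otherwise g_0 = g_1 =
  -- 0 and |g_{q-2}| > 0 remains.
  obtain ⟨A, hA⟩ := F.exists_ratio_bound hO' i0 i1
  obtain ⟨B, hB⟩ := F.exists_ratio_bound hO' i3 i0
  obtain ⟨B', hB'⟩ := F.exists_ratio_bound hO' i3 i2
  let A' := |A| + 1
  let K := A' * |B| + |B'| + 1
  refine ⟨fun j => A' * (if j = i0 then 1 else 0) - (if j = i1 then 1 else 0)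
    + (if j = i2 then 1 else 0) - K * (if j = i3 then 1 else 0), fun x hx0 hd => ?_⟩
  have hsum : ∑ j, (A' * (if j = i0 then 1 else 0) - (if j = i1 then 1 else 0)
      + (if j = i2 then 1 else 0) - K * (if j = i3 then 1 else 0)) * |g j x| =
      A' * |g i0 x| - |g i1 x| + |g i2 x| - K * |g i3 x| := by
    simp [sub_mul, add_mul, Finset.sum_sub_distrib, Finset.sum_add_distrib]
  rw [hsum]
  have hmem := hO x hx0 hd
  have hd3 := dim_of_mem_sphereFacets hq hmem
  by_cases h3 : g i3 x = 0
  · obtain ⟨a, b, hab, hbc, hz, hcase⟩ := zeros_of_mem_sphereFacets hq hmem (l := i3)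
      (by simp only [i3]; omega) (signVec_eq_zero.2 h3)
    have hab' : (a : ℕ) < b := hab
    have hbc' : (b : ℕ) < q - 1 := hbc
    rw [mem_mirror_polygonTriangulation_of_three (by omega) hab hbc hz, h3, abs_zero, mul_zero,
      sub_zero]
    have hz' : ∀ i : Fin q, g i x = 0 ↔ i = a ∨ i = b ∨ i = i3 := fun i => by
      rw [← hz, signVec_eq_zero]
    constructor
    · rintro ⟨hba, -⟩
      by_cases ha : (a : ℕ) = 0
      · have e0 : g i0 x = 0 := (hz' i0).2 (Or.inl (Fin.ext ha.symm))
        have e1 : g i1 x = 0 := (hz' i1).2 (Or.inr (Or.inl (Fin.ext (by simp only [i1]; omega))))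
        have e2 : g i2 x ≠ 0 := fun hc => by
          rw [hz'] at hc
          simp only [i2, i3, Fin.ext_iff] at hc
          omega
        rw [e0, e1]
        simpa using e2
      · have e0 : g i0 x ≠ 0 := fun hc => by
          rw [hz'] at hc
          simp only [i0, i3, Fin.ext_iff] at hc
          omega
        have h4 := hA x hx0 hd3 e0
        have h5 := abs_pos.2 e0
        have h6 := abs_nonneg (g i2 x)
        have h7 := mul_le_mul_of_nonneg_right (le_abs_self A) h5.le
        simp only [A']
        nlinarith
    · intro hcon
      have ha : (a : ℕ) = 0 ∧ (b : ℕ) + 2 = q := by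
        rcases hcase with hcase | hcase
        · exact absurd ⟨hcase, by simp only [i3]; omega⟩ hcon
        · exact hcase
      have e0 : g i0 x = 0 := (hz' i0).2 (Or.inl (Fin.ext ha.1.symm))
      have e2 : g i2 x = 0 := (hz' i2).2 (Or.inr (Or.inl (Fin.ext (by simp only [i2]; omega))))
      have e1 : g i1 x ≠ 0 := fun hc => by
        rw [hz'] at hc
        simp only [i1, i3, Fin.ext_iff] at hc
        omega
      rw [e0, e2]
      simpa using e1
  · refine ⟨fun hT => absurd hT (not_mem_triangulation_of_last_ne_zero hq hd3 (l := i3)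
      (by simp only [i3]; omega) fun h0 => h3 (signVec_eq_zero.1 h0)), fun _ => ?_⟩
    have h5 := abs_pos.2 h3
    have h6 := hB x hx0 hd3 h3
    have h7 := hB' x hx0 hd3 h3
    have h8 := mul_le_mul_of_nonneg_right (le_abs_self B) h5.le
    have h9 := mul_le_mul_of_nonneg_right (le_abs_self B') h5.le
    have h10 := abs_nonneg (g i1 x)
    have h11 : 0 ≤ A' := by positivity
    have h12 := mul_le_mul_of_nonneg_left (h6.trans h8) h11
    simp only [K]
    nlinarith

/-- Geometric form of fissuring: the zero set of the new function separates the rays inside the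
triangulated part from those outside, so the new rays appear on the two-dimensional sign vectors
adjacent to both kinds. -/
theorem IsSignFan.exists_extension [FiniteDimensional ℝ E] (F : IsSignFan g L v h) (hE : Module.finrank ℝ E = 4)
    (hq : 4 ≤ q) (hO : ∀ x, x ≠ 0 → 3 ≤ dim (signVec g x) → signVec g x ∈ sphereFacets q)
    (hR : ∀ β ∈ sphereFacets q, ∃ x, x ≠ 0 ∧ signVec g x = β) :
    ∃ (g' : Fin (q + 1) → E → ℝ) (L' : _) (v' : _) (h' : _), IsSignFan g' L' v' h' ∧
      (∀ x, x ≠ 0 → 3 ≤ dim (signVec g' x) → signVec g' x ∈ sphereFacets (q + 1)) ∧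
      (∀ β ∈ sphereFacets (q + 1), ∃ x, x ≠ 0 ∧ signVec g' x = β) := by
  obtain ⟨c, hc⟩ := F.exists_separating hq hO
  obtain ⟨L', v', h', F'⟩ := F.extend c
  have hO' : ∀ x, x ≠ 0 → dim (signVec g x) ≤ 3 := fun x hx => by
    by_contra hd
    have := dim_of_mem_sphereFacets hq (hO x hx (by omega))
    omega
  have hadd : ∀ {ε : SignVec q} {x y : E} {a b : ℝ}, IsVertex ε → IsFace ε (signVec g x) →
      IsFace ε (signVec g y) → 0 ≤ a → 0 ≤ b →
      ∑ j, c j * |g j (a • x + b • y)| = a * ∑ j, c j * |g j x| + b * ∑ j, c j * |g j y| := by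
    intro ε x y a b hε hx hy ha hb
    obtain ⟨h1, h2⟩ := F.cone_comb hε hx hy ha hb
    rw [Finset.mul_sum, Finset.mul_sum, ← Finset.sum_add_distrib]
    refine Finset.sum_congr rfl fun j _ => ?_
    rw [SignType.abs_eq_mul (hε j) ((isFace_signVec_iff hε).1 h1 j),
      SignType.abs_eq_mul (hε j) ((isFace_signVec_iff hε).1 hx j),
      SignType.abs_eq_mul (hε j) ((isFace_signVec_iff hε).1 hy j), h2]
    ring
  refine ⟨extendFan g c, L', v', h', F', fun x hx0 hd => ?_, fun β hβ => ?_⟩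
  · rw [mem_sphereFacets_succ hq, init_signVec_extendFan, signVec_extendFan_last]
    rw [dim_eq_init, init_signVec_extendFan, signVec_extendFan_last] at hd
    by_cases h3 : 3 ≤ dim (signVec g x)
    · obtain ⟨h4, h5⟩ := hc x hx0 h3
      by_cases hT : signVec g x ∈ mirrorComplex (polygonTriangulation q)
      · exact Or.inl ⟨hO x hx0 h3, hT, sign_pos (h4 hT)⟩
      · exact Or.inr (Or.inl ⟨hO x hx0 h3, hT, sign_neg (h5 hT)⟩)
    · have hs0 : SignType.sign (∑ j, c j * |g j x|) = 0 := by
        by_contra hs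
        rw [if_neg hs] at hd
        omega
      rw [if_pos hs0] at hd
      have hd2 : dim (signVec g x) = 2 := by omega
      refine Or.inr (Or.inr ⟨?_, hd2, hs0⟩)
      -- The new function is linear between the rays y and z and vanishes at x, so it has opposite
      -- signs at them. One is therefore inside M(T_q) and the other outside, and their common face
      -- lies in M(Q_q).
      obtain ⟨ε, y, z, hε, hy0, hz0, hfy, hfz, hxy, hxz, hdy, hdz, a, b, ha, hb, hxyz⟩ :=
        F.exists_split hE hx0 hd2.le
      have hy := hc y hy0 (by omega)
      have hz := hc z hz0 (by omega)
      have hsum := hadd hε hfy hfz ha.le hb.le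
      rw [← hxyz, sign_eq_zero_iff.1 hs0] at hsum
      by_cases hTy : signVec g y ∈ mirrorComplex (polygonTriangulation q)
      · by_cases hTz : signVec g z ∈ mirrorComplex (polygonTriangulation q)
        · have h1 := mul_pos ha (hy.1 hTy)
          have h2 := mul_pos hb (hz.1 hTz)
          linarith
        · exact mem_mirror_polygonBoundary_of_isFace hq hTy (hO z hz0 (by omega)) hTz hxy hxz
      · by_cases hTz : signVec g z ∈ mirrorComplex (polygonTriangulation q)
        · exact mem_mirror_polygonBoundary_of_isFace hq hTz (hO y hy0 (by omega)) hTy hxz hxy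
        · have h1 := mul_neg_of_pos_of_neg ha (hy.2 hTy)
          have h2 := mul_neg_of_pos_of_neg hb (hz.2 hTz)
          linarith
  · have key : ∀ x, (Fin.init β : SignVec q) = signVec g x →
        β (Fin.last q) = SignType.sign (∑ j, c j * |g j x|) →
        signVec (extendFan g c) x = β := by
      intro x h1 h2
      rw [← Fin.snoc_init_self (α := fun _ => SignType) β,
        ← Fin.snoc_init_self (α := fun _ => SignType) (signVec (extendFan g c) x),
        signVec_extendFan_last, ← h2]
      congr 1
      rw [init_signVec_extendFan, h1]
    rw [mem_sphereFacets_succ hq] at hβ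
    rcases hβ with ⟨h1, h2, h3⟩ | ⟨h1, h2, h3⟩ | ⟨h1, h2, h3⟩
    · obtain ⟨x, hx0, hx⟩ := hR _ h1
      refine ⟨x, hx0, key x hx.symm ?_⟩
      rw [h3, sign_pos ((hc x hx0 (by rw [hx, dim_of_mem_sphereFacets hq h1])).1 (by rwa [hx]))]
    · obtain ⟨x, hx0, hx⟩ := hR _ h1
      refine ⟨x, hx0, key x hx.symm ?_⟩
      rw [h3, sign_neg ((hc x hx0 (by rw [hx, dim_of_mem_sphereFacets hq h1])).2 (by rwa [hx]))]
    -- Near a ray inside and a ray outside there are points y₁, y₂ with the prescribed sign vector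
    -- at which the new function is positive and negative. The combination weighted by the opposite
    -- values is a zero of it.
    · obtain ⟨β₁, hβ₁, hT₁, hf₁⟩ :=
        exists_facet_of_mem_triangulation hq (mirror_polygonBoundary_subset (by omega) h1)
      obtain ⟨β₂, hβ₂, hT₂, hf₂⟩ := exists_facet_not_mem_triangulation hq h1 h2
      obtain ⟨x₁, hx₁, rfl⟩ := hR _ hβ₁
      obtain ⟨x₂, hx₂, rfl⟩ := hR _ hβ₂
      have hd₁ := dim_of_mem_sphereFacets hq hβ₁
      have hd₂ := dim_of_mem_sphereFacets hq hβ₂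
      have hcont : Continuous fun x => ∑ j, c j * |g j x| :=
        continuous_finsetSum _ fun j _ => continuous_const.mul (F.continuous j).abs
      obtain ⟨y₁, hy₁, hs₁⟩ := ((F.frequently_signVec_eq hE hO' hx₁ hd₁ hf₁).and_eventually
        ((hcont.tendsto x₁).eventually (lt_mem_nhds ((hc x₁ hx₁ hd₁.ge).1 hT₁)))).exists
      obtain ⟨y₂, hy₂, hs₂⟩ := ((F.frequently_signVec_eq hE hO' hx₂ hd₂ hf₂).and_eventually
        ((hcont.tendsto x₂).eventually (gt_mem_nhds ((hc x₂ hx₂ hd₂.ge).2 hT₂)))).exists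
      set G₁ := ∑ j, c j * |g j y₁| with hG₁
      set G₂ := ∑ j, c j * |g j y₂| with hG₂
      obtain ⟨ε, hε, hεf⟩ := exists_isVertex_isFace (Fin.init β : SignVec q)
      have hε₁ : IsFace ε (signVec g y₁) := hy₁ ▸ hεf
      have hε₂ : IsFace ε (signVec g y₂) := hy₂ ▸ hεf
      have ha : 0 < -G₂ := by linarith
      have hb : 0 < G₁ := hs₁
      obtain ⟨hf, hcomb⟩ := F.cone_comb hε hε₁ hε₂ ha.le hb.le
      have hz := hadd hε hε₁ hε₂ ha.le hb.le
      rw [← hG₁, ← hG₂] at hz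
      -- The values of g_j at y₁ and y₂ have the same sign, so no cancellation occurs.
      have hsv : signVec g ((-G₂) • y₁ + G₁ • y₂) = Fin.init β := by
        have hiff : ∀ j, g j ((-G₂) • y₁ + G₁ • y₂) = 0 ↔ (Fin.init β : SignVec q) j = 0 := by
          intro j
          have e1 := (isFace_signVec_iff hε).1 hε₁ j
          have e2 := (isFace_signVec_iff hε).1 hε₂ j
          have e3 : signVec g y₁ j = 0 ↔ signVec g y₂ j = 0 := by rw [hy₁, hy₂]
          rw [← hy₁, signVec_eq_zero, hcomb]
          rw [signVec_eq_zero, signVec_eq_zero] at e3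
          constructor
          · intro h0
            have h4 : -G₂ * ((ε j : ℝ) * g j y₁) + G₁ * ((ε j : ℝ) * g j y₂) = 0 := by
              rw [← mul_zero (ε j : ℝ), ← h0]; ring
            have h5 := mul_nonneg ha.le e1
            have h6 := mul_nonneg hb.le e2
            have h7 : (ε j : ℝ) * g j y₁ = 0 :=
              (mul_eq_zero.1 (by linarith : -G₂ * ((ε j : ℝ) * g j y₁) = 0)).resolve_left ha.ne'
            refine (mul_eq_zero.1 h7).resolve_left fun h8 => ?_
            rcases SignType.cast_eq_one_or_neg_one (hε j) with h9 | h9 <;> rw [h9] at h8 <;>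
              norm_num at h8
          · intro h0
            rw [h0, e3.1 h0]; ring
        refine IsFace.eq_of_zeroSet (isFace_of_common_vertex hf hεf fun j hj => ?_) fun j hj => ?_
        · rwa [signVec_eq_zero, hiff] at hj
        · rw [mem_zeroSet] at hj ⊢
          rwa [signVec_eq_zero, hiff]
      refine ⟨_, fun h0 => ?_, key _ hsv.symm ?_⟩
      -- The combination is not the origin: its sign vector has two zeros among at least four
      -- entries.
      · rw [h0] at hsv
        obtain ⟨y, z, hyz, hx⟩ := dim_eq_two_iff.1 h2
        obtain ⟨k, hk⟩ : ∃ k : Fin q, k ≠ y ∧ k ≠ z := by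
          have : ∃ k ∉ ({y, z} : Finset (Fin q)), True := by
            by_contra hcon
            push Not at hcon
            have h4 : (Finset.univ : Finset (Fin q)) ⊆ {y, z} := fun k _ => by
              by_contra hk; exact hcon k hk
            have h5 := (Finset.card_le_card h4).trans Finset.card_le_two
            rw [Finset.card_univ, Fintype.card_fin] at h5
            omega
          obtain ⟨k, hk, -⟩ := this
          exact ⟨k, by simpa using hk⟩
        have h4 : (Fin.init β : SignVec q) k ≠ 0 := fun h5 => by
          rcases (hx k).1 h5 with h6 | h6
          · exact hk.1 h6
          · exact hk.2 h6
        rw [← hsv, Ne, signVec_eq_zero] at h4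
        have h5 := F.cone_comb hε hε₁ hε₂ (le_refl 0) (le_refl 0)
        have h6 := h5.2 k
        rw [zero_smul, zero_smul, add_zero] at h6
        exact h4 (by rw [h6]; ring)
      · rw [h3, hz, eq_comm, sign_eq_zero_iff]
        ring

/-- The fan of the neighborly cubical polytope. -/
theorem exists_sphere_fan [FiniteDimensional ℝ E] (hE : Module.finrank ℝ E = 4) (hq : 4 ≤ q) :
    ∃ (g : Fin q → E → ℝ) (L : _) (v : _) (h : _), IsSignFan g L v h ∧
      (∀ x, x ≠ 0 → 3 ≤ dim (signVec g x) → signVec g x ∈ sphereFacets q) ∧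
      (∀ β ∈ sphereFacets q, ∃ x, x ≠ 0 ∧ signVec g x = β) := by
  induction q, hq using Nat.le_induction with
  | base =>
    let b : OrthonormalBasis (Fin 4) ℝ E := (stdOrthonormalBasis ℝ E).reindex (finCongr hE)
    have F := isSignFan_basis b
    refine ⟨_, _, _, _, F, fun x hx0 hd => ?_, fun β hβ => ?_⟩
    · rw [sphereFacets_four]
      refine le_antisymm ?_ hd
      by_contra hlt
      obtain ⟨j, hj⟩ := F.signVec_ne_zero hx0
      have h1 : zeroSet (signVec (fun j x => ⟪b j, x⟫) x) ⊆ Finset.univ.erase j := fun i hi => by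
        rw [Finset.mem_erase]
        refine ⟨?_, Finset.mem_univ _⟩
        rintro rfl
        exact hj (signVec_eq_zero.1 (mem_zeroSet.1 hi))
      have h2 := Finset.card_le_card h1
      rw [Finset.card_erase_of_mem (Finset.mem_univ _), Finset.card_univ, Fintype.card_fin] at h2
      exact hlt h2
    · rw [sphereFacets_four] at hβ
      have h1 : ∀ j, ⟪b j, ∑ i, (β i : ℝ) • b i⟫ = (β j : ℝ) := fun j => by
        rw [inner_sum]
        simp [inner_smul_right, orthonormal_iff_ite.1 b.orthonormal]
      have h2 : signVec (fun j x => ⟪b j, x⟫) (∑ i, (β i : ℝ) • b i) = β := by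
        funext j
        rw [signVec, h1]
        cases β j <;> simp
      refine ⟨_, fun h0 => ?_, h2⟩
      rw [h0] at h2
      have h3 : dim β = 4 := by
        rw [← h2]; simp [dim, zeroSet, signVec]
      have h4 : dim β = 3 := hβ
      omega
  | succ q hq ih =>
    obtain ⟨g, L, v, h, F, hO, hR⟩ := ih
    exact F.exists_extension hE hq hO hR

end FanExtension


/-! ### Faces of convex hulls of finite families -/

section FaceSets

variable {E : Type*} [NormedAddCommGroup E] [NormedSpace ℝ E] {ι : Type*}

/-- The set `W` of indices is cut out of the family `u` on `I` by a valid inequality. -/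
def IsFaceSet (u : ι → E) (I W : Set ι) : Prop :=
  ∃ (l : StrongDual ℝ E) (c : ℝ), (∀ i ∈ I, l (u i) ≤ c) ∧ W = {i | i ∈ I ∧ l (u i) = c}

variable {u : ι → E} {I W W' : Set ι}

theorem IsFaceSet.subset (h : IsFaceSet u I W) : W ⊆ I := by
  obtain ⟨l, c, -, rfl⟩ := h
  exact fun i hi => hi.1

theorem le_of_mem_hull {l : StrongDual ℝ E} {c : ℝ} (h : ∀ i ∈ I, l (u i) ≤ c) {x : E}
    (hx : x ∈ convexHull ℝ (u '' I)) : l x ≤ c := by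
  have h1 : Convex ℝ {y : E | l y ≤ c} := convex_halfSpace_le l.toLinearMap.isLinear c
  refine convexHull_min ?_ h1 hx
  rintro _ ⟨i, hi, rfl⟩
  exact h i hi

/-- A convex combination attains the maximal value only if every term with positive weight does. The
proof runs over the convex set of points that satisfy this implication. -/
theorem mem_hull_of_eq {l : StrongDual ℝ E} {c : ℝ} (h : ∀ i ∈ I, l (u i) ≤ c) {x : E}
    (hx : x ∈ convexHull ℝ (u '' I)) (hc : l x = c) :
    x ∈ convexHull ℝ (u '' {i | i ∈ I ∧ l (u i) = c}) := by
  set H := convexHull ℝ (u '' {i | i ∈ I ∧ l (u i) = c}) with hH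
  have h1 : Convex ℝ {y : E | l y ≤ c ∧ (l y = c → y ∈ H)} := by
    intro y hy z hz a b ha hb hab
    have hlin : l (a • y + b • z) = a * l y + b * l z := by simp
    have hy1 := mul_le_mul_of_nonneg_left hy.1 ha
    have hz1 := mul_le_mul_of_nonneg_left hz.1 hb
    have hsum : a * c + b * c = c := by rw [← add_mul, hab, one_mul]
    refine ⟨by rw [hlin]; linarith, fun heq => ?_⟩
    rw [hlin] at heq
    rcases ha.eq_or_lt with rfl | ha'
    · have hb1 : b = 1 := by linarith
      subst hb1
      rw [zero_smul, zero_add, one_smul]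
      exact hz.2 (by linarith)
    · rcases hb.eq_or_lt with rfl | hb'
      · have ha1 : a = 1 := by linarith
        subst ha1
        rw [zero_smul, add_zero, one_smul]
        exact hy.2 (by linarith)
      · have e1 : l y = c := mul_left_cancel₀ ha'.ne' (by linarith)
        have e2 : l z = c := mul_left_cancel₀ hb'.ne' (by linarith)
        exact convex_convexHull ℝ _ (hy.2 e1) (hz.2 e2) ha hb hab
  have h2 := convexHull_min (t := {y : E | l y ≤ c ∧ (l y = c → y ∈ H)}) ?_ h1 hx
  · exact h2.2 hc
  · rintro _ ⟨i, hi, rfl⟩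
    exact ⟨h i hi, fun hic => subset_convexHull ℝ _ ⟨i, ⟨hi, hic⟩, rfl⟩⟩

theorem hull_inter_eq {l : StrongDual ℝ E} {c : ℝ} (h : ∀ i ∈ I, l (u i) ≤ c) :
    {x | x ∈ convexHull ℝ (u '' I) ∧ l x = c} =
      convexHull ℝ (u '' {i | i ∈ I ∧ l (u i) = c}) := by
  refine Set.Subset.antisymm (fun x hx => mem_hull_of_eq h hx.1 hx.2) (convexHull_min ?_ ?_)
  · rintro _ ⟨i, hi, rfl⟩
    exact ⟨subset_convexHull ℝ _ ⟨i, hi.1, rfl⟩, hi.2⟩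
  · exact (convex_convexHull ℝ _).inter (convex_hyperplane l.toLinearMap.isLinear c)

theorem isExposed_hull_iff {G : Set E} :
    (IsExposed ℝ (convexHull ℝ (u '' I)) G ∧ G.Nonempty) ↔
      ∃ W, IsFaceSet u I W ∧ W.Nonempty ∧ G = convexHull ℝ (u '' W) := by
  constructor
  · rintro ⟨hG, hne⟩
    obtain ⟨l, rfl⟩ := hG hne
    obtain ⟨x, hx, hmax⟩ := hne
    have hval : ∀ i ∈ I, l (u i) ≤ l x := fun i hi =>
      hmax _ (subset_convexHull ℝ _ ⟨i, hi, rfl⟩)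
    have heq : {y | y ∈ convexHull ℝ (u '' I) ∧ ∀ z ∈ convexHull ℝ (u '' I), l z ≤ l y} =
        convexHull ℝ (u '' {i | i ∈ I ∧ l (u i) = l x}) := by
      rw [← hull_inter_eq hval]
      ext y
      constructor
      · exact fun hy => ⟨hy.1, le_antisymm (hmax _ hy.1) (hy.2 x hx)⟩
      · exact fun hy => ⟨hy.1, fun z hz => by rw [hy.2]; exact hmax z hz⟩
    refine ⟨_, ⟨l, l x, hval, rfl⟩, ?_, heq⟩
    have h1 : (convexHull ℝ (u '' {i | i ∈ I ∧ l (u i) = l x})).Nonempty :=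
      ⟨x, mem_hull_of_eq hval hx rfl⟩
    rw [convexHull_nonempty_iff] at h1
    exact h1.of_image
  · rintro ⟨W, ⟨l, c, hval, rfl⟩, ⟨i, hi, hic⟩, rfl⟩
    refine ⟨fun _ => ⟨l, ?_⟩, ⟨u i, subset_convexHull ℝ _ ⟨i, ⟨hi, hic⟩, rfl⟩⟩⟩
    rw [← hull_inter_eq hval]
    ext y
    constructor
    · exact fun hy => ⟨hy.1, fun z hz => by rw [hy.2]; exact le_of_mem_hull hval hz⟩
    · refine fun hy => ⟨hy.1, le_antisymm (le_of_mem_hull hval hy.1) ?_⟩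
      rw [← hic]
      exact hy.2 _ (subset_convexHull ℝ _ ⟨i, hi, rfl⟩)

theorem IsFaceSet.inter (h : IsFaceSet u I W) (h' : IsFaceSet u I W') :
    IsFaceSet u I (W ∩ W') := by
  obtain ⟨l, c, hl, rfl⟩ := h
  obtain ⟨l', c', hl', rfl⟩ := h'
  refine ⟨l + l', c + c', fun i hi => add_le_add (hl i hi) (hl' i hi), ?_⟩
  ext i
  simp only [Set.mem_inter_iff, Set.mem_ofPred_eq, add_apply]
  constructor
  · rintro ⟨⟨h1, h2⟩, -, h3⟩
    exact ⟨h1, by rw [h2, h3]⟩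
  · rintro ⟨h1, h2⟩
    have := hl i h1
    have := hl' i h1
    exact ⟨⟨h1, by linarith⟩, h1, by linarith⟩

/-- No member of the family lies in the convex hull of other members. -/
def IsConvexlyIndep (u : ι → E) (I : Set ι) : Prop :=
  ∀ i ∈ I, ∀ W ⊆ I, u i ∈ convexHull ℝ (u '' W) → i ∈ W

theorem IsConvexlyIndep.hull_subset_iff (h : IsConvexlyIndep u I) (hW : W ⊆ I) (hW' : W' ⊆ I) :
    convexHull ℝ (u '' W) ⊆ convexHull ℝ (u '' W') ↔ W ⊆ W' := by
  refine ⟨fun hs i hi => h i (hW hi) W' hW' (hs (subset_convexHull ℝ _ ⟨i, hi, rfl⟩)),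
    fun hs => convexHull_mono (Set.image_mono hs)⟩

theorem IsConvexlyIndep.hull_inj (h : IsConvexlyIndep u I) (hW : W ⊆ I) (hW' : W' ⊆ I)
    (heq : convexHull ℝ (u '' W) = convexHull ℝ (u '' W')) : W = W' :=
  ((h.hull_subset_iff hW hW').1 heq.subset).antisymm ((h.hull_subset_iff hW' hW).1 heq.superset)

theorem IsConvexlyIndep.isProperFace_iff (h : IsConvexlyIndep u I) {G : Set E} :
    IsProperFace (convexHull ℝ (u '' I)) G ↔
      ∃ W, IsFaceSet u I W ∧ W.Nonempty ∧ W ≠ I ∧ G = convexHull ℝ (u '' W) := by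
  rw [IsProperFace, ← and_assoc, isExposed_hull_iff]
  constructor
  · rintro ⟨⟨W, h1, h2, rfl⟩, h3⟩
    exact ⟨W, h1, h2, fun hW => h3 (by rw [hW]), rfl⟩
  · rintro ⟨W, h1, h2, h3, rfl⟩
    exact ⟨⟨W, h1, h2, rfl⟩, fun heq => h3 (h.hull_inj h1.subset subset_rfl heq)⟩

/-- Rotating a valid inequality about the face set `W`, away from the valid inequality of the
larger face set `W'`, until it becomes tight at a further index. -/
theorem exists_rotation [Finite ι] {l l' : StrongDual ℝ E} {c c' : ℝ}
    (hl : ∀ i ∈ I, l (u i) ≤ c) (hl' : ∀ i ∈ I, l' (u i) ≤ c')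
    (hsub : ∀ i ∈ I, l (u i) = c → l' (u i) = c') (hne : ∃ i ∈ I, l' (u i) ≠ c') :
    ∃ s : ℝ, 0 < s ∧ (∀ i ∈ I, s * (c' - l' (u i)) ≤ c - l (u i)) ∧
      ∃ i ∈ I, l' (u i) ≠ c' ∧ s * (c' - l' (u i)) = c - l (u i) := by
  obtain ⟨k, hk, hmin⟩ := Set.exists_min_image {i | i ∈ I ∧ l' (u i) ≠ c'}
    (fun i => (c - l (u i)) / (c' - l' (u i))) (Set.toFinite _) hne
  have hpos : ∀ i ∈ I, l' (u i) ≠ c' → 0 < c' - l' (u i) := fun i hi hi' =>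
    sub_pos.2 (lt_of_le_of_ne (hl' i hi) hi')
  have hk' := hpos k hk.1 hk.2
  have hk'' : 0 < c - l (u k) :=
    sub_pos.2 (lt_of_le_of_ne (hl k hk.1) fun h0 => hk.2 (hsub k hk.1 h0))
  refine ⟨_, div_pos hk'' hk', fun i hi => ?_, k, hk.1, hk.2, div_mul_cancel₀ _ hk'.ne'⟩
  by_cases hi' : l' (u i) = c'
  · rw [hi', sub_self, mul_zero]
    exact sub_nonneg.2 (hl i hi)
  · exact (le_div_iff₀ (hpos i hi hi')).1 (hmin i ⟨hi, hi'⟩)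

/-- The facets of a family, as sets of indices. -/
def IsFacetSet (u : ι → E) (I F : Set ι) : Prop :=
  Maximal (fun W => IsFaceSet u I W ∧ W ≠ I) F

/-- A face set can be separated from any further index by a facet. -/
theorem IsFaceSet.exists_facetSet [Finite ι] (hW : IsFaceSet u I W) {p : ι} (hp : p ∈ I)
    (hpW : p ∉ W) : ∃ F, IsFacetSet u I F ∧ W ⊆ F ∧ p ∉ F := by
  -- Take H maximal among the face sets containing W and missing p. If it were no facet, a larger
  -- proper face set H' would contain p; rotating the inequality of H away from that of H' makes it
  -- tight at a further index outside H', while p stays strictly beneath. This contradicts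
  -- maximality.
  obtain ⟨H, hWH, hH⟩ := (Set.toFinite {F | IsFaceSet u I F ∧ W ⊆ F ∧ p ∉ F}).exists_le_maximal
    (show W ∈ {F | IsFaceSet u I F ∧ W ⊆ F ∧ p ∉ F} from ⟨hW, subset_rfl, hpW⟩)
  obtain ⟨hHf, hWH', hpH⟩ := hH.prop
  refine ⟨H, ⟨⟨hHf, fun h0 => hpH (h0 ▸ hp)⟩, fun H' hH' hle => ?_⟩, hWH', hpH⟩
  by_contra hnot
  have hpH' : p ∈ H' := by
    by_contra hp'
    exact hnot (hH.le_of_ge ⟨hH'.1, hWH'.trans hle, hp'⟩ hle)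
  obtain ⟨⟨l', c', hl', rfl⟩, hne⟩ := hH'
  obtain ⟨l, c, hl, rfl⟩ := hHf
  have hne' : ∃ i ∈ I, l' (u i) ≠ c' := by
    by_contra hcon
    push Not at hcon
    exact hne (Set.Subset.antisymm (fun i hi => hi.1) fun i hi => ⟨hi, hcon i hi⟩)
  obtain ⟨s, hs, hval, k, hk, hk', hks⟩ := exists_rotation hl hl'
    (fun i hi h0 => (hle ⟨hi, h0⟩ : i ∈ {i | i ∈ I ∧ l' (u i) = c'}).2) hne'
  have hmem : {i | i ∈ I ∧ (l - s • l') (u i) = c - s * c'} ∈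
      {F | IsFaceSet u I F ∧ W ⊆ F ∧ p ∉ F} := by
    refine ⟨⟨l - s • l', c - s * c', fun i hi => ?_, rfl⟩, fun i hi => ?_, fun hp' => ?_⟩
    · have := hval i hi
      simp only [sub_apply, smul_apply, smul_eq_mul]
      linarith
    · have h1 := hWH' hi
      have h2 := hle h1
      refine ⟨h1.1, ?_⟩
      simp only [sub_apply, smul_apply, smul_eq_mul]
      rw [h1.2, h2.2]
    · have h1 := hp'.2
      simp only [sub_apply, smul_apply, smul_eq_mul] at h1
      rw [hpH'.2] at h1
      exact hpH ⟨hp, by linarith⟩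
  have hle2 : {i | i ∈ I ∧ l (u i) = c} ⊆ {i | i ∈ I ∧ (l - s • l') (u i) = c - s * c'} := by
    intro i hi
    have h2 := hle hi
    refine ⟨hi.1, ?_⟩
    simp only [sub_apply, smul_apply, smul_eq_mul]
    rw [hi.2, h2.2]
  have h3 := hH.le_of_ge hmem hle2
  have h4 : k ∈ {i | i ∈ I ∧ l (u i) = c} := h3 ⟨hk, by
    simp only [sub_apply, smul_apply, smul_eq_mul]
    linarith⟩
  exact hk' (hle h4).2

/-- The inequality of a facet is unique up to scaling. -/
theorem IsFacetSet.exists_scaling [Finite ι] {l l' : StrongDual ℝ E} {c c' : ℝ}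
    (hF : IsFacetSet u I {i | i ∈ I ∧ l (u i) = c}) (hl : ∀ i ∈ I, l (u i) ≤ c)
    (hl' : ∀ i ∈ I, l' (u i) ≤ c')
    (heq : {i | i ∈ I ∧ l (u i) = c} = {i | i ∈ I ∧ l' (u i) = c'}) :
    ∃ s : ℝ, 0 < s ∧ ∀ i ∈ I, c - l (u i) = s * (c' - l' (u i)) := by
  have hne' : ∃ i ∈ I, l' (u i) ≠ c' := by
    by_contra hcon
    push Not at hcon
    refine hF.prop.2 ?_
    rw [heq]
    exact Set.Subset.antisymm (fun i hi => hi.1) fun i hi => ⟨hi, hcon i hi⟩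
  -- If l - s • l' were not constantly tight on I, it would cut out a proper face set that contains
  -- the facet and also k.
  obtain ⟨s, hs, hval, k, hk, hk', hks⟩ := exists_rotation hl hl'
    (fun i hi h0 => (heq ▸ (⟨hi, h0⟩ : i ∈ {i | i ∈ I ∧ l (u i) = c}) :
      i ∈ {i | i ∈ I ∧ l' (u i) = c'}).2) hne'
  refine ⟨s, hs, ?_⟩
  by_contra hcon
  push Not at hcon
  obtain ⟨j, hj, hj'⟩ := hcon
  have hmem : IsFaceSet u I {i | i ∈ I ∧ (l - s • l') (u i) = c - s * c'} := by
    refine ⟨l - s • l', c - s * c', fun i hi => ?_, rfl⟩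
    have := hval i hi
    simp only [sub_apply, smul_apply, smul_eq_mul]
    linarith
  have hne2 : {i | i ∈ I ∧ (l - s • l') (u i) = c - s * c'} ≠ I := by
    intro h0
    have h1 : j ∈ {i | i ∈ I ∧ (l - s • l') (u i) = c - s * c'} := h0.symm ▸ hj
    have h2 := h1.2
    simp only [sub_apply, smul_apply, smul_eq_mul] at h2
    exact hj' (by linarith)
  have hle := hF.le_of_ge ⟨hmem, hne2⟩ (fun i hi => by
    have h2 : i ∈ {i | i ∈ I ∧ l' (u i) = c'} := heq ▸ hi
    refine ⟨hi.1, ?_⟩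
    simp only [sub_apply, smul_apply, smul_eq_mul]
    rw [hi.2, h2.2])
  have h4 : k ∈ {i | i ∈ I ∧ l (u i) = c} := hle ⟨hk, by
    simp only [sub_apply, smul_apply, smul_eq_mul]
    linarith⟩
  rw [heq] at h4
  exact hk' h4.2

theorem IsConvexlyIndep.isFacet_of_facetSet (h : IsConvexlyIndep u I) {F : Set ι}
    (hF : IsFacetSet u I F) (hne : F.Nonempty) :
    IsFacet (convexHull ℝ (u '' I)) (convexHull ℝ (u '' F)) := by
  refine ⟨h.isProperFace_iff.2 ⟨F, hF.prop.1, hne, hF.prop.2, rfl⟩, fun G hG hle => ?_⟩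
  obtain ⟨W, h1, h2, h3, rfl⟩ := h.isProperFace_iff.1 hG
  exact (h.hull_subset_iff h1.subset hF.prop.1.subset).2
    (hF.le_of_ge ⟨h1, h3⟩ ((h.hull_subset_iff hF.prop.1.subset h1.subset).1 hle))

theorem IsConvexlyIndep.facetSet_of_isFacet (h : IsConvexlyIndep u I) {F : Set ι} (hFI : F ⊆ I)
    (hF : IsFacet (convexHull ℝ (u '' I)) (convexHull ℝ (u '' F))) :
    IsFacetSet u I F ∧ F.Nonempty := by
  obtain ⟨W, h1, h2, h3, h4⟩ := h.isProperFace_iff.1 hF.prop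
  obtain rfl := h.hull_inj hFI h1.subset h4
  refine ⟨⟨⟨h1, h3⟩, fun W hW hle => ?_⟩, h2⟩
  exact (h.hull_subset_iff hW.1.subset hFI).1 (hF.le_of_ge
    (h.isProperFace_iff.2 ⟨W, hW.1, h2.mono hle, hW.2, rfl⟩)
    ((h.hull_subset_iff hFI hW.1.subset).2 hle))

end FaceSets

/-! ### Polytopes with the facets of the neighborly cubical sphere -/

section SpherePolytope

theorem SignVec.exists_meet {n : ℕ} {α β : SignVec n} (h : (verts α ∩ verts β).Nonempty) :
    ∃ γ, IsFace γ α ∧ IsFace γ β ∧ verts γ = verts α ∩ verts β := by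
  obtain ⟨ε, hα, hβ⟩ := h
  let γ : SignVec n := fun i => if α i = 0 then β i else α i
  have h1 : IsFace γ α := fun i => by
    by_cases h0 : α i = 0
    · exact Or.inl h0
    · right; simp only [γ, if_neg h0]
  have h2 : IsFace γ β := fun i => by
    by_cases h0 : α i = 0
    · right; simp only [γ, if_pos h0]
    · rcases hβ.2 i with h3 | h3
      · exact Or.inl h3
      · right
        simp only [γ, if_neg h0]
        rcases hα.2 i with h4 | h4
        · exact absurd h4 h0
        · rw [← h3, h4]
  refine ⟨γ, h1, h2, Set.Subset.antisymm
    (Set.subset_inter h1.verts_subset h2.verts_subset) fun δ hδ => ⟨hδ.1.1, fun i => ?_⟩⟩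
  by_cases h0 : α i = 0
  · simp only [γ, if_pos h0]; exact hδ.2.2 i
  · simp only [γ, if_neg h0]; exact hδ.1.2 i

/-- Every ridge of the sphere lies in a second facet. -/
theorem exists_adjacent_facet {q : ℕ} (hq : 4 ≤ q) {α β : SignVec q} (hβ : β ∈ sphereFacets q)
    (hαβ : IsFace α β) (hd : dim α = 2) : ∃ β' ∈ sphereFacets q, β' ≠ β ∧ IsFace α β' := by
  obtain ⟨g, L, v, h, F, hO, hR⟩ := exists_sphere_fan (E := EuclideanSpace ℝ (Fin 4))
    (q := q) (by simp) hq
  have hO' : ∀ x, x ≠ 0 → dim (signVec g x) ≤ 3 := fun x hx => by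
    by_contra hd
    have := dim_of_mem_sphereFacets hq (hO x hx (by omega))
    omega
  obtain ⟨x, hx0, rfl⟩ := hR β hβ
  obtain ⟨y, rfl, hy0⟩ := ((F.frequently_signVec_eq (by simp) hO' hx0
    (dim_of_mem_sphereFacets hq hβ) hαβ).and_eventually (isOpen_ne.mem_nhds hx0)).exists
  -- The point y of the ridge lies between two rays. If both had the sign vector of x, the three
  -- zeros of x would also be zeros of y, which has only two.
  obtain ⟨ε, x₁, x₂, hε, h1, h2, hf1, hf2, hyf1, hyf2, hd1, hd2, a, b, ha, hb, hab⟩ :=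
    F.exists_split (by simp) hy0 hd.le
  by_contra hcon
  push Not at hcon
  have e1 : signVec g x₁ = signVec g x := by
    by_contra hne
    exact hcon _ (hO _ h1 (by omega)) hne hyf1
  have e2 : signVec g x₂ = signVec g x := by
    by_contra hne
    exact hcon _ (hO _ h2 (by omega)) hne hyf2
  have h3 : zeroSet (signVec g x) ⊆ zeroSet (signVec g y) := fun j hj => by
    have hj1 := hj
    have hj2 := hj
    rw [← e1] at hj1
    rw [← e2] at hj2
    rw [mem_zeroSet, signVec_eq_zero] at hj1 hj2 ⊢
    rw [hab, (F.cone_comb hε hf1 hf2 ha.le hb.le).2, hj1, hj2]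
    ring
  have h4 := Finset.card_le_card h3
  have h5 : dim (signVec g x) ≤ dim (signVec g y) := h4
  rw [dim_of_mem_sphereFacets hq hβ] at h5
  omega

variable {E : Type*} [NormedAddCommGroup E] [NormedSpace ℝ E]

/-- A polytope whose vertices are labelled by the vertices of the `q`-cube and whose facets are
those of the neighborly cubical sphere. -/
structure IsSpherePolytope (q : ℕ) (P : Set E) (u : SignVec q → E) : Prop where
  four_le : 4 ≤ q
  hull : P = convexHull ℝ (u '' {ε | IsVertex ε})
  indep : IsConvexlyIndep u {ε | IsVertex ε}
  facets : {F | IsFacet P F} = cell u '' sphereFacets q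

theorem SignVec.verts_subset_isVertex {n : ℕ} (α : SignVec n) : verts α ⊆ {ε | IsVertex ε} :=
  fun _ h => h.1

namespace IsSpherePolytope

variable {q : ℕ} {P : Set E} {u : SignVec q → E}

theorem facetSet_iff (H : IsSpherePolytope q P u) {F : Set (SignVec q)} (hF : F.Nonempty) :
    IsFacetSet u {ε | IsVertex ε} F ↔ ∃ β ∈ sphereFacets q, F = verts β := by
  constructor
  · intro h
    have h1 := H.indep.isFacet_of_facetSet h hF
    rw [← H.hull] at h1
    have h2 : convexHull ℝ (u '' F) ∈ cell u '' sphereFacets q := H.facets ▸ h1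
    obtain ⟨β, hβ, hc⟩ := h2
    exact ⟨β, hβ, (H.indep.hull_inj (verts_subset_isVertex β) h.prop.1.subset hc).symm⟩
  · rintro ⟨β, hβ, rfl⟩
    have h1 : cell u β ∈ {F | IsFacet P F} := H.facets.symm ▸ ⟨β, hβ, rfl⟩
    have h2 : IsFacet P (cell u β) := h1
    rw [H.hull] at h2
    exact (H.indep.facetSet_of_isFacet (verts_subset_isVertex β) h2).1

theorem isFaceSet_of_facet (H : IsSpherePolytope q P u) {β : SignVec q}
    (hβ : β ∈ sphereFacets q) : IsFaceSet u {ε | IsVertex ε} (verts β) :=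
  ((H.facetSet_iff (verts_nonempty β)).2 ⟨β, hβ, rfl⟩).prop.1

/-- Only facets are known to be faces of P, and intersections of face sets are face sets. Inside a
facet β containing α, each coordinate that is fixed on α but free on β is enforced by a neighbouring
facet, and intersecting β with these leaves exactly the vertices of α. -/
theorem isFaceSet_verts (H : IsSpherePolytope q P u) {α : SignVec q}
    (hα : α ∈ neighborlyCubicalSphere q) : IsFaceSet u {ε | IsVertex ε} (verts α) := by
  have hq := H.four_le
  obtain ⟨β, hβ, hαβ⟩ := (mem_neighborlyCubicalSphere hq).1 hα
  have hdβ := dim_of_mem_sphereFacets hq hβ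
  have key : ∀ j, β j = 0 → α j ≠ 0 →
      ∃ β' ∈ sphereFacets q, IsFace α β' ∧ β' j = α j := by
    intro j hj hαj
    let γ : SignVec q := Function.update β j (α j)
    have hγ : IsFace γ β := fun i => by
      by_cases hi : i = j
      · subst hi; exact Or.inl hj
      · right; simp [γ, hi]
    have hαγ : IsFace α γ := fun i => by
      by_cases hi : i = j
      · subst hi; right; simp [γ]
      · simpa [γ, hi] using hαβ i
    have hz : zeroSet γ = (zeroSet β).erase j := by
      ext i
      by_cases hi : i = j
      · subst hi; simp [mem_zeroSet, γ, hαj]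
      · simp [mem_zeroSet, γ, hi]
    have hd : dim γ = 2 := by
      have := Finset.card_erase_of_mem (mem_zeroSet.2 hj)
      rw [← hz] at this
      change dim γ = dim β - 1 at this
      omega
    obtain ⟨β', hβ', hne, hγβ'⟩ := exists_adjacent_facet hq hβ hγ hd
    refine ⟨β', hβ', hαγ.trans hγβ', ?_⟩
    -- If β' were free at j, it would contain β, and equal dimensions would force β' = β.
    have hj' : β' j ≠ 0 := fun h0 => by
      apply hne
      have h1 : IsFace β β' := fun i => by
        by_cases hi : i = j
        · subst hi; exact Or.inl h0
        · rcases hγβ' i with h2 | h2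
          · exact Or.inl h2
          · right; simpa [γ, hi] using h2
      exact (h1.eq_of_dim_le (by rw [hdβ, dim_of_mem_sphereFacets hq hβ'])).symm
    rcases hγβ' j with h0 | h0
    · exact absurd h0 hj'
    · simpa [γ] using h0.symm
  choose! β' hβ' hαβ' hval using key
  have h1 : ∀ s : Finset (Fin q), (∀ j ∈ s, β j = 0 ∧ α j ≠ 0) →
      IsFaceSet u {ε | IsVertex ε} (verts β ∩ {ε | ∀ j ∈ s, ε ∈ verts (β' j)}) := by
    intro s
    induction s using Finset.induction_on with
    | empty =>
      intro _
      simpa using H.isFaceSet_of_facet hβ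
    | insert a s ha ih =>
      intro hs
      have h2 := (ih fun j hj => hs j (Finset.mem_insert_of_mem hj)).inter
        (H.isFaceSet_of_facet (hβ' a (hs a (Finset.mem_insert_self _ _)).1
          (hs a (Finset.mem_insert_self _ _)).2))
      convert h2 using 1
      ext ε
      simp only [Finset.mem_insert, Set.mem_inter_iff, Set.mem_ofPred_eq, forall_eq_or_imp]
      tauto
  convert h1 (Finset.univ.filter fun j => β j = 0 ∧ α j ≠ 0) (fun j hj => by simpa using hj) using 1
  ext ε
  constructor
  · intro hε
    refine ⟨hαβ.verts_subset hε, fun j hj => ?_⟩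
    simp only [Finset.mem_filter, Finset.mem_univ, true_and] at hj
    exact (hαβ' j hj.1 hj.2).verts_subset hε
  · rintro ⟨hε, hε'⟩
    refine ⟨hε.1, fun j => ?_⟩
    by_cases h0 : α j = 0
    · exact Or.inl h0
    · right
      by_cases hb : β j = 0
      · rcases (hε' j (by simp [hb, h0])).2 j with h2 | h2
        · rw [hval j hb h0] at h2
          exact absurd h2 h0
        · rw [h2, hval j hb h0]
      · rcases hε.2 j with h2 | h2
        · exact absurd h2 hb
        · rcases hαβ j with h3 | h3
          · exact absurd h3 hb
          · rw [h2, h3]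

/-- Every face set is the vertex set of a face of the sphere. -/
theorem exists_eq_verts (H : IsSpherePolytope q P u) {W : Set (SignVec q)}
    (hW : IsFaceSet u {ε | IsVertex ε} W) (hne : W.Nonempty) (hW' : W ≠ {ε | IsVertex ε}) :
    ∃ α ∈ neighborlyCubicalSphere q, W = verts α := by
  have hq := H.four_le
  have hfac : ∀ p, IsVertex p → p ∉ W → ∃ β ∈ sphereFacets q, W ⊆ verts β ∧ p ∉ verts β := by
    intro p hp hpW
    obtain ⟨F, hF, hWF, hpF⟩ := hW.exists_facetSet (p := p) hp hpW
    obtain ⟨β, hβ, rfl⟩ := (H.facetSet_iff (hne.mono hWF)).1 hF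
    exact ⟨β, hβ, hWF, hpF⟩
  -- Descent: as long as α has a vertex p outside W, a facet containing W but not p cuts α down to a
  -- smaller face still containing W.
  have key : ∀ k, ∀ α ∈ neighborlyCubicalSphere q, dim α = k → W ⊆ verts α →
      ∃ α ∈ neighborlyCubicalSphere q, W = verts α := by
    intro k
    induction k using Nat.strong_induction_on with
    | _ k ih =>
      intro α hα hk hWα
      by_cases heq : W = verts α
      · exact ⟨α, hα, heq⟩
      · obtain ⟨p, hp, hpW⟩ : ∃ p ∈ verts α, p ∉ W := by
          by_contra hcon
          push Not at hcon
          exact heq (hWα.antisymm hcon)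
        obtain ⟨β, hβ, hWβ, hpβ⟩ := hfac p hp.1 hpW
        have hWi := Set.subset_inter hWα hWβ
        obtain ⟨γ, h1, h2, h3⟩ := exists_meet (hne.mono hWi)
        refine ih (dim γ) ?_ γ (isCubicalComplex_neighborlyCubicalSphere hq α hα γ h1) rfl
          (h3 ▸ hWi)
        rw [← hk]
        refine h1.dim_lt fun h0 => hpβ ?_
        subst h0
        rw [h3] at hp
        exact hp.2
  obtain ⟨p, hp, hpW⟩ : ∃ p, IsVertex p ∧ p ∉ W := by
    by_contra hcon
    push Not at hcon
    exact hW' (hW.subset.antisymm hcon)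
  obtain ⟨β, hβ, hWβ, -⟩ := hfac p hp hpW
  exact key _ β ((mem_neighborlyCubicalSphere hq).2 ⟨β, hβ, .refl _⟩) rfl hWβ

theorem verts_ne (H : IsSpherePolytope q P u) {α : SignVec q}
    (hα : α ∈ neighborlyCubicalSphere q) : verts α ≠ {ε | IsVertex ε} := by
  intro h
  obtain ⟨β, hβ, hf⟩ := (mem_neighborlyCubicalSphere H.four_le).1 hα
  have h1 : IsFace (0 : SignVec q) α := isFace_of_verts_subset (by
    rw [h]; exact verts_subset_isVertex _)
  have h2 := (h1.trans hf).dim_le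
  rw [dim_of_mem_sphereFacets H.four_le hβ] at h2
  have h3 : dim (0 : SignVec q) = q := by simp [dim, zeroSet]
  have := H.four_le
  omega

theorem isProperFace_cell (H : IsSpherePolytope q P u) {α : SignVec q}
    (hα : α ∈ neighborlyCubicalSphere q) : IsProperFace P (cell u α) := by
  rw [H.hull]
  exact H.indep.isProperFace_iff.2 ⟨verts α, H.isFaceSet_verts hα, verts_nonempty α, H.verts_ne hα,
    rfl⟩

theorem exists_eq_cell (H : IsSpherePolytope q P u) {G : Set E} (hG : IsProperFace P G) :
    ∃ α ∈ neighborlyCubicalSphere q, G = cell u α := by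
  rw [H.hull] at hG
  obtain ⟨W, h1, h2, h3, rfl⟩ := H.indep.isProperFace_iff.1 hG
  obtain ⟨α, hα, rfl⟩ := H.exists_eq_verts h1 h2 h3
  exact ⟨α, hα, rfl⟩

theorem cell_subset_iff (H : IsSpherePolytope q P u) {α β : SignVec q} :
    cell u α ⊆ cell u β ↔ IsFace α β := by
  rw [cell, cell, H.indep.hull_subset_iff (verts_subset_isVertex α) (verts_subset_isVertex β)]
  exact ⟨isFace_of_verts_subset, IsFace.verts_subset⟩

theorem isBoundarySubcomplex (H : IsSpherePolytope q P u) {C : Set (SignVec q)}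
    (hC : IsCubicalComplex C) (hsub : C ⊆ neighborlyCubicalSphere q) :
    IsBoundarySubcomplex C P u where
  face α hα := H.isProperFace_cell (hsub hα)
  le_iff α _ β _ := H.cell_subset_iff
  lower α hα G hG hle := by
    obtain ⟨γ, -, rfl⟩ := H.exists_eq_cell hG
    exact ⟨γ, hC α hα γ (H.cell_subset_iff.1 hle), rfl⟩

theorem isBoundaryComplex (H : IsSpherePolytope q P u) :
    IsBoundaryComplex (neighborlyCubicalSphere q) P u where
  toIsBoundarySubcomplex := H.isBoundarySubcomplex
    (isCubicalComplex_neighborlyCubicalSphere H.four_le) subset_rfl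
  surj _ hG := H.exists_eq_cell hG

end IsSpherePolytope

end SpherePolytope


/-! ### Existence of the neighborly cubical polytope -/

section Existence

variable {E : Type*} [NormedAddCommGroup E] [InnerProductSpace ℝ E]

local notation "⟪" x ", " y "⟫" => inner ℝ x y

namespace IsSignFan

variable {q : ℕ} {g : Fin q → E → ℝ} {L : SignVec q → Fin q → E} {v : SignVec q → E} {h : E → ℝ}

theorem inner_le (F : IsSignFan g L v h) {ε : SignVec q} (hε : IsVertex ε) (x : E) :
    ⟪v ε, x⟫ ≤ h x := by
  have h1 := F.le_support ε x hε
  have h2 : 0 ≤ ∑ j, |(|g j x| - (ε j : ℝ) * ⟪L ε j, x⟫)| :=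
    Finset.sum_nonneg fun _ _ => abs_nonneg _
  linarith

/-- Equality in the support bound annihilates the gap sum, so ε_j L_j has the nonnegative value
|g_j| for all j and x lies in the cone of ε. Thus the signs of g at x determine which vertices are
maximal in direction x. -/
theorem inner_eq_iff (F : IsSignFan g L v h) {ε : SignVec q} (hε : IsVertex ε) (x : E) :
    ⟪v ε, x⟫ = h x ↔ IsFace ε (signVec g x) := by
  constructor
  · intro heq
    have h1 := F.le_support ε x hε
    rw [heq, sub_self] at h1
    have h2 : ∑ j, |(|g j x| - (ε j : ℝ) * ⟪L ε j, x⟫)| = 0 :=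
      le_antisymm h1 (Finset.sum_nonneg fun _ _ => abs_nonneg _)
    rw [Finset.sum_eq_zero_iff_of_nonneg fun _ _ => abs_nonneg _] at h2
    have h3 : ∀ j, |g j x| = (ε j : ℝ) * ⟪L ε j, x⟫ := fun j =>
      sub_eq_zero.1 (abs_eq_zero.1 (h2 j (Finset.mem_univ j)))
    have h4 := F.eq_of_L ε x hε fun j => by rw [← h3]; exact abs_nonneg _
    exact (isFace_signVec_iff hε).2 fun j => by rw [h4, ← h3]; exact abs_nonneg _
  · exact fun hf => F.support_eq ε x hε ((isFace_signVec_iff hε).1 hf)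

theorem isFaceSet_verts (F : IsSignFan g L v h) (x : E) :
    IsFaceSet v {ε | IsVertex ε} (verts (signVec g x)) := by
  refine ⟨innerSL ℝ x, h x, fun ε hε => ?_, ?_⟩
  · rw [innerSL_apply_apply, real_inner_comm]
    exact F.inner_le hε x
  · ext ε
    simp only [verts, Set.mem_ofPred_eq, innerSL_apply_apply, real_inner_comm (v ε) x]
    exact and_congr_right fun hε => (F.inner_eq_iff hε x).symm

/-- A supporting functional is the inner product with some x, and its maximum over the points v(ε)
must be h x. Properness of W excludes x = 0. -/
theorem exists_of_isFaceSet [CompleteSpace E] (F : IsSignFan g L v h) {W : Set (SignVec q)}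
    (hW : IsFaceSet v {ε | IsVertex ε} W) (hne : W.Nonempty) (hW' : W ≠ {ε | IsVertex ε}) :
    ∃ x, x ≠ 0 ∧ W = verts (signVec g x) := by
  obtain ⟨l, c, hl, rfl⟩ := hW
  set x := (InnerProductSpace.toDual ℝ E).symm l with hx
  have hlx : ∀ y, l y = ⟪y, x⟫ := fun y => by
    rw [real_inner_comm, hx, InnerProductSpace.toDual_symm_apply]
  obtain ⟨ε₀, hε₀, hc₀⟩ := hne
  obtain ⟨ε₁, hε₁, hf₁⟩ := exists_isVertex_isFace (signVec g x)
  have hc : c = h x := by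
    refine le_antisymm ?_ ?_
    · rw [← hc₀, hlx]; exact F.inner_le hε₀ x
    · rw [← (F.inner_eq_iff hε₁ x).2 hf₁, ← hlx]; exact hl ε₁ hε₁
  refine ⟨x, fun hx0 => hW' ?_, ?_⟩
  · refine Set.Subset.antisymm (fun i hi => hi.1) fun i hi => ⟨hi, ?_⟩
    rw [← hc₀, hlx, hlx, hx0, inner_zero_right, inner_zero_right]
  · ext ε
    simp only [verts, Set.mem_ofPred_eq, hlx, hc]
    exact and_congr_right fun hε => F.inner_eq_iff hε x

end IsSignFan

/-- The sign vectors of nonzero x are exactly the faces of the sphere, and the face of the hull in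
direction x has the vertices of the sign vector of x. So the fan is the normal fan of the hull. -/
theorem exists_spherePolytope [FiniteDimensional ℝ E] (hE : Module.finrank ℝ E = 4) {q : ℕ}
    (hq : 4 ≤ q) : ∃ v : SignVec q → E,
      IsSpherePolytope q (convexHull ℝ (v '' {ε | IsVertex ε})) v ∧
      (interior (convexHull ℝ (v '' {ε | IsVertex ε}))).Nonempty := by
  obtain ⟨g, L, v, h, F, hO, hR⟩ := exists_sphere_fan (E := E) hE hq
  have : CompleteSpace E := FiniteDimensional.complete ℝ E
  have hO' : ∀ x, x ≠ 0 → dim (signVec g x) ≤ 3 := fun x hx => by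
    by_contra hd
    have := dim_of_mem_sphereFacets hq (hO x hx (by omega))
    omega
  have hreal : ∀ α ∈ neighborlyCubicalSphere q, ∃ x, x ≠ 0 ∧ signVec g x = α := by
    intro α hα
    obtain ⟨β, hβ, hf⟩ := (mem_neighborlyCubicalSphere hq).1 hα
    obtain ⟨x, hx0, rfl⟩ := hR β hβ
    obtain ⟨y, hy, hy0⟩ := ((F.frequently_signVec_eq hE hO' hx0
      (dim_of_mem_sphereFacets hq hβ) hf).and_eventually (isOpen_ne.mem_nhds hx0)).exists
    exact ⟨y, hy0, hy⟩
  have hmem : ∀ x, x ≠ 0 → signVec g x ∈ neighborlyCubicalSphere q := by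
    intro x hx0
    obtain ⟨y, hy0, hf, hd⟩ := F.exists_climb hE hx0
    exact (mem_neighborlyCubicalSphere hq).2 ⟨_, hO y hy0 hd, hf⟩
  -- Every cube vertex lies in the sphere, so each v(ε) is the unique maximizer of some functional.
  -- This yields convex independence.
  have hvert : ∀ ε : SignVec q, IsVertex ε → IsFaceSet v {ε | IsVertex ε} {ε} := by
    intro ε hε
    obtain ⟨x, -, hx⟩ := hreal ε (isCubicallyNeighborly_sphere hq ε
      (by rw [isVertex_iff_dim.1 hε]; omega))
    have h1 := F.isFaceSet_verts x
    rw [hx] at h1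
    convert h1 using 1
    ext δ
    simp only [Set.mem_singleton_iff, verts, Set.mem_ofPred_eq]
    constructor
    · rintro rfl
      exact ⟨hε, .refl _⟩
    · rintro ⟨-, hf⟩
      exact hf.eq_of_dim_le (by rw [isVertex_iff_dim.1 hε]; omega)
  have hindep : IsConvexlyIndep v {ε | IsVertex ε} := by
    intro ε hε W hW hmemW
    obtain ⟨l, c, hl, heq⟩ := hvert ε hε
    have h1 : ε ∈ {ε | IsVertex ε ∧ l (v ε) = c} := heq ▸ Set.mem_singleton ε
    have h2 := mem_hull_of_eq (fun i hi => hl i (hW hi)) hmemW h1.2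
    have h3 : (v '' {i | i ∈ W ∧ l (v i) = c}).Nonempty :=
      convexHull_nonempty_iff.1 ⟨_, h2⟩
    obtain ⟨i, hi, hic⟩ := h3.of_image
    have h4 : i ∈ ({ε} : Set (SignVec q)) := heq.symm ▸ ⟨hW hi, hic⟩
    rw [Set.mem_singleton_iff] at h4
    exact h4 ▸ hi
  have hface : ∀ G : Set E, IsProperFace (convexHull ℝ (v '' {ε | IsVertex ε})) G ↔
      ∃ α ∈ neighborlyCubicalSphere q, G = cell v α := by
    intro G
    rw [hindep.isProperFace_iff]
    constructor
    · rintro ⟨W, h1, h2, h3, rfl⟩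
      obtain ⟨x, hx0, rfl⟩ := F.exists_of_isFaceSet h1 h2 h3
      exact ⟨_, hmem x hx0, rfl⟩
    · rintro ⟨α, hα, rfl⟩
      obtain ⟨x, hx0, rfl⟩ := hreal α hα
      refine ⟨_, F.isFaceSet_verts x, verts_nonempty _, fun h0 => ?_, rfl⟩
      obtain ⟨j, hj⟩ := F.signVec_ne_zero hx0
      have h1 : IsFace (0 : SignVec q) (signVec g x) := isFace_of_verts_subset (by
        rw [h0]; exact verts_subset_isVertex _)
      exact hj (signVec_eq_zero.1 (h1.apply_eq_zero rfl))
  have hsub : ∀ {α β : SignVec q}, cell v α ⊆ cell v β ↔ IsFace α β := fun {α β} => by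
    rw [cell, cell, hindep.hull_subset_iff (verts_subset_isVertex α) (verts_subset_isVertex β)]
    exact ⟨isFace_of_verts_subset, IsFace.verts_subset⟩
  refine ⟨v, ⟨hq, rfl, hindep, ?_⟩, ?_⟩
  · ext G
    constructor
    · intro hG
      obtain ⟨α, hα, rfl⟩ := (hface G).1 hG.prop
      obtain ⟨β, hβ, hf⟩ := (mem_neighborlyCubicalSphere hq).1 hα
      have h1 : cell v β ⊆ cell v α := hG.le_of_ge ((hface _).2
        ⟨β, (mem_neighborlyCubicalSphere hq).2 ⟨β, hβ, .refl _⟩, rfl⟩) (hsub.2 hf)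
      rw [hf.antisymm (hsub.1 h1)]
      exact ⟨β, hβ, rfl⟩
    · rintro ⟨β, hβ, rfl⟩
      refine ⟨(hface _).2 ⟨β, (mem_neighborlyCubicalSphere hq).2 ⟨β, hβ, .refl _⟩, rfl⟩,
        fun G hG hle => ?_⟩
      obtain ⟨α, hα, rfl⟩ := (hface G).1 hG
      obtain ⟨β', hβ', hf⟩ := (mem_neighborlyCubicalSphere hq).1 hα
      have hf' := hsub.1 hle
      have h1 : β = β' := (hf'.trans hf).eq_of_dim_le
        (by rw [dim_of_mem_sphereFacets hq hβ, dim_of_mem_sphereFacets hq hβ'])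
      exact hsub.2 (h1 ▸ hf)
  · rw [interior_convexHull_nonempty_iff_affineSpan_eq_top]
    have hne : (affineSpan ℝ (v '' {ε | IsVertex ε}) : Set E).Nonempty := by
      obtain ⟨ε, hε, -⟩ := exists_isVertex_isFace (0 : SignVec q)
      exact ⟨v ε, subset_affineSpan ℝ _ ⟨ε, hε, rfl⟩⟩
    rw [← AffineSubspace.direction_eq_top_iff_of_nonempty hne, direction_affineSpan,
      ← Submodule.orthogonal_eq_bot_iff]
    -- A nonzero x orthogonal to all differences of vertices would make every ε maximal in direction
    -- x. Then the whole cube would be a face of the sign vector of x, forcing all g_j x = 0.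
    by_contra hbot
    obtain ⟨x, hx, hx0⟩ := (Submodule.ne_bot_iff _).1 hbot
    obtain ⟨ε₁, hε₁, hf₁⟩ := exists_isVertex_isFace (signVec g x)
    have hall : ∀ ε, IsVertex ε → IsFace ε (signVec g x) := fun ε hε => by
      rw [← F.inner_eq_iff hε, ← (F.inner_eq_iff hε₁ x).2 hf₁, ← sub_eq_zero, ← inner_sub_left]
      exact (Submodule.mem_orthogonal _ _).1 hx _
        (vsub_mem_vectorSpan ℝ ⟨ε, hε, rfl⟩ ⟨ε₁, hε₁, rfl⟩)
    obtain ⟨j, hj⟩ := F.signVec_ne_zero hx0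
    have h1 : IsFace (0 : SignVec q) (signVec g x) :=
      isFace_of_verts_subset fun ε hε => ⟨hε.1, hall ε hε.1⟩
    exact hj (signVec_eq_zero.1 (h1.apply_eq_zero rfl))

end Existence

/-! ### Relabelling -/

section Relabelling

variable {n : ℕ}

namespace SignVec

theorem reverseFlip_injective : Function.Injective (reverseFlip : SignVec n → SignVec n) := by
  intro α β h
  funext i
  have h1 := congrFun h (Fin.rev i)
  unfold reverseFlip at h1
  rw [Fin.rev_rev, SignType.neg_one_pow_mul_eq_iff, ← mul_assoc, SignType.neg_one_pow_mul_self,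
    one_mul] at h1
  exact h1

theorem reverseFlip_surjective : Function.Surjective (reverseFlip : SignVec n → SignVec n) :=
  Finite.surjective_of_injective reverseFlip_injective

theorem isVertex_reverseFlip {ε : SignVec n} : IsVertex (reverseFlip ε) ↔ IsVertex ε := by
  rw [isVertex_iff_dim, isVertex_iff_dim, dim_reverseFlip]

theorem isFace_reverseFlip {α β : SignVec n} :
    IsFace (reverseFlip α) (reverseFlip β) ↔ IsFace α β := by
  have key : ∀ i, (reverseFlip β i = 0 ∨ reverseFlip α i = reverseFlip β i) ↔
      (β (Fin.rev i) = 0 ∨ α (Fin.rev i) = β (Fin.rev i)) := by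
    intro i
    rw [reverseFlip_eq_zero_iff]
    unfold reverseFlip
    rw [SignType.neg_one_pow_mul_eq_iff, ← mul_assoc, SignType.neg_one_pow_mul_self, one_mul]
  constructor
  · intro h i
    have := (key (Fin.rev i)).1 (h (Fin.rev i))
    rwa [Fin.rev_rev] at this
  · exact fun h i => (key i).2 (h _)

theorem image_reverseFlip_isVertex :
    (reverseFlip : SignVec n → SignVec n) '' {ε | IsVertex ε} = {ε | IsVertex ε} := by
  ext ε
  constructor
  · rintro ⟨δ, hδ, rfl⟩
    exact isVertex_reverseFlip.2 hδ
  · intro hε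
    obtain ⟨δ, rfl⟩ := reverseFlip_surjective ε
    exact ⟨δ, isVertex_reverseFlip.1 hε, rfl⟩

theorem image_reverseFlip_verts (α : SignVec n) :
    reverseFlip '' verts α = verts (reverseFlip α) := by
  ext ε
  constructor
  · rintro ⟨δ, hδ, rfl⟩
    exact ⟨isVertex_reverseFlip.2 hδ.1, isFace_reverseFlip.2 hδ.2⟩
  · intro hε
    obtain ⟨δ, rfl⟩ := reverseFlip_surjective ε
    exact ⟨δ, ⟨isVertex_reverseFlip.1 hε.1, isFace_reverseFlip.1 hε.2⟩, rfl⟩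

end SignVec

theorem image_reverseFlip_sphereFacets (hn : 4 ≤ n) :
    reverseFlip '' sphereFacets n = {α | CubicalGale 3 α} := by
  ext α
  constructor
  · rintro ⟨β, hβ, rfl⟩
    exact (cubicalGale_reverseFlip_iff hn).2 hβ
  · intro hα
    obtain ⟨β, rfl⟩ := reverseFlip_surjective α
    exact ⟨β, (cubicalGale_reverseFlip_iff hn).1 hα, rfl⟩

theorem cell_comp_reverseFlip {E : Type*} [NormedAddCommGroup E] [NormedSpace ℝ E]
    (v : SignVec n → E) (α : SignVec n) :
    cell (fun ε => v (reverseFlip ε)) α = cell v (reverseFlip α) := by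
  rw [cell, cell, ← image_reverseFlip_verts, Set.image_image]

/-- Convex independence of the labelled points follows because they are distinct extreme points: an
extreme point of P lying in a smaller hull is extreme there, hence one of its generators. -/
theorem IsNeighborlyCubicalPolytope.isSpherePolytope (hn : 4 ≤ n)
    {P : Set (EuclideanSpace ℝ (Fin (3 + 1)))} {v : SignVec n → EuclideanSpace ℝ (Fin (3 + 1))}
    (H : IsNeighborlyCubicalPolytope 3 n P v) :
    IsSpherePolytope n P (fun ε => v (reverseFlip ε)) where
  four_le := hn
  hull := by
    rw [H.hull]
    conv_lhs => rw [← image_reverseFlip_isVertex, Set.image_image]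
  indep := by
    intro ε hε W hW hmem
    have hε' : IsVertex (reverseFlip ε) := isVertex_reverseFlip.2 hε
    have h1 : v (reverseFlip ε) ∈ P.extremePoints ℝ := by
      rw [H.vertices]
      exact ⟨_, hε', rfl⟩
    have h2 : convexHull ℝ ((fun ε => v (reverseFlip ε)) '' W) ⊆ P := by
      rw [H.hull]
      refine convexHull_mono ?_
      rintro _ ⟨δ, hδ, rfl⟩
      exact ⟨_, isVertex_reverseFlip.2 (hW hδ), rfl⟩
    have h3 := extremePoints_convexHull_subset
      (inter_extremePoints_subset_extremePoints_of_subset h2 ⟨hmem, h1⟩)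
    obtain ⟨δ, hδ, heq⟩ := h3
    have h4 := H.injOn (isVertex_reverseFlip.2 (hW hδ)) hε' heq
    rwa [← reverseFlip_injective h4]
  facets := by
    rw [H.facets, ← image_reverseFlip_sphereFacets hn, Set.image_image]
    exact Set.image_congr fun α _ => (cell_comp_reverseFlip v α).symm

theorem exists_neighborlyCubicalPolytope (hn : 4 ≤ n) :
    ∃ (P : Set (EuclideanSpace ℝ (Fin (3 + 1)))) (v : SignVec n → EuclideanSpace ℝ (Fin (3 + 1))),
      IsNeighborlyCubicalPolytope 3 n P v := by
  obtain ⟨u, H, hint⟩ := exists_spherePolytope (E := EuclideanSpace ℝ (Fin (3 + 1))) (by simp) hn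
  let e : SignVec n ≃ SignVec n :=
    Equiv.ofBijective reverseFlip ⟨reverseFlip_injective, reverseFlip_surjective⟩
  have hcomp : (fun ε => (u ∘ e.symm) (reverseFlip ε)) = u :=
    funext fun ε => congrArg u (e.symm_apply_apply ε)
  have himg : (u ∘ e.symm) '' {ε | IsVertex ε} = u '' {ε | IsVertex ε} := by
    conv_rhs => rw [← hcomp]
    rw [← Set.image_image (g := u ∘ e.symm) (f := reverseFlip), image_reverseFlip_isVertex]
  have hinj : Set.InjOn u {ε | IsVertex ε} := by
    intro ε hε δ hδ heq
    have h1 : u ε ∈ convexHull ℝ (u '' {δ}) := subset_convexHull ℝ _ ⟨δ, rfl, heq.symm⟩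
    exact H.indep ε hε {δ} (Set.singleton_subset_iff.2 hδ) h1
  refine ⟨_, u ∘ e.symm, by rw [himg], ?_, ?_, hint, ?_⟩
  · intro ε hε δ hδ heq
    obtain ⟨ε, rfl⟩ := e.surjective ε
    obtain ⟨δ, rfl⟩ := e.surjective δ
    simp only [Function.comp_apply, e.symm_apply_apply] at heq
    rw [hinj (isVertex_reverseFlip.1 hε) (isVertex_reverseFlip.1 hδ) heq]
  · rw [himg]
    refine Set.Subset.antisymm extremePoints_convexHull_subset ?_
    rintro _ ⟨ε, hε, rfl⟩
    have hmem : ε ∈ neighborlyCubicalSphere n :=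
      isCubicallyNeighborly_sphere hn ε (by rw [isVertex_iff_dim.1 hε]; omega)
    have h1 := (H.isProperFace_cell hmem).1
    have h2 : cell u ε = {u ε} := by
      have : verts ε = {ε} := by
        ext δ
        constructor
        · exact fun hδ => hδ.2.eq_of_dim_le (by rw [isVertex_iff_dim.1 hε]; omega)
        · rintro rfl
          exact ⟨hε, .refl _⟩
      rw [cell, this, Set.image_singleton, convexHull_singleton]
    rw [h2] at h1
    exact exposedPoints_subset_extremePoints (mem_exposedPoints_iff_exposed_singleton.2 h1)
  · rw [H.facets, ← image_reverseFlip_sphereFacets hn, Set.image_image]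
    refine Set.image_congr fun α _ => ?_
    rw [← cell_comp_reverseFlip, hcomp]

end Relabelling


/-! ### Central projections of faces -/

section Schlegel

variable {E : Type*} [NormedAddCommGroup E] [NormedSpace ℝ E] {ι : Type*}

theorem schlegelProjection_eq {l : StrongDual ℝ E} {c t : ℝ} {x y z : E} (hx : l x ≠ l y)
    (hz : l z = c) (h : z - y = t • (x - y)) : schlegelProjection l c y x = z := by
  have h1 := congrArg l h
  simp only [map_sub, map_smul, smul_eq_mul, hz] at h1
  rw [schlegelProjection, h1, mul_div_cancel_right₀ _ (sub_ne_zero.2 hx), ← h, add_sub_cancel]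

theorem schlegelProjection_apply {l : StrongDual ℝ E} {c : ℝ} {x y : E} (hx : l x ≠ l y) :
    l (schlegelProjection l c y x) = c := by
  simp only [schlegelProjection, map_add, map_smul, map_sub, smul_eq_mul]
  rw [div_mul_cancel₀ _ (sub_ne_zero.2 hx), add_sub_cancel]

theorem exists_schlegelProjection_sub {l : StrongDual ℝ E} {c : ℝ} {x y : E} (hx : l x < l y)
    (hy : c < l y) : ∃ t : ℝ, 0 < t ∧ schlegelProjection l c y x - y = t • (x - y) :=
  ⟨_, div_pos_of_neg_of_neg (sub_neg.2 hy) (sub_neg.2 hx), add_sub_cancel_left _ _⟩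

/-- The projection is projective, not affine, but it still maps segments to segments: points on rays
from y are rescaled by positive factors, so the preimage of a combination is a combination with
weights multiplied by these factors and normalized. -/
theorem convex_image_schlegelProjection {l : StrongDual ℝ E} {c : ℝ} {y : E} {K : Set E}
    (hK : Convex ℝ K) (hl : ∀ x ∈ K, l x < l y) (hy : c < l y) :
    Convex ℝ (schlegelProjection l c y '' K) := by
  rintro _ ⟨x, hx, rfl⟩ _ ⟨x', hx', rfl⟩ a b ha hb hab
  obtain ⟨t, ht, h⟩ := exists_schlegelProjection_sub (hl x hx) hy
  obtain ⟨t', ht', h'⟩ := exists_schlegelProjection_sub (hl x' hx') hy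
  have hT : 0 < a * t + b * t' := by
    rcases ha.eq_or_lt with rfl | ha
    · obtain rfl : b = 1 := by linarith
      simpa
    · positivity
  have hm : (a * t / (a * t + b * t')) • x + (b * t' / (a * t + b * t')) • x' ∈ K :=
    hK hx hx' (by positivity) (by positivity) (by rw [← add_div, div_self hT.ne'])
  refine ⟨_, hm, schlegelProjection_eq (t := a * t + b * t') (hl _ hm).ne ?_ ?_⟩
  · rw [map_add, map_smul, map_smul, schlegelProjection_apply (hl x hx).ne,
      schlegelProjection_apply (hl x' hx').ne, ← add_smul, hab, one_smul]
  · rw [smul_sub, smul_add, smul_smul, smul_smul, mul_div_cancel₀ _ hT.ne',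
      mul_div_cancel₀ _ hT.ne', eq_add_of_sub_eq h, eq_add_of_sub_eq h']
    obtain rfl : b = 1 - a := by linarith
    module

theorem schlegelProjection_image_hull {l : StrongDual ℝ E} {c : ℝ} {y : E} {u : ι → E}
    {W : Set ι} (hl : ∀ i ∈ W, l (u i) ≤ c) (hy : c < l y) :
    schlegelProjection l c y '' convexHull ℝ (u '' W) =
      convexHull ℝ ((fun i => schlegelProjection l c y (u i)) '' W) := by
  have hlt : ∀ x ∈ convexHull ℝ (u '' W), l x < l y := fun x hx =>
    (le_of_mem_hull hl hx).trans_lt hy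
  refine Set.Subset.antisymm ?_ (convexHull_min ?_
    (convex_image_schlegelProjection (convex_convexHull ℝ _) hlt hy))
  · set H := convexHull ℝ ((fun i => schlegelProjection l c y (u i)) '' W)
    have hconv : Convex ℝ {x | l x ≤ c ∧ schlegelProjection l c y x ∈ H} := by
      intro x hx x' hx' a b ha hb hab
      have hle : l (a • x + b • x') ≤ c :=
        convex_halfSpace_le l.toLinearMap.isLinear c hx.1 hx'.1 ha hb hab
      refine ⟨hle, ?_⟩
      obtain ⟨t, ht, h⟩ := exists_schlegelProjection_sub (hx.1.trans_lt hy) hy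
      obtain ⟨t', ht', h'⟩ := exists_schlegelProjection_sub (hx'.1.trans_lt hy) hy
      have hT : 0 < a / t + b / t' := by
        rcases ha.eq_or_lt with rfl | ha
        · obtain rfl : b = 1 := by linarith
          simpa
        · positivity
      have hsum : a / t / (a / t + b / t') + b / t' / (a / t + b / t') = 1 := by
        rw [← add_div, div_self hT.ne']
      have hm := convex_convexHull ℝ _ hx.2 hx'.2
        (div_nonneg (div_nonneg ha ht.le) hT.le) (div_nonneg (div_nonneg hb ht'.le) hT.le) hsum
      convert hm using 1
      refine schlegelProjection_eq (t := (a / t + b / t')⁻¹) (hle.trans_lt hy).ne ?_ ?_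
      · rw [map_add, map_smul, map_smul, schlegelProjection_apply (hx.1.trans_lt hy).ne,
          schlegelProjection_apply (hx'.1.trans_lt hy).ne, ← add_smul, hsum, one_smul]
      · rw [eq_add_of_sub_eq h, eq_add_of_sub_eq h']
        have e1 : a / t / (a / t + b / t') * t = (a / t + b / t')⁻¹ * a := by field_simp
        have e2 : b / t' / (a / t + b / t') * t' = (a / t + b / t')⁻¹ * b := by field_simp
        simp only [smul_add, smul_smul, e1, e2]
        rw [add_add_add_comm, ← add_smul, hsum]
        obtain rfl : b = 1 - a := by linarith
        module
    refine Set.image_subset_iff.2 fun x hx => (convexHull_min ?_ hconv hx).2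
    rintro _ ⟨i, hi, rfl⟩
    exact ⟨hl i hi, subset_convexHull ℝ _ ⟨i, hi, rfl⟩⟩
  · rintro _ ⟨i, hi, rfl⟩
    exact ⟨u i, subset_convexHull ℝ _ ⟨i, hi, rfl⟩, rfl⟩

/-- The part `W` of the family lies on a valid inequality that is strictly satisfied by `y`. -/
def IsBeneath (u : ι → E) (I : Set ι) (y : E) (W : Set ι) : Prop :=
  ∃ (l : StrongDual ℝ E) (c : ℝ), (∀ i ∈ I, l (u i) ≤ c) ∧ (∀ i ∈ W, l (u i) = c) ∧ l y < c

variable {u : ι → E} {I V V' W W' : Set ι} {y : E}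

theorem IsBeneath.mono (h : IsBeneath u I y V) (hW : W ⊆ V) : IsBeneath u I y W := by
  obtain ⟨l, c, h1, h2, h3⟩ := h
  exact ⟨l, c, h1, fun i hi => h2 i (hW hi), h3⟩

/-- The functional that is tight on V increases along the ray from y through x and reaches its
maximum over the hull at x. No point of the hull lies behind x, so V is on the far side as seen from
y. -/
theorem IsBeneath.le_one (h : IsBeneath u I y V) (hV : V ⊆ I) {x x' : E} {r : ℝ}
    (hx : x ∈ convexHull ℝ (u '' V)) (hx' : x' ∈ convexHull ℝ (u '' I))
    (hr : x' - y = r • (x - y)) : r ≤ 1 := by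
  obtain ⟨l, c, h1, h2, h3⟩ := h
  have e1 := le_of_mem_hull h1 hx'
  have e2 : l x = c := by
    refine le_antisymm (le_of_mem_hull (fun i hi => h1 i (hV hi)) hx) ?_
    have := le_of_mem_hull (l := -l) (c := -c) (fun i hi => by simp [h2 i hi]) hx
    simpa using this
  have e3 := congrArg l hr
  simp only [map_sub, map_smul, smul_eq_mul, e2] at e3
  nlinarith

theorem IsBeneath.schlegelProjection_inj {l : StrongDual ℝ E} {c : ℝ} (hl : ∀ i ∈ I, l (u i) ≤ c)
    (hy : c < l y) (h : IsBeneath u I y V) (h' : IsBeneath u I y V') (hV : V ⊆ I) (hV' : V' ⊆ I)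
    {x x' : E} (hx : x ∈ convexHull ℝ (u '' V)) (hx' : x' ∈ convexHull ℝ (u '' V'))
    (heq : schlegelProjection l c y x = schlegelProjection l c y x') : x = x' := by
  have hI := convexHull_mono (Set.image_mono hV) hx
  have hI' := convexHull_mono (Set.image_mono hV') hx'
  obtain ⟨t, ht, e⟩ := exists_schlegelProjection_sub ((le_of_mem_hull hl hI).trans_lt hy) hy
  obtain ⟨t', ht', e'⟩ := exists_schlegelProjection_sub ((le_of_mem_hull hl hI').trans_lt hy) hy
  rw [heq, e'] at e
  have r1 : x' - y = (t / t') • (x - y) := by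
    rw [div_eq_inv_mul, mul_smul, ← e, inv_smul_smul₀ ht'.ne']
  have r2 : x - y = (t' / t) • (x' - y) := by
    rw [div_eq_inv_mul, mul_smul, e, inv_smul_smul₀ ht.ne']
  -- Each of x and x' is the last point of the hull on their common ray, so both ratios are at most
  -- 1.
  have h1 := h.le_one hV hx hI' r1
  have h2 := h'.le_one hV' hx' hI r2
  rw [div_le_one ht'] at h1
  rw [div_le_one ht] at h2
  obtain rfl := le_antisymm h1 h2
  rw [div_self ht.ne', one_smul] at r2
  exact sub_left_injective r2

/-- A face set of a face set is a face set. -/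
theorem IsFaceSet.trans [Finite ι] (hW : IsFaceSet u V W) (hV : IsFaceSet u I V) :
    IsFaceSet u I W := by
  obtain ⟨l, c, hl, rfl⟩ := hW
  obtain ⟨m, d, hm, rfl⟩ := hV
  -- Adding a large multiple of the inequality of V makes the sum strict off V. N bounds the
  -- required multiples, and N + 1 leaves room for strictness.
  obtain ⟨N, hN⟩ := ((Set.toFinite I).image fun i => (l (u i) - c) / (d - m (u i))).bddAbove
  have hlt : ∀ i ∈ I, m (u i) ≠ d → l (u i) - c < (N + 1) * (d - m (u i)) := by
    intro i hi hne
    have h1 : 0 < d - m (u i) := sub_pos.2 (lt_of_le_of_ne (hm i hi) hne)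
    rw [← div_lt_iff₀ h1]
    have := hN ⟨i, hi, rfl⟩
    simp only at this
    linarith
  refine ⟨l + (N + 1) • m, c + (N + 1) * d, fun i hi => ?_, ?_⟩
  · simp only [add_apply, smul_apply, smul_eq_mul]
    by_cases h0 : m (u i) = d
    · rw [h0]
      linarith [hl i ⟨hi, h0⟩]
    · linarith [hlt i hi h0]
  · ext i
    simp only [Set.mem_ofPred_eq, add_apply, smul_apply, smul_eq_mul]
    constructor
    · rintro ⟨⟨h1, h2⟩, h3⟩
      exact ⟨h1, by rw [h2, h3]⟩
    · rintro ⟨h1, h2⟩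
      by_cases h0 : m (u i) = d
      · rw [h0] at h2
        exact ⟨⟨h1, h0⟩, by linarith⟩
      · linarith [hlt i h1 h0]

/-- A point of both hulls is tight for the inequality of V, so its representation over V' uses only
tight indices, which lie in V. -/
theorem IsFaceSet.hull_inter (hV : IsFaceSet u I V) (hV' : V' ⊆ I) :
    convexHull ℝ (u '' V) ∩ convexHull ℝ (u '' V') = convexHull ℝ (u '' (V ∩ V')) := by
  refine Set.Subset.antisymm ?_ (Set.subset_inter
    (convexHull_mono (Set.image_mono Set.inter_subset_left))
    (convexHull_mono (Set.image_mono Set.inter_subset_right)))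
  obtain ⟨l, c, hl, rfl⟩ := hV
  rintro x ⟨hx, hx'⟩
  rw [← hull_inter_eq hl] at hx
  refine convexHull_mono (Set.image_mono ?_)
    (mem_hull_of_eq (fun i hi => hl i (hV' hi)) hx' hx.2)
  exact fun i hi => ⟨⟨hV' hi.1, hi.2⟩, hi.1⟩

/-- A proper face set spans a space of smaller dimension. -/
theorem IsFaceSet.finrank_vectorSpan_lt [FiniteDimensional ℝ E] (hW : IsFaceSet u V W)
    (hne : W.Nonempty) (hWV : W ≠ V) :
    Module.finrank ℝ (vectorSpan ℝ (u '' W)) < Module.finrank ℝ (vectorSpan ℝ (u '' V)) := by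
  obtain ⟨l, c, hl, rfl⟩ := hW
  refine Submodule.finrank_lt_finrank_of_lt
    (lt_of_le_not_ge (vectorSpan_mono ℝ (Set.image_mono fun i hi => hi.1)) fun hle => ?_)
  obtain ⟨k, hk, hkc⟩ := hne
  have h1 : vectorSpan ℝ (u '' {i | i ∈ V ∧ l (u i) = c}) ≤ LinearMap.ker l.toLinearMap := by
    refine Submodule.span_le.2 ?_
    rintro _ ⟨_, ⟨i, hi, rfl⟩, _, ⟨j, hj, rfl⟩, rfl⟩
    simp [hi.2, hj.2]
  refine hWV (Set.Subset.antisymm (fun i hi => hi.1) fun i hi => ⟨hi, ?_⟩)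
  have h2 := (hle.trans h1) (vsub_mem_vectorSpan ℝ (Set.mem_image_of_mem u hi)
    (Set.mem_image_of_mem u hk))
  simp only [vsub_eq_sub, LinearMap.mem_ker, ContinuousLinearMap.coe_coe, map_sub, hkc] at h2
  linarith

/-! ### Transfer of faces and intersections along the central projection -/

variable {E' : Type*} [NormedAddCommGroup E'] [NormedSpace ℝ E']

/-- In the affine coordinates `e` of the hyperplane `l = c`, the family `w` is the central
projection of the family `u` from the point `y`. -/
structure IsSchlegelMap (u : ι → E) (I : Set ι) (l : StrongDual ℝ E) (c : ℝ) (y : E)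
    (e : E' →ᵃ[ℝ] E) (w : ι → E') : Prop where
  le : ∀ i ∈ I, l (u i) ≤ c
  lt : c < l y
  inj : Function.Injective e
  range : Set.range e = {x | l x = c}
  map : ∀ i ∈ I, e (w i) = schlegelProjection l c y (u i)

namespace IsSchlegelMap

variable {l : StrongDual ℝ E} {c : ℝ} {e : E' →ᵃ[ℝ] E} {w : ι → E'}

theorem image_hull (h : IsSchlegelMap u I l c y e w) (hW : W ⊆ I) :
    e '' convexHull ℝ (w '' W) = schlegelProjection l c y '' convexHull ℝ (u '' W) := by
  rw [schlegelProjection_image_hull (fun i hi => h.le i (hW hi)) h.lt, AffineMap.image_convexHull,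
    Set.image_image]
  congr 1
  exact Set.image_congr fun i hi => h.map i (hW hi)

theorem apply_eq (h : IsSchlegelMap u I l c y e w) (z : E') : l (e z) = c := by
  have : e z ∈ {x | l x = c} := h.range ▸ Set.mem_range_self z
  exact this

/-- A hyperplane of the diagram spans, together with y, a hyperplane of E. Central projection
rescales differences from y by positive factors and therefore preserves sides. -/
theorem isFaceSet_of_image [FiniteDimensional ℝ E] (h : IsSchlegelMap u I l c y e w) (hV : V ⊆ I)
    (hW : IsFaceSet w V W) : IsFaceSet u V W := by
  obtain ⟨k, d, hk, rfl⟩ := hW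
  have hinj : LinearMap.ker e.linear = ⊥ :=
    LinearMap.ker_eq_bot.2 (e.linear_injective_iff.2 h.inj)
  obtain ⟨g, hg⟩ := e.linear.exists_leftInverse_of_injective hinj
  have hne : c - l y ≠ 0 := (sub_neg.2 h.lt).ne
  -- ρ takes the value 1 on all vectors from y to the hyperplane l = c. It homogenizes the affine
  -- function k - d into a linear functional m with m (e z - y) = k z - d.
  let ρ : E →ₗ[ℝ] ℝ := (c - l y)⁻¹ • l.toLinearMap
  let m : E →ₗ[ℝ] ℝ := k.toLinearMap ∘ₗ g ∘ₗ
    (LinearMap.id - ρ.smulRight (e 0 - y)) - d • ρ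
  have hm : ∀ z, m (e z - y) = k z - d := by
    intro z
    have h1 : ρ (e z - y) = 1 := by
      simp [ρ, h.apply_eq z, hne]
    have h2 : e z - y - (e 0 - y) = e.linear z := by
      rw [sub_sub_sub_cancel_right]
      have := e.linearMap_vsub z 0
      simpa using this.symm
    have h3 : g (e.linear z) = z := by
      rw [← LinearMap.comp_apply, hg, LinearMap.id_apply]
    simp only [m, LinearMap.sub_apply, LinearMap.comp_apply, LinearMap.smulRight_apply, h1,
      LinearMap.id_apply, one_smul, h2, h3, LinearMap.smul_apply, smul_eq_mul, mul_one,
      ContinuousLinearMap.coe_coe]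
  have key : ∀ i ∈ V, ∃ t : ℝ, 0 < t ∧ k (w i) - d = t * (m (u i) - m y) := by
    intro i hi
    obtain ⟨t, ht, h1⟩ := exists_schlegelProjection_sub ((h.le i (hV hi)).trans_lt h.lt) h.lt
    refine ⟨t, ht, ?_⟩
    rw [← hm, h.map i (hV hi), h1, map_smul, map_sub, smul_eq_mul]
  refine ⟨LinearMap.toContinuousLinearMap m, m y, fun i hi => ?_, ?_⟩
  · obtain ⟨t, ht, h1⟩ := key i hi
    have h2 := hk i hi
    simp only [LinearMap.coe_toContinuousLinearMap']
    by_contra hcon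
    have := mul_pos ht (sub_pos.2 (not_le.1 hcon))
    linarith
  · ext i
    simp only [Set.mem_ofPred_eq, LinearMap.coe_toContinuousLinearMap']
    refine and_congr_right fun hi => ?_
    obtain ⟨t, ht, h1⟩ := key i hi
    rw [← sub_eq_zero, h1, mul_eq_zero, or_iff_right ht.ne', sub_eq_zero]

/-- A supporting hyperplane of W need not pass through y, but on V it may be tilted about its
intersection with a second hyperplane containing V. -/
theorem isFaceSet_image [FiniteDimensional ℝ E'] (h : IsSchlegelMap u I l c y e w) (hV : V ⊆ I)
    (hb : IsBeneath u I y V) (hW : IsFaceSet u I W) (hWV : W ⊆ V) : IsFaceSet w V W := by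
  obtain ⟨l₁, c₁, h1, rfl⟩ := hW
  obtain ⟨l₂, c₂, h2, h2', hy⟩ := hb
  -- Chosen so that m (u i) - m y = l₁ (u i) - c₁ for i in V, where l₂ is constantly c₂. The
  -- denominator is positive because y is strictly beneath.
  set κ := (c₁ - l₁ y) / (c₂ - l₂ y) with hκ
  have hκ' : κ * (c₂ - l₂ y) = c₁ - l₁ y := div_mul_cancel₀ _ (sub_pos.2 hy).ne'
  let m : StrongDual ℝ E := l₁ - κ • l₂
  have key : ∀ i ∈ V, ∃ t : ℝ, 0 < t ∧ m (e (w i)) - m y = t * (l₁ (u i) - c₁) := by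
    intro i hi
    obtain ⟨t, ht, h3⟩ := exists_schlegelProjection_sub ((h.le i (hV hi)).trans_lt h.lt) h.lt
    refine ⟨t, ht, ?_⟩
    rw [← map_sub, h.map i (hV hi), h3, map_smul, map_sub, smul_eq_mul]
    congr 1
    simp only [m, sub_apply, smul_apply, smul_eq_mul, h2' i hi]
    linarith
  have he : ∀ z, m (e z) = m (e.linear z) + m (e 0) := fun z => by
    rw [← map_add]
    congr 1
    have := e.linearMap_vsub z 0
    rw [vsub_eq_sub, sub_zero, vsub_eq_sub] at this
    rw [this, sub_add_cancel]
  refine ⟨LinearMap.toContinuousLinearMap (m.toLinearMap ∘ₗ e.linear), m y - m (e 0),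
    fun i hi => ?_, ?_⟩
  · obtain ⟨t, ht, h3⟩ := key i hi
    simp only [LinearMap.coe_toContinuousLinearMap', LinearMap.comp_apply,
      ContinuousLinearMap.coe_coe]
    have := mul_nonneg ht.le (sub_nonneg.2 (h1 i (hV hi)))
    rw [he] at h3
    linarith
  · ext i
    simp only [Set.mem_ofPred_eq, LinearMap.coe_toContinuousLinearMap', LinearMap.comp_apply,
      ContinuousLinearMap.coe_coe]
    constructor
    · intro hi
      refine ⟨hWV hi, ?_⟩
      obtain ⟨t, ht, h3⟩ := key i (hWV hi)
      rw [hi.2, sub_self, mul_zero, he] at h3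
      linarith
    · rintro ⟨hi, h4⟩
      refine ⟨hV hi, ?_⟩
      obtain ⟨t, ht, h3⟩ := key i hi
      have h5 : t * (l₁ (u i) - c₁) = 0 := by
        rw [← h3, he]
        linarith
      exact sub_eq_zero.1 ((mul_eq_zero.1 h5).resolve_left ht.ne')

/-- Injectivity on the far side lifts a common point of two projected hulls to one common point of
the original hulls, where faces of P intersect well. -/
theorem hull_inter (h : IsSchlegelMap u I l c y e w) (hV : IsFaceSet u I V)
    (hV' : V' ⊆ I) (hb : IsBeneath u I y V) (hb' : IsBeneath u I y V') :
    convexHull ℝ (w '' V) ∩ convexHull ℝ (w '' V') = convexHull ℝ (w '' (V ∩ V')) := by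
  refine Set.Subset.antisymm ?_ (Set.subset_inter
    (convexHull_mono (Set.image_mono Set.inter_subset_left))
    (convexHull_mono (Set.image_mono Set.inter_subset_right)))
  rintro z ⟨hz, hz'⟩
  obtain ⟨x, hx, hxz⟩ := (h.image_hull hV.subset).subset (Set.mem_image_of_mem e hz)
  obtain ⟨x', hx', hxz'⟩ := (h.image_hull hV').subset (Set.mem_image_of_mem e hz')
  obtain rfl := hb.schlegelProjection_inj h.le h.lt hb' hV.subset hV' hx hx' (hxz.trans hxz'.symm)
  have h1 := Set.mem_image_of_mem (schlegelProjection l c y)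
    ((hV.hull_inter hV').subset ⟨hx, hx'⟩)
  rw [hxz, ← h.image_hull (Set.inter_subset_left.trans hV.subset), h.inj.mem_set_image] at h1
  exact h1

theorem hull_subset (h : IsSchlegelMap u I l c y e w) (hV : V ⊆ I) (hV' : V' ⊆ I)
    (hb : IsBeneath u I y V) (hb' : IsBeneath u I y V')
    (hsub : convexHull ℝ (w '' V) ⊆ convexHull ℝ (w '' V')) :
    convexHull ℝ (u '' V) ⊆ convexHull ℝ (u '' V') := by
  intro x hx
  have h1 := Set.mem_image_of_mem (schlegelProjection l c y) hx
  rw [← h.image_hull hV] at h1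
  obtain ⟨x', hx', heq⟩ := (h.image_hull hV').subset (Set.image_mono hsub h1)
  rwa [hb.schlegelProjection_inj h.le h.lt hb' hV hV' hx hx' heq.symm]

end IsSchlegelMap

/-- Affine coordinates on a hyperplane. -/
theorem exists_hyperplane_coordinates {d : ℕ} [FiniteDimensional ℝ E]
    (hE : Module.finrank ℝ E = d + 1) {l : StrongDual ℝ E} (hl : l ≠ 0) (c : ℝ) :
    ∃ e : EuclideanSpace ℝ (Fin d) →ᵃ[ℝ] E, Function.Injective e ∧ Set.range e = {x | l x = c} := by
  have hl' : l.toLinearMap ≠ 0 := fun h => hl (ContinuousLinearMap.coe_injective h)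
  have h1 := Module.Dual.finrank_ker_add_one_of_ne_zero hl'
  obtain ⟨φ⟩ : Nonempty (EuclideanSpace ℝ (Fin d) ≃ₗ[ℝ] LinearMap.ker l.toLinearMap) :=
    ⟨LinearEquiv.ofFinrankEq _ _ (by rw [finrank_euclideanSpace_fin]; omega)⟩
  obtain ⟨x₀, hx₀⟩ := LinearMap.surjective hl' c
  refine ⟨((LinearMap.ker l.toLinearMap).subtype ∘ₗ φ.toLinearMap).toAffineMap +
    AffineMap.const ℝ _ x₀, fun z z' hz => ?_, ?_⟩
  · simpa using hz
  · ext x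
    constructor
    · rintro ⟨z, rfl⟩
      have := (φ z).2
      rw [LinearMap.mem_ker] at this
      simp only [ContinuousLinearMap.coe_coe] at this hx₀
      simp [this, hx₀]
    · intro hx
      have hx' : l x = c := hx
      refine ⟨φ.symm ⟨x - x₀, ?_⟩, by simp⟩
      rw [LinearMap.mem_ker, map_sub, hx₀, ContinuousLinearMap.coe_coe, hx', sub_self]

/-- The hull of a finite nonempty family has a relatively interior point. -/
theorem exists_relatively_interior_point [Finite ι] (hW : W.Nonempty) :
    ∃ p ∈ convexHull ℝ (u '' W), ∀ (l : StrongDual ℝ E) (c : ℝ), (∀ i ∈ W, l (u i) ≤ c) →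
      (∃ i ∈ W, l (u i) ≠ c) → l p < c := by
  classical
  have := Fintype.ofFinite ι
  have hs : (W.toFinset).Nonempty := Set.toFinset_nonempty.2 hW
  have hpos : (0 : ℝ) < W.toFinset.card := by exact_mod_cast hs.card_pos
  refine ⟨W.toFinset.centerMass (fun _ => (1 : ℝ)) u, ?_, fun l c hl hne => ?_⟩
  · refine Finset.centerMass_mem_convexHull _ (fun _ _ => zero_le_one) (by rw [Finset.sum_const, nsmul_eq_mul, mul_one]; exact hpos)
      fun i hi => Set.mem_image_of_mem u (Set.mem_toFinset.1 hi)
  · obtain ⟨k, hk, hkc⟩ := hne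
    have h1 : ∑ i ∈ W.toFinset, l (u i) < ∑ _i ∈ W.toFinset, c :=
      Finset.sum_lt_sum (fun i hi => hl i (Set.mem_toFinset.1 hi))
        ⟨k, Set.mem_toFinset.2 hk, lt_of_le_of_ne (hl k hk) hkc⟩
    rw [Finset.sum_const, nsmul_eq_mul] at h1
    rw [Finset.centerMass]
    simp only [Finset.sum_const, nsmul_eq_mul, mul_one, one_smul, map_smul, map_sum, smul_eq_mul]
    rw [inv_mul_lt_iff₀ hpos]
    exact h1

end Schlegel


/-! ### Schlegel diagrams of sphere polytopes -/

section SchlegelDiagrams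

theorem SignVec.exists_isFace_dim_succ {n : ℕ} {α β : SignVec n} (h : IsFace α β) (hne : α ≠ β) :
    ∃ γ, IsFace α γ ∧ IsFace γ β ∧ dim γ = dim α + 1 := by
  obtain ⟨j, hj⟩ := Function.ne_iff.1 hne
  have hβ : β j = 0 := (h j).resolve_right hj
  have hα : α j ≠ 0 := hβ ▸ hj
  refine ⟨Function.update α j 0, isFace_update α j, fun i => ?_, ?_⟩
  · by_cases hi : i = j
    · subst hi; exact Or.inl hβ
    · simpa [hi] using h i
  · have h1 : zeroSet (Function.update α j 0) = insert j (zeroSet α) := by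
      ext x
      rw [mem_zeroSet, SignVec.update_eq_zero_iff, Finset.mem_insert, mem_zeroSet]
    rw [dim, h1, Finset.card_insert_of_notMem (by rwa [mem_zeroSet]), dim]

theorem SignVec.exists_isFace_dim_pred {n : ℕ} {α : SignVec n} (h : dim α ≠ 0) :
    ∃ γ, IsFace γ α ∧ dim α = dim γ + 1 := by
  obtain ⟨j, hj⟩ := Finset.card_ne_zero.1 h
  rw [mem_zeroSet] at hj
  have h2 : IsFace (Function.update α j 1) α := fun i => by
    by_cases hi : i = j
    · subst hi; exact Or.inl hj
    · simp [hi]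
  refine ⟨Function.update α j 1, h2, ?_⟩
  have h1 : zeroSet α = insert j (zeroSet (Function.update α j 1)) := by
    ext x
    rw [Finset.mem_insert, mem_zeroSet, mem_zeroSet]
    by_cases hx : x = j
    · subst hx; simp [hj]
    · simp [hx]
  conv_lhs => rw [dim, h1]
  rw [Finset.card_insert_of_notMem (by simp [mem_zeroSet]), dim]

theorem SignVec.exists_mem_sphereFacets {q : ℕ} (hq : 4 ≤ q) : (sphereFacets q).Nonempty := by
  obtain ⟨β, hβ, -⟩ := (mem_neighborlyCubicalSphere hq).1
    (isCubicallyNeighborly_sphere hq (1 : SignVec q) (by simp [dim, zeroSet]))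
  exact ⟨β, hβ⟩

namespace IsSpherePolytope

variable {E : Type*} [NormedAddCommGroup E] [NormedSpace ℝ E] {q : ℕ} {P : Set E}
  {u : SignVec q → E}

theorem verts_eq_of_cut (H : IsSpherePolytope q P u) {l : StrongDual ℝ E} {c : ℝ} {α : SignVec q}
    (hl : ∀ ε ∈ {ε | IsVertex ε}, l (u ε) ≤ c) (h : cell u α = {x | x ∈ P ∧ l x = c}) :
    verts α = {ε | ε ∈ {ε | IsVertex ε} ∧ l (u ε) = c} := by
  refine H.indep.hull_inj (verts_subset_isVertex α) (fun ε h => h.1) ?_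
  rw [← hull_inter_eq hl, ← H.hull]
  exact h

theorem cut_of_verts_eq (H : IsSpherePolytope q P u) {l : StrongDual ℝ E} {c : ℝ} {α : SignVec q}
    (hl : ∀ ε ∈ {ε | IsVertex ε}, l (u ε) ≤ c)
    (h : verts α = {ε | ε ∈ {ε | IsVertex ε} ∧ l (u ε) = c}) :
    cell u α = {x | x ∈ P ∧ l x = c} := by
  rw [cell, h, ← hull_inter_eq hl, ← H.hull]

theorem le_of_valid (H : IsSpherePolytope q P u) {l : StrongDual ℝ E} {c : ℝ}
    (h : ∀ x ∈ P, l x ≤ c) : ∀ ε ∈ {ε : SignVec q | IsVertex ε}, l (u ε) ≤ c := fun ε hε =>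
  h _ (H.hull ▸ subset_convexHull ℝ _ ⟨ε, hε, rfl⟩)

theorem isFacet_cell (H : IsSpherePolytope q P u) {β : SignVec q} (hβ : β ∈ sphereFacets q) :
    IsFacet P (cell u β) :=
  H.facets.superset ⟨β, hβ, rfl⟩

theorem cell_injective (H : IsSpherePolytope q P u) : Function.Injective (cell u) := fun _ _ h =>
  (H.cell_subset_iff.1 h.subset).antisymm (H.cell_subset_iff.1 h.superset)

/-- Every facet admits a point beyond it. -/
theorem exists_isBeyondFacet (H : IsSpherePolytope q P u) : ∃ F l c y, IsBeyondFacet P F l c y := by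
  have hq := H.four_le
  obtain ⟨β₀, hβ₀⟩ := SignVec.exists_mem_sphereFacets hq
  have hcut : ∀ β : sphereFacets q, ∃ (l : StrongDual ℝ E) (c : ℝ),
      (∀ ε ∈ {ε | IsVertex ε}, l (u ε) ≤ c) ∧
      verts β.1 = {ε | ε ∈ {ε | IsVertex ε} ∧ l (u ε) = c} := fun β => H.isFaceSet_of_facet β.2
  choose l c hl hv using hcut
  -- The centre is p + t (p - o), with p relatively interior to the facet, o interior to the hull
  -- and t > 0 small. It crosses the inequality of this facet, while those of the finitely many
  -- other facets are strict at p and remain so.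
  obtain ⟨p, hp, hp'⟩ := exists_relatively_interior_point (u := u) (verts_nonempty β₀)
  obtain ⟨o, ho, ho'⟩ := exists_relatively_interior_point (u := u)
    (W := {ε : SignVec q | IsVertex ε}) ⟨1, fun _ => one_ne_zero⟩
  have hpt : l ⟨β₀, hβ₀⟩ p = c ⟨β₀, hβ₀⟩ := by
    have h1 : p ∈ cell u β₀ := hp
    rw [H.cut_of_verts_eq (hl ⟨β₀, hβ₀⟩) (hv ⟨β₀, hβ₀⟩)] at h1
    exact h1.2
  have hot : l ⟨β₀, hβ₀⟩ o < c ⟨β₀, hβ₀⟩ := by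
    refine ho' _ _ (hl _) ?_
    by_contra hcon
    push Not at hcon
    refine H.verts_ne ((mem_neighborlyCubicalSphere hq).2 ⟨β₀, hβ₀, .refl _⟩) ?_
    rw [hv ⟨β₀, hβ₀⟩]
    exact Set.Subset.antisymm (fun i hi => hi.1) fun i hi => ⟨hi, hcon i hi⟩
  have hpG : ∀ β : sphereFacets q, β.1 ≠ β₀ → l β p < c β := by
    intro β hne
    refine hp' _ _ (fun ε hε => hl β ε hε.1) ?_
    by_contra hcon
    push Not at hcon
    have h1 : verts β₀ ⊆ verts β.1 := fun ε hε => by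
      rw [hv β]
      exact ⟨hε.1, hcon ε hε⟩
    exact hne ((isFace_of_verts_subset h1).eq_of_dim_le
      (by rw [dim_of_mem_sphereFacets hq β.2, dim_of_mem_sphereFacets hq hβ₀])).symm
  have hev : ∀ᶠ t in nhdsWithin (0 : ℝ) (Set.Ioi 0), ∀ β : sphereFacets q, β.1 ≠ β₀ →
      l β (p + t • (p - o)) < c β := by
    refine Filter.Eventually.filter_mono nhdsWithin_le_nhds
      (Filter.eventually_all.2 fun β => ?_)
    by_cases hne : β.1 = β₀
    · exact Filter.Eventually.of_forall fun _ h => absurd hne h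
    · have hc : Continuous fun t : ℝ => l β (p + t • (p - o)) := by fun_prop
      have h0 : l β (p + (0 : ℝ) • (p - o)) < c β := by simpa using hpG β hne
      exact (hc.continuousAt.eventually_lt continuousAt_const h0).mono fun _ h _ => h
  obtain ⟨t, ht, ht0⟩ := (hev.and self_mem_nhdsWithin).exists
  have ht0' : 0 < t := ht0
  refine ⟨cell u β₀, l ⟨β₀, hβ₀⟩, c ⟨β₀, hβ₀⟩, p + t • (p - o), H.isFacet_cell hβ₀, fun x hx => ?_,
    H.cut_of_verts_eq (hl ⟨β₀, hβ₀⟩) (hv ⟨β₀, hβ₀⟩), ?_, ?_⟩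
  · rw [H.hull] at hx
    exact le_of_mem_hull (hl ⟨β₀, hβ₀⟩) hx
  · have := mul_pos ht0' (sub_pos.2 hot)
    simp only [map_add, map_smul, map_sub, smul_eq_mul, hpt]
    linarith
  · intro G l' c' hG hne hval hcut
    obtain ⟨β, hβ, rfl⟩ := H.facets.subset hG
    have hval' := H.le_of_valid hval
    have hv' := H.verts_eq_of_cut hval' hcut
    have hfac := (H.facetSet_iff (verts_nonempty β)).2 ⟨β, hβ, rfl⟩
    rw [hv ⟨β, hβ⟩] at hfac hv'
    -- `IsBeyondFacet` quantifies over all inequalities cutting out G, so the given one is compared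
    -- with the chosen one. Their slacks are proportional on P, and the centre is the affine
    -- combination (1 + t) p - t o of points of P.
    obtain ⟨s, hs, hscale⟩ := hfac.exists_scaling (hl ⟨β, hβ⟩) hval' hv'
    have hext : ∀ x ∈ convexHull ℝ (u '' {ε | IsVertex ε}),
        c ⟨β, hβ⟩ - l ⟨β, hβ⟩ x = s * (c' - l' x) := by
      intro x hx
      have h1 : x ∈ {x | (l ⟨β, hβ⟩ - s • l') x = c ⟨β, hβ⟩ - s * c'} := by
        refine convexHull_min ?_
          (convex_hyperplane (l ⟨β, hβ⟩ - s • l').toLinearMap.isLinear _) hx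
        rintro _ ⟨ε, hε, rfl⟩
        have := hscale ε hε
        simp only [Set.mem_ofPred_eq, ContinuousLinearMap.coe_coe, sub_apply, smul_apply,
          smul_eq_mul]
        linarith
      simp only [Set.mem_ofPred_eq, sub_apply, smul_apply, smul_eq_mul] at h1
      linarith
    have h2 := hext p (convexHull_mono (Set.image_mono (verts_subset_isVertex β₀)) hp)
    have h3 := hext o ho
    have h4 := ht ⟨β, hβ⟩ fun h0 => hne (by rw [← h0])
    simp only [map_add, map_smul, map_sub, smul_eq_mul] at h4 ⊢
    have h5 : 0 < s * (c' - (l' p + t * (l' p - l' o))) := by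
      have : s * (c' - (l' p + t * (l' p - l' o))) =
          (1 + t) * (s * (c' - l' p)) - t * (s * (c' - l' o)) := by ring
      rw [this, ← h2, ← h3]
      linarith
    linarith [(mul_pos_iff_of_pos_left hs).1 h5]

variable {F : Set E} {l : StrongDual ℝ E} {c : ℝ} {y : E}

theorem isBeneath_of_facet (H : IsSpherePolytope q P u) (hB : IsBeyondFacet P F l c y)
    {β : SignVec q} (hβ : β ∈ sphereFacets q) (hne : cell u β ≠ F) :
    IsBeneath u {ε | IsVertex ε} y (verts β) := by
  obtain ⟨l', c', hl', hv⟩ := H.isFaceSet_of_facet hβ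
  refine ⟨l', c', hl', fun ε hε => (hv ▸ hε : ε ∈ {ε | ε ∈ {ε | IsVertex ε} ∧ l' (u ε) = c'}).2,
    hB.beneath _ l' c' (H.isFacet_cell hβ) hne (fun x hx => ?_) (H.cut_of_verts_eq hl' hv)⟩
  rw [H.hull] at hx
  exact le_of_mem_hull hl' hx

/-- Every face of dimension at most two lies in a facet different from a given one. -/
theorem exists_facet_ne (H : IsSpherePolytope q P u) (hF : IsFacet P F) {α : SignVec q}
    (hα : α ∈ neighborlyCubicalSphere q) (hd : dim α ≤ 2) :
    ∃ β ∈ sphereFacets q, cell u β ≠ F ∧ IsFace α β := by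
  obtain ⟨β₀, hβ₀, rfl⟩ := H.facets.subset hF
  -- By dimension, the facet F has a vertex p not on α. A facet containing α but missing p differs
  -- from F.
  obtain ⟨p, hp, hpα⟩ : ∃ p ∈ verts β₀, p ∉ verts α := by
    by_contra hcon
    push Not at hcon
    have h1 := (isFace_of_verts_subset hcon).dim_le
    rw [dim_of_mem_sphereFacets H.four_le hβ₀] at h1
    omega
  obtain ⟨W, hW, hle, hpW⟩ := (H.isFaceSet_verts hα).exists_facetSet (p := p) hp.1 hpα
  obtain ⟨β, hβ, rfl⟩ := (H.facetSet_iff ((verts_nonempty α).mono hle)).1 hW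
  exact ⟨β, hβ, fun h => hpW (H.cell_injective h ▸ hp), isFace_of_verts_subset hle⟩

theorem exists_isSchlegelMap [FiniteDimensional ℝ E] {d : ℕ} (hE : Module.finrank ℝ E = d + 1)
    (H : IsSpherePolytope q P u) (hB : IsBeyondFacet P F l c y) :
    ∃ (e : EuclideanSpace ℝ (Fin d) →ᵃ[ℝ] E) (w : SignVec q → EuclideanSpace ℝ (Fin d)),
      IsSchlegelMap u {ε | IsVertex ε} l c y e w := by
  obtain ⟨x, hx⟩ := hB.facet.prop.2.1
  rw [hB.cut] at hx
  have hl : l ≠ 0 := by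
    rintro rfl
    have h1 := hB.beyond
    rw [← hx.2] at h1
    exact lt_irrefl _ h1
  obtain ⟨e, he, hr⟩ := exists_hyperplane_coordinates hE hl c
  have hle := H.le_of_valid hB.valid
  refine ⟨e, fun ε => Function.invFun e (schlegelProjection l c y (u ε)), hle, hB.beyond, he, hr,
    fun ε hε => Function.invFun_eq ?_⟩
  have h1 : schlegelProjection l c y (u ε) ∈ {x | l x = c} :=
    schlegelProjection_apply ((hle ε hε).trans_lt hB.beyond).ne
  rw [← hr] at h1
  exact h1

variable {E' : Type*} [NormedAddCommGroup E'] [NormedSpace ℝ E'] {e : E' →ᵃ[ℝ] E}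
  {w : SignVec q → E'}

theorem isFaceSet_schlegel_iff [FiniteDimensional ℝ E] [FiniteDimensional ℝ E']
    (H : IsSpherePolytope q P u) (hS : IsSchlegelMap u {ε | IsVertex ε} l c y e w)
    {α : SignVec q} (hα : α ∈ neighborlyCubicalSphere q)
    (hb : IsBeneath u {ε | IsVertex ε} y (verts α)) {W : Set (SignVec q)} (hW : W.Nonempty) :
    IsFaceSet w (verts α) W ↔ ∃ γ, IsFace γ α ∧ W = verts γ := by
  constructor
  · intro h
    have h1 := (hS.isFaceSet_of_image (verts_subset_isVertex α) h).trans (H.isFaceSet_verts hα)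
    obtain ⟨γ, -, rfl⟩ := H.exists_eq_verts h1 hW fun h0 =>
      H.verts_ne hα ((verts_subset_isVertex α).antisymm (h0 ▸ h.subset))
    exact ⟨γ, isFace_of_verts_subset h.subset, rfl⟩
  · rintro ⟨γ, hγ, rfl⟩
    exact hS.isFaceSet_image (verts_subset_isVertex α) hb
      (H.isFaceSet_verts (isCubicalComplex_neighborlyCubicalSphere H.four_le α hα γ hγ))
      hγ.verts_subset

/-- Dimensions strictly increase along chains of faces of β, also after projection. A chain through
α with one face in each of the dimensions 0 to 3 must fit into a 3-dimensional space, which leaves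
no slack: the bound from above counts down from β, the bound from below counts up from a vertex. -/
theorem finrank_vectorSpan_schlegel [FiniteDimensional ℝ E] [FiniteDimensional ℝ E']
    (hE' : Module.finrank ℝ E' = 3)
    (H : IsSpherePolytope q P u) (hS : IsSchlegelMap u {ε | IsVertex ε} l c y e w)
    {β : SignVec q} (hβ : β ∈ sphereFacets q) (hb : IsBeneath u {ε | IsVertex ε} y (verts β))
    {α : SignVec q} (hα : IsFace α β) :
    Module.finrank ℝ (vectorSpan ℝ (w '' verts α)) = dim α := by
  have hq := H.four_le
  have hlt : ∀ γ γ' : SignVec q, IsFace γ γ' → IsFace γ' β → γ ≠ γ' →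
      Module.finrank ℝ (vectorSpan ℝ (w '' verts γ)) <
        Module.finrank ℝ (vectorSpan ℝ (w '' verts γ')) := by
    intro γ γ' h h' hne
    refine ((H.isFaceSet_schlegel_iff hS ((mem_neighborlyCubicalSphere hq).2 ⟨β, hβ, h'⟩)
      (hb.mono h'.verts_subset) (verts_nonempty γ)).2 ⟨γ, h, rfl⟩).finrank_vectorSpan_lt
      (verts_nonempty γ) fun heq => hne (h.antisymm (isFace_of_verts_subset heq.superset))
  apply le_antisymm
  · have key : ∀ k, ∀ γ : SignVec q, IsFace γ β → dim γ + k = 3 →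
        Module.finrank ℝ (vectorSpan ℝ (w '' verts γ)) ≤ dim γ := by
      intro k
      induction k with
      | zero =>
        intro γ _ hd
        have := (vectorSpan ℝ (w '' verts γ)).finrank_le
        omega
      | succ k ih =>
        intro γ hγ hd
        have hdβ := dim_of_mem_sphereFacets hq hβ
        obtain ⟨δ, h1, h2, h3⟩ := SignVec.exists_isFace_dim_succ hγ
          (by rintro rfl; omega)
        have h4 := hlt γ δ h1 h2 (by rintro rfl; omega)
        have h5 := ih δ h2 (by omega)
        omega
    have h1 := hα.dim_le
    rw [dim_of_mem_sphereFacets hq hβ] at h1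
    exact key (3 - dim α) α hα (by omega)
  · have key : ∀ k, ∀ γ : SignVec q, IsFace γ β → dim γ = k →
        k ≤ Module.finrank ℝ (vectorSpan ℝ (w '' verts γ)) := by
      intro k
      induction k with
      | zero => exact fun _ _ _ => Nat.zero_le _
      | succ k ih =>
        intro γ hγ hd
        obtain ⟨δ, h1, h2⟩ := SignVec.exists_isFace_dim_pred (α := γ) (by omega)
        have h4 := hlt δ γ h1 hγ (by rintro rfl; omega)
        have h5 := ih δ (h1.trans hγ) (by omega)
        omega
    exact key _ α hα rfl

/-- Subcomplexes of dimension at most two are straightly embedded by Schlegel diagrams. -/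
theorem isStraightEmbedding_schlegel [FiniteDimensional ℝ E] [FiniteDimensional ℝ E']
    (hE' : Module.finrank ℝ E' = 3) (H : IsSpherePolytope q P u) (hB : IsBeyondFacet P F l c y)
    (hS : IsSchlegelMap u {ε | IsVertex ε} l c y e w) {C : Set (SignVec q)}
    (hC : C ⊆ neighborlyCubicalSphere q) (hd : ∀ α ∈ C, dim α ≤ 2) :
    IsStraightEmbedding C w := by
  have hfac : ∀ α ∈ C, ∃ β ∈ sphereFacets q, IsFace α β ∧
      IsBeneath u {ε | IsVertex ε} y (verts β) := fun α hα => by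
    obtain ⟨β, hβ, hne, hf⟩ := H.exists_facet_ne hB.facet (hC hα) (hd α hα)
    exact ⟨β, hβ, hf, H.isBeneath_of_facet hB hβ hne⟩
  have hb : ∀ α ∈ C, IsBeneath u {ε | IsVertex ε} y (verts α) := fun α hα => by
    obtain ⟨β, -, hf, hβ⟩ := hfac α hα
    exact hβ.mono hf.verts_subset
  have hle : ∀ α ∈ C, ∀ β ∈ C, cell w α ⊆ cell w β → IsFace α β := fun α hα β hβ h =>
    H.cell_subset_iff.1 (hS.hull_subset (verts_subset_isVertex α) (verts_subset_isVertex β)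
      (hb α hα) (hb β hβ) h)
  constructor
  · exact fun α hα β hβ h => (hle α hα β hβ h.subset).antisymm (hle β hβ α hα h.superset)
  · intro α hα
    obtain ⟨β, hβ, hf, hbβ⟩ := hfac α hα
    rw [cell, ← direction_affineSpan, affineSpan_convexHull, direction_affineSpan]
    exact H.finrank_vectorSpan_schlegel hE' hS hβ hbβ hf
  · intro α hα G
    rw [cell, isExposed_hull_iff]
    constructor
    · rintro ⟨W, hW, hne, rfl⟩
      obtain ⟨γ, hγ, rfl⟩ := (H.isFaceSet_schlegel_iff hS (hC hα) (hb α hα) hne).1 hW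
      exact ⟨γ, hγ, rfl⟩
    · rintro ⟨γ, hγ, rfl⟩
      exact ⟨verts γ, (H.isFaceSet_schlegel_iff hS (hC hα) (hb α hα)
        (verts_nonempty γ)).2 ⟨γ, hγ, rfl⟩, verts_nonempty γ, rfl⟩
  · exact fun α hα β hβ => hS.hull_inter (H.isFaceSet_verts (hC hα)) (verts_subset_isVertex β)
      (hb α hα) (hb β hβ)

theorem image_cell_mem_schlegelDiagram (H : IsSpherePolytope q P u)
    (hB : IsBeyondFacet P F l c y) (hS : IsSchlegelMap u {ε | IsVertex ε} l c y e w)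
    {α : SignVec q} (hα : α ∈ neighborlyCubicalSphere q) (hd : dim α ≤ 2) :
    e '' cell w α ∈ schlegelDiagram P F l c y := by
  refine ⟨cell u α, H.isProperFace_cell hα, fun h => ?_, hS.image_hull (verts_subset_isVertex α)⟩
  obtain ⟨β, hβ, hβF⟩ := H.facets.subset hB.facet
  have h1 := dim_of_mem_sphereFacets H.four_le hβ
  rw [H.cell_injective (hβF.trans h.symm)] at h1
  omega

end IsSpherePolytope

end SchlegelDiagrams

/-! ### The main theorem -/

theorem mainTheorem5 :
    -- the surface, its f-vector and its genus
    (∃ g : ℕ → ℕ,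
      (∀ q : ℕ, 3 ≤ q →
        IsEquivelarSurface 4 q (mirrorComplex (polygonBoundary q)) ∧
        faceCount (mirrorComplex (polygonBoundary q)) 0 = 2 ^ q ∧
        faceCount (mirrorComplex (polygonBoundary q)) 1 = 2 ^ (q - 1) * q ∧
        faceCount (mirrorComplex (polygonBoundary q)) 2 = 2 ^ (q - 2) * q ∧
        HasGenus (mirrorComplex (polygonBoundary q)) (g q) ∧
        (g q : ℤ) = 1 + 2 ^ (q - 3) * ((q : ℤ) - 4)) ∧
      (fun q : ℕ => (g q : ℝ)) =O[Filter.atTop]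
        (fun q : ℕ => (faceCount (mirrorComplex (polygonBoundary q)) 0 : ℝ) *
          Real.log (faceCount (mirrorComplex (polygonBoundary q)) 0 : ℝ))) ∧
    (∀ q : ℕ, 4 ≤ q →
      -- the neighborly cubical sphere contains the surface
      IsCubicallyNeighborly 2 (neighborlyCubicalSphere q) ∧
      IsSubcomplex (mirrorComplex (polygonBoundary q)) (neighborlyCubicalSphere q) ∧
      IsSubcomplex (mirrorComplex (polygonTriangulation q)) (neighborlyCubicalSphere q) ∧
      -- the neighborly cubical polytope exists
      (∃ (P : Set (EuclideanSpace ℝ (Fin (3 + 1))))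
        (v : SignVec q → EuclideanSpace ℝ (Fin (3 + 1))),
        IsNeighborlyCubicalPolytope 3 q P v) ∧
      -- in each realization, the surface is a subcomplex of the boundary
      -- and of every Schlegel diagram, where it is straightly embedded in 3-space
      ∀ (P : Set (EuclideanSpace ℝ (Fin (3 + 1))))
        (v : SignVec q → EuclideanSpace ℝ (Fin (3 + 1))),
        IsNeighborlyCubicalPolytope 3 q P v →
        IsBoundaryComplex (neighborlyCubicalSphere q) P (fun ε => v (SignVec.reverseFlip ε)) ∧
        IsBoundarySubcomplex (mirrorComplex (polygonBoundary q)) P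
          (fun ε => v (SignVec.reverseFlip ε)) ∧
        (∃ F l c y, IsBeyondFacet P F l c y) ∧
        ∀ F l c y, IsBeyondFacet P F l c y →
          ∃ (e : EuclideanSpace ℝ (Fin 3) →ᵃ[ℝ] EuclideanSpace ℝ (Fin (3 + 1)))
            (w : SignVec q → EuclideanSpace ℝ (Fin 3)),
            Function.Injective e ∧
            Set.range e = {x | l x = c} ∧
            (∀ α ∈ mirrorComplex (polygonBoundary q),
              e '' cell w α =
                schlegelProjection l c y '' cell (fun ε => v (SignVec.reverseFlip ε)) α ∧
              e '' cell w α ∈ schlegelDiagram P F l c y) ∧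
            IsStraightEmbedding (mirrorComplex (polygonBoundary q)) w) := by
  obtain ⟨g, hg, hO⟩ := exists_genus
  refine ⟨⟨g, fun q hq => ⟨isEquivelarSurface_mirror hq, faceCount_zero hq, faceCount_one,
    faceCount_two hq, hasGenus_mirror hq (hg q hq), hg q hq⟩, hO⟩, fun q hq => ?_⟩
  have hQ := isCubicalComplex_mirror_polygonBoundary (n := q) (by omega)
  have hsub := mirror_polygonBoundary_subset_sphere hq
  have hS := isCubicalComplex_neighborlyCubicalSphere hq
  refine ⟨isCubicallyNeighborly_sphere hq, ⟨hQ, hS, hsub⟩,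
    ⟨isCubicalComplex_mirror_polygonTriangulation (by omega), hS,
      mirror_polygonTriangulation_subset hq⟩,
    exists_neighborlyCubicalPolytope hq, fun P v hP => ?_⟩
  have H := hP.isSpherePolytope hq
  refine ⟨H.isBoundaryComplex, H.isBoundarySubcomplex hQ hsub, H.exists_isBeyondFacet,
    fun F l c y hB => ?_⟩
  obtain ⟨e, w, hw⟩ := H.exists_isSchlegelMap (d := 3) (by simp) hB
  refine ⟨e, w, hw.inj, hw.range, fun α hα => ⟨hw.image_hull (verts_subset_isVertex α),
    H.image_cell_mem_schlegelDiagram hB hw (hsub hα) (dim_le_two_of_mem_mirror_polygonBoundary hα)⟩,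
    H.isStraightEmbedding_schlegel (by simp) hB hw hsub fun α hα =>
      dim_le_two_of_mem_mirror_polygonBoundary hα⟩
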